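/- Let $X$ be a complex manifold of dimension $n\ge 2$ (Hausdorff, second countable, not necessarily compact or kählerian) endowed with a nowhere vanishing holomorphic section $\Omega$ of the canonical bundle $K_X=\Lambda^nT^*X$, and let $J$ be its almost complex structure. Let $g$ be a hermitian metric on $X$, i.e. a smooth riemannian metric with $g(J\cdot,J\cdot)=g$, with Kähler form $\omega(V,W)=g(JV,W)$. Let $d^*=-{*}\,d\,{*}$, where $*$ is the riemannian Hodge star operator of $g$, let $d^c=i(\bar\partial-\partial)$, and let $\|\Omega\|_\omega>0$ be the function defined by $$\|\Omega\|_\omega^2\,\frac{\omega^n}{n!}=(-1)^{\frac{n(n-1)}{2}}\,i^n\,\Omega\wedge\overline{\Omega}.$$ Let $\nabla^g$ be the Levi-Civita connection of $g$ and let $$\nabla^B=\nabla^g-\tfrac12\,g^{-1}d^c\omega$$ be the Bismut connection, i.e. $g(\nabla^B_UV,W)=g(\nabla^g_UV,W)-\frac12\,d^c\omega(U,V,W)$. 1. If $g$ solves the dilatino equation $$d^*\omega=d^c\log\|\Omega\|_\omega,$$ then the holonomy of $\nabla^B$ is contained in $SU(n)$: for every $x\in X$, the parallel transport of $\nabla^B$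 along every piecewise smooth loop based at $x$ is a $\mathbb C$-linear isometry of $(T_xX,J_x,g_x)$ of complex determinant $1$. 2. Conversely, if $X$ is compact and the holonomy of $\nabla^B$ is contained in $SU(n)$ in this sense, then $g$ solves the dilatino equation. -/

import Mathlib

open Bundle Set Module
open scoped Manifold ContDiff Topology

noncomputable section

namespace CalabiYau

/-! ### Differential forms and the exterior derivative -/

/-- The smooth manifold that underlies a complex manifold. -/
instance instIsManifoldReal {E : Type*} [NormedAddCommGroup E] [NormedSpace ℂ E]
    {X : Type*} [TopologicalSpace X] [ChartedSpace E X] [IsManifold 𝓘(ℂ, E) ω X] :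
    IsManifold 𝓘(ℝ, E) ω X := by
  apply isManifold_of_contDiffOn
  intro e e' he he'
  have h1 := (contDiffGroupoid ω 𝓘(ℂ, E)).compatible he he'
  rw [contDiffGroupoid, mem_groupoid_of_pregroupoid] at h1
  exact ContDiffOn.restrict_scalars ℝ h1.1

/-- The `F`-valued differential forms of degree `k` on `X` (with no condition of smoothness). -/
abbrev Form (𝕜 : Type*) [NontriviallyNormedField 𝕜] (E : Type*) [NormedAddCommGroup E]
    [NormedSpace 𝕜 E] (X : Type*) [TopologicalSpace X] [ChartedSpace E X]
    (F : Type*) [NormedAddCommGroup F] [NormedSpace 𝕜 F] (k : ℕ) :=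
  ∀ x : X, TangentSpace 𝓘(𝕜, E) x [⋀^Fin k]→L[𝕜] F

section Forms

variable {𝕜 : Type*} [NontriviallyNormedField 𝕜] {E : Type*} [NormedAddCommGroup E]
  [NormedSpace 𝕜 E] {X : Type*} [TopologicalSpace X] [ChartedSpace E X]
  [IsManifold 𝓘(𝕜, E) 1 X] {F : Type*} [NormedAddCommGroup F] [NormedSpace 𝕜 F] {k : ℕ}

/-- The expression of a differential form in the preferred chart at `x`: a form on the model
space `E`, meaningful on the target of the chart. -/
def Form.inChart (α : Form 𝕜 E X F k) (x : X) (y : E) : E [⋀^Fin k]→L[𝕜] F :=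
  (α ((extChartAt 𝓘(𝕜, E) x).symm y)).compContinuousLinearMap
    ((trivializationAt E (TangentSpace 𝓘(𝕜, E)) x).symmL 𝕜 ((extChartAt 𝓘(𝕜, E) x).symm y))

/-- The exterior derivative, computed at each point in the preferred chart at that point. -/
def Form.d (α : Form 𝕜 E X F k) : Form 𝕜 E X F (k + 1) := fun x =>
  (extDeriv (α.inChart x) (extChartAt 𝓘(𝕜, E) x x)).compContinuousLinearMap
    ((trivializationAt E (TangentSpace 𝓘(𝕜, E)) x).continuousLinearMapAt 𝕜 x)

end Forms

/-! ### Linear algebra on the tangent spaces -/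

section LinearAlgebra

variable {E : Type*} [NormedAddCommGroup E] [NormedSpace ℂ E]

/-- The complex structure of a complex vector space, as a real endomorphism. -/
def cplxJ (E : Type*) [NormedAddCommGroup E] [NormedSpace ℂ E] : E →L[ℝ] E :=
  (Complex.I • ContinuousLinearMap.id ℂ E).restrictScalars ℝ

@[simp] lemma cplxJ_apply (v : E) : cplxJ E v = Complex.I • v := rfl

variable [FiniteDimensional ℂ E]

/-- The real basis `e₁, i e₁, e₂, i e₂, …` of `E`, for a complex basis `e₁, e₂, …` of `E`.
It is positive for the orientation defined by the complex structure. -/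
def realBasis (E : Type*) [NormedAddCommGroup E] [NormedSpace ℂ E] [FiniteDimensional ℂ E] :
    Basis (Fin (2 * finrank ℂ E)) ℝ E :=
  (Complex.basisOneI.smulTower' (finBasis ℂ E)).reindex
    (finProdFinEquiv.trans (finCongr (mul_comm _ _)))

/-- The Gram matrix of an inner product in the real basis. -/
def gram (B : E →L[ℝ] E →L[ℝ] ℝ) :
    Matrix (Fin (2 * finrank ℂ E)) (Fin (2 * finrank ℂ E)) ℝ :=
  Matrix.of fun i j => B (realBasis E i) (realBasis E j)

/-- The isomorphism `B⁻¹ : E* → E` that is defined by an inner product `B`. -/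
def sharp (B : E →L[ℝ] E →L[ℝ] ℝ) : (E →L[ℝ] ℝ) →ₗ[ℝ] E :=
  ∑ i, ∑ j, (gram B)⁻¹ i j •
    ((LinearMap.applyₗ (realBasis E i)).comp (ContinuousLinearMap.coeLM ℝ)).smulRight
      (realBasis E j)

/-- The volume form of an inner product, for the orientation defined by the complex structure.
(The number `m` is the real dimension.) -/
def volForm (B : E →L[ℝ] E →L[ℝ] ℝ) {m : ℕ} (h : 2 * finrank ℂ E = m) : E [⋀^Fin m]→L[ℝ] ℝ :=
  √(gram B).det •
    { ((realBasis E).reindex (finCongr h)).det with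
      cont := by
        have : FiniteDimensional ℝ E := FiniteDimensional.complexToReal E
        change Continuous fun v => ((realBasis E).reindex (finCongr h)).det v
        simp only [Basis.det_apply]
        refine Continuous.matrix_det (continuous_matrix fun i j => ?_)
        simp only [Basis.toMatrix_apply]
        exact (LinearMap.continuous_of_finiteDimensional
          (((realBasis E).reindex (finCongr h)).coord i)).comp (continuous_apply j) }

/-- Contraction of a form with the vectors `u 0, u 1, …`, inserted in this order in the first
places. -/
def contract : (k : ℕ) → {l : ℕ} → (E [⋀^Fin (l + k)]→L[ℝ] ℝ) → (Fin k → E) →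
    E [⋀^Fin l]→L[ℝ] ℝ
  | 0, _, β, _ => β
  | k + 1, _, β, u => contract k (β.curryLeft (u 0)) (Fin.tail u)

/-- The Hodge star operator from `k`-forms to `l`-forms, where `k + l` is the real dimension:
`⋆β = (1/k!) ∑ β_{i₁ … i_k} B^{i₁ j₁} ⋯ B^{i_k j_k} vol(e_{j₁}, …, e_{j_k}, …)`,
so that `α ∧ ⋆β = ⟨α, β⟩ vol`. (It is `0` for other values of `l`.) -/
def hodgeStar (B : E →L[ℝ] E →L[ℝ] ℝ) {k : ℕ} (l : ℕ) (β : E [⋀^Fin k]→L[ℝ] ℝ) :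
    E [⋀^Fin l]→L[ℝ] ℝ :=
  if h : 2 * finrank ℂ E = l + k then
    (k.factorial : ℝ)⁻¹ • ∑ i : Fin k → Fin (2 * finrank ℂ E),
      ∑ j : Fin k → Fin (2 * finrank ℂ E),
        (β (realBasis E ∘ i) * ∏ a, (gram B)⁻¹ (i a) (j a)) •
          contract k (volForm B h) (realBasis E ∘ j)
  else 0

/-- The wedge product of alternating maps with values in a real algebra `A`. -/
def wedge {A : Type*} [CommRing A] [Algebra ℝ A] {k l : ℕ}
    (α : E [⋀^Fin k]→ₗ[ℝ] A) (β : E [⋀^Fin l]→ₗ[ℝ] A) : E [⋀^Fin (k + l)]→ₗ[ℝ] A :=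
  ((LinearMap.mul' ℝ A).compAlternatingMap (α.domCoprod β)).domDomCongr finSumFinEquiv

/-- The powers `β ∧ ⋯ ∧ β` of a form of degree two. -/
def wedgePow (β : E [⋀^Fin 2]→ₗ[ℝ] ℝ) : (m : ℕ) → E [⋀^Fin (2 * m)]→ₗ[ℝ] ℝ
  | 0 => AlternatingMap.constOfIsEmpty ℝ E (Fin 0) 1
  | m + 1 => wedge (wedgePow β m) β

/-- The complex conjugate of a complex valued form. -/
def conjForm {k : ℕ} (α : E [⋀^Fin k]→ₗ[ℝ] ℂ) : E [⋀^Fin k]→ₗ[ℝ] ℂ :=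
  (Complex.conjAe.toLinearMap).compAlternatingMap α

/-- The special unitary group of a complex vector space with a hermitian metric `B`. -/
def specialUnitary (B : E →L[ℝ] E →L[ℝ] ℝ) : Set (E →L[ℝ] E) :=
  {P | ∃ Q : E →L[ℂ] E, Q.restrictScalars ℝ = P ∧ (∀ v w, B (Q v) (Q w) = B v w) ∧
    LinearMap.det (Q : E →ₗ[ℂ] E) = 1}

end LinearAlgebra

/-! ### Hermitian metrics -/

section Metric

variable (E : Type*) [NormedAddCommGroup E] [NormedSpace ℂ E]
  (X : Type*) [TopologicalSpace X] [ChartedSpace E X] [IsManifold 𝓘(ℂ, E) ω X]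

/-- A hermitian metric on a complex manifold: a smooth riemannian metric `g` on the underlying
real manifold with `g(J·, J·) = g`. The charts being holomorphic, `J` is the multiplication by
`i` on each tangent space (which is identified with `E` by the preferred chart). -/
structure HermitianMetric extends
    ContMDiffRiemannianMetric 𝓘(ℝ, E) ∞ E (fun x : X => TangentSpace 𝓘(ℝ, E) x) where
  hermitian : ∀ (x : X) (v w : TangentSpace 𝓘(ℝ, E) x),
    inner x (cplxJ E v) (cplxJ E w) = inner x v w

/-- A nowhere vanishing holomorphic section of the canonical bundle: a Calabi-Yau manifold is a
complex manifold that is endowed with one. -/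
structure HolomorphicVolumeForm where
  toForm : Form ℂ E X ℂ (finrank ℂ E)
  holomorphic : ∀ x, DifferentiableOn ℂ (toForm.inChart x) (extChartAt 𝓘(ℂ, E) x).target
  ne_zero : ∀ x, toForm x ≠ 0

end Metric

section Hermitian

variable {E : Type*} [NormedAddCommGroup E] [NormedSpace ℂ E]
  {X : Type*} [TopologicalSpace X] [ChartedSpace E X] [IsManifold 𝓘(ℂ, E) ω X]

/-- The inner product on the tangent space at `x`. -/
abbrev HermitianMetric.at (g : HermitianMetric E X) (x : X) : E →L[ℝ] E →L[ℝ] ℝ := g.inner x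

/-- The Kähler form `ω(v, w) = g(Jv, w)`. -/
def HermitianMetric.kahlerForm (g : HermitianMetric E X) : Form ℝ E X ℝ 2 := fun x =>
  show E [⋀^Fin 2]→L[ℝ] ℝ from
  { toFun := fun v => g.at x (cplxJ E (v 0)) (v 1)
    map_update_add' := by
      intro _ v i a b
      fin_cases i <;> simp
    map_update_smul' := by
      intro _ v i c a
      fin_cases i <;> simp
    cont := by fun_prop
    map_eq_zero_of_eq' := by
      intro v i j hv hij
      have key : ∀ w : E, g.at x (cplxJ E w) w = 0 := by
        intro w
        have h1 : g.at x (cplxJ E (cplxJ E w)) (cplxJ E w) = g.at x (cplxJ E w) w :=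
          g.hermitian x (cplxJ E w) w
        have h2 : cplxJ E (cplxJ E w) = -w := by simp [smul_smul]
        have h3 : g.at x w (cplxJ E w) = g.at x (cplxJ E w) w := g.symm x w (cplxJ E w)
        rw [h2, map_neg, neg_apply, h3] at h1
        linarith
      have h01 : v 0 = v 1 := by
        fin_cases i <;> fin_cases j <;> simp_all
      change g.at x (cplxJ E (v 0)) (v 1) = 0
      rw [h01]
      exact key (v 1) }

/-- The action of the complex structure on `k`-forms, `α ↦ (-1)ᵏ α(J·, …, J·)`. On forms of type
`(p, q)` it is the multiplication by `i^(q - p)`. -/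
def Form.actJ {k : ℕ} (α : Form ℝ E X ℝ k) : Form ℝ E X ℝ k := fun x =>
  (-1 : ℝ) ^ k • (α x).compContinuousLinearMap (cplxJ E)

/-- The operator `d^c = J d J⁻¹` (with `J⁻¹ = (-1)ᵏ J` on `k`-forms). Since `d = ∂ + ∂̄` and `J` is
`i^(q - p)` on forms of type `(p, q)`, this is the operator `i (∂̄ - ∂)`. -/
def Form.dc {k : ℕ} (α : Form ℝ E X ℝ k) : Form ℝ E X ℝ (k + 1) :=
  Form.actJ (Form.d (fun x => (-1 : ℝ) ^ k • Form.actJ α x))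

/-- The coordinates of a vector field in the preferred chart at `x`. -/
def coords (σ : ∀ x : X, TangentSpace 𝓘(ℝ, E) x) (x z : X) : E :=
  (trivializationAt E (TangentSpace 𝓘(ℝ, E)) x (⟨z, σ z⟩ : TangentBundle 𝓘(ℝ, E) X)).2

lemma coords_self (σ : ∀ x : X, TangentSpace 𝓘(ℝ, E) x) (x : X) : coords σ x x = σ x :=
  (tangentBundleCore 𝓘(ℝ, E) X).coordChange_self (achart E x) x (mem_chart_source E x) (σ x)

variable [FiniteDimensional ℂ E]

/-- The Hodge star operator on differential forms. -/
def HermitianMetric.star (g : HermitianMetric E X) {k : ℕ} (l : ℕ) (α : Form ℝ E X ℝ k) :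
    Form ℝ E X ℝ l := fun x => hodgeStar (g.at x) l (α x)

/-- The codifferential `d* = - ⋆ d ⋆`. -/
def HermitianMetric.codiff (g : HermitianMetric E X) {k : ℕ} (α : Form ℝ E X ℝ (k + 1)) :
    Form ℝ E X ℝ k := fun x =>
  - g.star k (g.star (2 * finrank ℂ E - (k + 1)) α).d x

/-- The norm `‖Ω‖_ω`, defined by `‖Ω‖²_ω ωⁿ / n! = (-1)^(n(n-1)/2) iⁿ Ω ∧ Ω̄`. (Both sides are
evaluated at a basis of the tangent space.) -/
def HermitianMetric.normOmega (g : HermitianMetric E X) (Ω : HolomorphicVolumeForm E X) (x : X) :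
    ℝ :=
  let n := finrank ℂ E
  let Ωx : E [⋀^Fin n]→ₗ[ℝ] ℂ :=
    ((show E [⋀^Fin n]→L[ℂ] ℂ from Ω.toForm x).restrictScalars ℝ).toAlternatingMap
  let ωx : E [⋀^Fin 2]→ₗ[ℝ] ℝ :=
    (show E [⋀^Fin 2]→L[ℝ] ℝ from g.kahlerForm x).toAlternatingMap
  √(((-1) ^ (n * (n - 1) / 2) * Complex.I ^ n *
      wedge Ωx (conjForm Ωx) (realBasis E ∘ Fin.cast (two_mul n).symm)).re /
    ((n.factorial : ℝ)⁻¹ * wedgePow ωx n (realBasis E)))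

/-- The dilatino equation `d*ω = d^c log ‖Ω‖_ω`. -/
def HermitianMetric.IsDilatinoSolution (g : HermitianMetric E X)
    (Ω : HolomorphicVolumeForm E X) : Prop :=
  g.codiff (k := 1) g.kahlerForm =
    Form.dc (k := 0) (fun x : X =>
      ContinuousAlternatingMap.constOfIsEmpty ℝ (TangentSpace 𝓘(ℝ, E) x) (Fin 0)
        (Real.log (g.normOmega Ω x)))

/-! ### The Levi-Civita connection and the Bismut connection -/

/-- The coefficients of the metric in the preferred chart at `x`, as a function on the manifold
(meaningful on the source of the chart). -/
def HermitianMetric.coeff (g : HermitianMetric E X) (x z : X) : E →L[ℝ] E →L[ℝ] ℝ :=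
  let S : E →L[ℝ] E := (trivializationAt E (TangentSpace 𝓘(ℝ, E)) x).symmL ℝ z
  (g.at z).bilinearComp S S

/-- The Christoffel symbols of the first kind, for the derivative `D` of the coefficients of a
metric: `Γ(u, v)(w) = ½ (D_u(v, w) + D_v(u, w) - D_w(u, v))`. -/
def christoffelFirst {E : Type*} [NormedAddCommGroup E] [NormedSpace ℝ E]
    (D : E →L[ℝ] E →L[ℝ] E →L[ℝ] ℝ) (u v : E) : E →L[ℝ] ℝ :=
  (2 : ℝ)⁻¹ • (D u v + D v u - (D.flip u).flip v)

lemma christoffelFirst_apply {E : Type*} [NormedAddCommGroup E] [NormedSpace ℝ E]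
    (D : E →L[ℝ] E →L[ℝ] E →L[ℝ] ℝ) (u v w : E) :
    christoffelFirst D u v w = (2 : ℝ)⁻¹ * (D u v w + D v u w - D w u v) := rfl

/-- The Christoffel symbols of the Levi-Civita connection in the preferred chart at `x`, at the
point `x`: `g(Γ(u, v), w) = ½ (∂_u g(v, w) + ∂_v g(u, w) - ∂_w g(u, v))`. -/
def HermitianMetric.christoffel (g : HermitianMetric E X) (x : X) : E →ₗ[ℝ] E →ₗ[ℝ] E :=
  let D : E →L[ℝ] E →L[ℝ] E →L[ℝ] ℝ := mvfderiv 𝓘(ℝ, E) (g.coeff x) x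
  LinearMap.mk₂ ℝ (fun u v => sharp (g.at x) (christoffelFirst D u v))
    (fun u u' v => by
      rw [← (sharp (g.at x)).map_add]
      congr 1
      ext w
      have h : D (u + u') = D u + D u' := D.map_add u u'
      simp only [christoffelFirst_apply, add_apply, h, map_add]
      ring)
    (fun c u v => by
      rw [← (sharp (g.at x)).map_smul]
      congr 1
      ext w
      have h : D (c • u) = c • D u := D.map_smul c u
      simp only [christoffelFirst_apply, smul_apply, h, map_smul, smul_eq_mul]
      ring)
    (fun u v v' => by
      rw [← (sharp (g.at x)).map_add]
      congr 1
      ext w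
      have h : D (v + v') = D v + D v' := D.map_add v v'
      simp only [christoffelFirst_apply, add_apply, h, map_add]
      ring)
    (fun c u v => by
      rw [← (sharp (g.at x)).map_smul]
      congr 1
      ext w
      have h : D (c • v) = c • D v := D.map_smul c v
      simp only [christoffelFirst_apply, smul_apply, h, map_smul, smul_eq_mul]
      ring)

/-- The derivative at `x` of the coordinates of a vector field in the preferred chart at `x`. -/
def coordDeriv (σ : ∀ x : X, TangentSpace 𝓘(ℝ, E) x) (x : X) : E →L[ℝ] E :=
  mvfderiv 𝓘(ℝ, E) (coords σ x) x

/-- The Levi-Civita connection `∇_u σ = ∂_u σ + Γ(u, σ)`. -/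
def HermitianMetric.leviCivita (g : HermitianMetric E X) :
    CovariantDerivative 𝓘(ℝ, E) E (fun x : X => TangentSpace 𝓘(ℝ, E) x) where
  toFun σ x :=
    haveI : FiniteDimensional ℝ E := FiniteDimensional.complexToReal E
    coordDeriv σ x + LinearMap.toContinuousLinearMap ((g.christoffel x).flip (σ x))
  isCovariantDerivativeOnUniv := by
    constructor
    · intro σ σ' x hσ hσ' _
      have hx : x ∈ (trivializationAt E (TangentSpace 𝓘(ℝ, E)) x).baseSet :=
        FiberBundle.mem_baseSet_trivializationAt' x
      have h : coordDeriv (σ + σ') x = coordDeriv σ x + coordDeriv σ' x := by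
        have hev : coords (σ + σ') x =ᶠ[𝓝 x] coords σ x + coords σ' x := by
          filter_upwards [(trivializationAt E (TangentSpace 𝓘(ℝ, E)) x).open_baseSet.mem_nhds hx]
            with z hz
          exact ((trivializationAt E (TangentSpace 𝓘(ℝ, E)) x).linear ℝ hz).map_add _ _
        have h1 : mvfderiv 𝓘(ℝ, E) (coords (σ + σ') x) x =
            mvfderiv 𝓘(ℝ, E) (coords σ x + coords σ' x) x := by
          ext v
          simp only [mvfderiv, ContinuousLinearMap.comp_apply, hev.mfderiv_eq]
          rfl
        exact h1.trans (mvfderiv_add ((mdifferentiableAt_section _ _).1 hσ)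
          ((mdifferentiableAt_section _ _).1 hσ'))
      refine ContinuousLinearMap.ext fun v => ?_
      have e1 : coordDeriv (σ + σ') x v = coordDeriv σ x v + coordDeriv σ' x v := by
        rw [h]
        rfl
      exact (congrArg₂ (fun a b : E => a + b) e1
        ((g.christoffel x v).map_add (σ x) (σ' x))).trans (add_add_add_comm _ _ _ _)
    · intro σ f x hσ hf _
      have hx : x ∈ (trivializationAt E (TangentSpace 𝓘(ℝ, E)) x).baseSet :=
        FiberBundle.mem_baseSet_trivializationAt' x
      have h : coordDeriv (f • σ) x = f x • coordDeriv σ x +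
          (show E →L[ℝ] ℝ from mvfderiv 𝓘(ℝ, E) f x).smulRight (show E from σ x) := by
        have hev : coords (f • σ) x =ᶠ[𝓝 x] f • coords σ x := by
          filter_upwards [(trivializationAt E (TangentSpace 𝓘(ℝ, E)) x).open_baseSet.mem_nhds hx]
            with z hz
          exact ((trivializationAt E (TangentSpace 𝓘(ℝ, E)) x).linear ℝ hz).map_smul _ _
        have h1 : mvfderiv 𝓘(ℝ, E) (coords (f • σ) x) x =
            mvfderiv 𝓘(ℝ, E) (f • coords σ x) x := by
          ext v
          simp only [mvfderiv, ContinuousLinearMap.comp_apply, hev.mfderiv_eq]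
          rfl
        have h2 := h1.trans (mvfderiv_smul hf ((mdifferentiableAt_section _ _).1 hσ))
        rw [coords_self] at h2
        exact h2
      have key : ∀ (A G S : E) (a c : ℝ), (a • A + c • S) + a • G = a • (A + G) + c • S := by
        intros
        module
      refine ContinuousLinearMap.ext fun v => ?_
      have e1 : coordDeriv (f • σ) x v = f x • coordDeriv σ x v +
          (mvfderiv 𝓘(ℝ, E) f x v) • (show E from σ x) := by
        rw [h]
        rfl
      exact (congrArg₂ (fun a b : E => a + b) e1
        ((g.christoffel x v).map_smul (f x) (σ x))).trans (key _ _ _ _ _)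

/-- The `1`-form `g⁻¹ d^cω` with values in the endomorphisms of the tangent bundle:
`g((g⁻¹ d^cω)(u) v, w) = d^cω(u, v, w)`. -/
def HermitianMetric.torsionTerm (g : HermitianMetric E X) (x : X) : E →ₗ[ℝ] E →ₗ[ℝ] E :=
  let T : E [⋀^Fin 3]→L[ℝ] ℝ := Form.dc g.kahlerForm x
  LinearMap.mk₂ ℝ (fun u v => sharp (g.at x)
    ((ContinuousAlternatingMap.ofSubsingleton ℝ E ℝ (0 : Fin 1)).symm
      ((T.curryLeft u).curryLeft v)))
    (fun u u' v => by rw [← map_add]; congr 1; ext w; simp)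
    (fun c u v => by rw [← map_smul]; congr 1; ext w; simp)
    (fun u v v' => by rw [← map_add]; congr 1; ext w; simp)
    (fun c u v => by rw [← map_smul]; congr 1; ext w; simp)

/-- The Bismut connection `∇ᴮ = ∇ᵍ - ½ g⁻¹ d^cω`. -/
def HermitianMetric.bismut (g : HermitianMetric E X) :
    CovariantDerivative 𝓘(ℝ, E) E (fun x : X => TangentSpace 𝓘(ℝ, E) x) :=
  haveI : FiniteDimensional ℝ E := FiniteDimensional.complexToReal E
  g.leviCivita.addOneForm fun x =>
    show E →L[ℝ] E →L[ℝ] E from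
    LinearMap.toContinuousLinearMap
      ((LinearMap.toContinuousLinearMap (𝕜 := ℝ) (E := E) (F' := E)).toLinearMap ∘ₗ
        (-(2 : ℝ)⁻¹ • (g.torsionTerm x).flip))

end Hermitian

/-! ### Parallel transport and holonomy -/

section Holonomy

variable {E : Type*} [NormedAddCommGroup E] [NormedSpace ℝ E]
  {X : Type*} [TopologicalSpace X] [ChartedSpace E X] [IsManifold 𝓘(ℝ, E) 1 X]

/-- The vector field `V` along the curve `γ : [0, 1] → X` is parallel for the linear connection
`∇`: at each time `t`, in the preferred chart at `γ(t)`, it solves `V' + Γ(γ', V) = 0`, where the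
symbol `Γ(u, w)` is the covariant derivative in the direction `u` of the local vector field with
the constant coordinates `w`. -/
def IsParallelAlong (cov : CovariantDerivative 𝓘(ℝ, E) E (fun x : X => TangentSpace 𝓘(ℝ, E) x))
    (γ : ℝ → X) (V : ∀ t, TangentSpace 𝓘(ℝ, E) (γ t)) : Prop :=
  ∀ t ∈ Icc (0 : ℝ) 1,
    HasDerivWithinAt
      (fun s => (trivializationAt E (TangentSpace 𝓘(ℝ, E)) (γ t)
        (⟨γ s, V s⟩ : TangentBundle 𝓘(ℝ, E) X)).2)
      (-(cov (FiberBundle.extend E (V t)) (γ t) (mfderivWithin 𝓘(ℝ, ℝ) 𝓘(ℝ, E) γ (Icc 0 1) t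
        (1 : ℝ))) : E)
      (Icc 0 1) t

/-- `P : T_xX → T_yX` is the parallel transport along some piecewise smooth path from `x` to `y`:
a composition of parallel transports along smooth curves. -/
inductive IsParallelTransport
    (cov : CovariantDerivative 𝓘(ℝ, E) E (fun x : X => TangentSpace 𝓘(ℝ, E) x)) :
    (x y : X) → (TangentSpace 𝓘(ℝ, E) x →L[ℝ] TangentSpace 𝓘(ℝ, E) y) → Prop
  | segment (γ : ℝ → X) (hγ : ContMDiffOn 𝓘(ℝ, ℝ) 𝓘(ℝ, E) ∞ γ (Icc 0 1))
      (P : TangentSpace 𝓘(ℝ, E) (γ 0) →L[ℝ] TangentSpace 𝓘(ℝ, E) (γ 1))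
      (hP : ∀ v, ∃ V : ∀ t, TangentSpace 𝓘(ℝ, E) (γ t),
        IsParallelAlong cov γ V ∧ V 0 = v ∧ V 1 = P v) :
      IsParallelTransport cov (γ 0) (γ 1) P
  | trans {x y z : X} (P : TangentSpace 𝓘(ℝ, E) x →L[ℝ] TangentSpace 𝓘(ℝ, E) y)
      (Q : TangentSpace 𝓘(ℝ, E) y →L[ℝ] TangentSpace 𝓘(ℝ, E) z)
      (hP : IsParallelTransport cov x y P) (hQ : IsParallelTransport cov y z Q) :
      IsParallelTransport cov x z (Q.comp P)

/-- The holonomy group at `x`: the parallel transports along piecewise smooth loops at `x`. -/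
def holonomy (cov : CovariantDerivative 𝓘(ℝ, E) E (fun x : X => TangentSpace 𝓘(ℝ, E) x)) (x : X) :
    Set (TangentSpace 𝓘(ℝ, E) x →L[ℝ] TangentSpace 𝓘(ℝ, E) x) :=
  {P | IsParallelTransport cov x x P}

end Holonomy

/-- The holonomy of the Bismut connection is contained in the special unitary group. -/
def HermitianMetric.BismutHolonomyInSU {E : Type*} [NormedAddCommGroup E] [NormedSpace ℂ E]
    [FiniteDimensional ℂ E] {X : Type*} [TopologicalSpace X] [ChartedSpace E X]
    [IsManifold 𝓘(ℂ, E) ω X] (g : HermitianMetric E X) : Prop :=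
  ∀ x : X, (holonomy g.bismut x : Set (E →L[ℝ] E)) ⊆ specialUnitary (E := E) (g.at x)

end CalabiYau

end

/-!
# Bismut connections with special unitary holonomy and the dilatino equation

Both implications follow from one local identity. Let `θ = d*ω - d^c log ‖Ω‖`, so that the dilatino
equation says `θ = 0`. The Bismut connection `∇ᴮ` preserves `g` and `J`, hence it acts on the
canonical bundle, where `Ω / ‖Ω‖` has constant norm, and

  `∇ᴮ (Ω / ‖Ω‖) = -i θ ⊗ Ω / ‖Ω‖`.

Indeed, in holomorphic coordinates the connection is given by complex linear symbols `Γ(u)`, and the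
metric trace that defines `d*ω` is, up to a derivative of `log det g`, the imaginary part of
`tr_ℂ Γ(u)`; the real part is again a derivative of `log det g`. Combined with
`log ‖Ω‖ = const + log |Ω̂| - ¼ log det g`, where `Ω̂` is the holomorphic coefficient of `Ω`, this
gives the identity (`complex_trace_bismutEnd`, `HermitianMetric.trace_symbol`). The form `d*ω` is
defined through the Hodge star; it is brought into the form of a metric trace by the formulas for `⋆`
in degree `2` and in codegree `1` (`hodgeStar_two`, `hodgeStar_codegree_one`,
`extDeriv_star_kahler`), which yields `HermitianMetric.isDilatinoSolution_iff`.

Parallel transport is therefore isometric and complex linear, and it multiplies `Ω / ‖Ω‖` by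
`exp (-i ∫ θ)` (`HermitianMetric.hasDerivWithinAt_volume`). If `θ = 0`, then transport along a loop
fixes `Ω` at the base point and so has determinant `1` (`HermitianMetric.bismutHolonomyInSU`).

For the converse, let the holonomy be special unitary. Then `∮ θ ∈ 2πℤ` for every loop along which
the transport exists. It exists along short coordinate segments, by the Picard-Lindelöf theorem
(`HermitianMetric.exists_transport_chartSegment`), and around a small triangle the integral is too
small to be a nonzero multiple of `2π`. Hence `θ` is closed
(`HermitianMetric.fderiv_defectForm_symm`).

For a closed form `θ` the vector density `Z = ‖Ω‖ √det g · J θ♯` satisfies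

  `div Z = √det g · (d‖Ω‖(J θ♯) + ‖Ω‖ d*ω(θ♯)) = ‖Ω‖ √det g · |θ|²`,

since the trace of the symmetric derivative of `θ` against `J` vanishes
(`IsHermitianAt.divergence_smul_I`, `HermitianMetric.divergence_defectField`). The weight `‖Ω‖` is
what turns `d*ω` into `θ`. On a compact manifold the total divergence of a vector density is zero.
This is proved with a partition of unity: integration by parts in each chart
(`HermitianMetric.integral_divergence`), and invariance of the integrals under changes of charts
(`HermitianMetric.integral_fieldDensity`, `HermitianMetric.sum_integral_fieldDensity`). So `θ = 0`
(`HermitianMetric.defect_eq_zero`).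

In the local computations a hermitian metric enters only through its value and its first derivative
at a point, and all identities are stated for such first jets (`IsHermitianJet`); expressions in
different charts are compared by the transformation laws `HermitianMetric.symbol_transition` and
`HermitianMetric.defect_transition`.
-/

noncomputable section

namespace CalabiYau

/-! ### Hermitian inner products and metric traces -/

section MetricTrace

variable {E : Type*} [NormedAddCommGroup E] [NormedSpace ℂ E]

/-- A positive definite real inner product for which the multiplication by `i` is an isometry. -/
structure IsHermitianInner (B : E →L[ℝ] E →L[ℝ] ℝ) : Prop where
  symm : ∀ v w, B v w = B w v
  pos : ∀ v, v ≠ 0 → 0 < B v v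
  inv : ∀ v w, B (Complex.I • v) (Complex.I • w) = B v w

namespace IsHermitianInner

variable {B : E →L[ℝ] E →L[ℝ] ℝ} (hB : IsHermitianInner B)
include hB

lemma smul_I_left (v w : E) : B (Complex.I • v) w = -B v (Complex.I • w) := by
  have h := hB.inv v (Complex.I • w)
  rw [smul_smul, Complex.I_mul_I, neg_one_smul, map_neg] at h
  linarith

lemma ext_left {v v' : E} (h : ∀ w, B v w = B v' w) : v = v' := by
  by_contra hne
  have h1 := hB.pos (v - v') (sub_ne_zero.2 hne)
  have h2 : B (v - v') (v - v') = B v (v - v') - B v' (v - v') := by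
    rw [B.map_sub]; rfl
  rw [h2, h (v - v'), sub_self] at h1
  exact lt_irrefl _ h1

end IsHermitianInner

lemma inner_add (B : E →L[ℝ] E →L[ℝ] ℝ) (v v' w : E) : B (v + v') w = B v w + B v' w := by
  rw [B.map_add]; rfl

lemma inner_smul (B : E →L[ℝ] E →L[ℝ] ℝ) (c : ℝ) (v w : E) : B (c • v) w = c * B v w := by
  rw [B.map_smul]; rfl

lemma I_smul_I_smul (v : E) : Complex.I • Complex.I • v = -v := by
  rw [smul_smul, Complex.I_mul_I, neg_one_smul]

variable [FiniteDimensional ℂ E]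

lemma gram_apply (B : E →L[ℝ] E →L[ℝ] ℝ) (i j) : gram B i j = B (realBasis E i) (realBasis E j) :=
  rfl

lemma inner_eq_sum (B : E →L[ℝ] E →L[ℝ] ℝ) (v w : E) :
    B v w = ∑ i, ∑ j, (realBasis E).repr v i * gram B i j * (realBasis E).repr w j := by
  conv_lhs => rw [← (realBasis E).sum_repr v, ← (realBasis E).sum_repr w]
  simp only [map_sum, sum_apply, map_smul, smul_apply, smul_eq_mul, Finset.mul_sum,
    gram_apply]
  rw [Finset.sum_comm]
  exact Finset.sum_congr rfl fun i _ => Finset.sum_congr rfl fun j _ => by ring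

lemma IsHermitianInner.gram_posDef {B : E →L[ℝ] E →L[ℝ] ℝ} (hB : IsHermitianInner B) :
    (gram B).PosDef := by
  refine Matrix.PosDef.of_dotProduct_mulVec_pos ?_ ?_
  · ext i j
    simp [gram_apply, hB.symm]
  · intro x hx
    have hv : (realBasis E).equivFun.symm x ≠ 0 :=
      (map_ne_zero_iff _ (LinearEquiv.injective _)).2 hx
    have := hB.pos _ hv
    rw [inner_eq_sum] at this
    have hr : ∀ i, (realBasis E).repr ((realBasis E).equivFun.symm x) i = x i := fun i => by
      rw [← Basis.equivFun_apply, LinearEquiv.apply_symm_apply]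
    simpa only [hr, Matrix.mulVec, dotProduct, Finset.mul_sum, mul_assoc, star_trivial] using this

lemma IsHermitianInner.det_gram_pos {B : E →L[ℝ] E →L[ℝ] ℝ} (hB : IsHermitianInner B) :
    0 < (gram B).det := hB.gram_posDef.det_pos

lemma IsHermitianInner.gram_inv_symm {B : E →L[ℝ] E →L[ℝ] ℝ} (hB : IsHermitianInner B) (i j) :
    (gram B)⁻¹ i j = (gram B)⁻¹ j i := by
  have h := hB.gram_posDef.isHermitian.inv
  conv_lhs => rw [← h]
  simp

lemma IsHermitianInner.sum_gram_inv_mul {B : E →L[ℝ] E →L[ℝ] ℝ} (hB : IsHermitianInner B) (i k) :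
    ∑ j, (gram B)⁻¹ i j * gram B j k = if i = k then 1 else 0 := by
  have h := Matrix.nonsing_inv_mul (gram B) (isUnit_iff_ne_zero.2 hB.det_gram_pos.ne')
  have := congrFun (congrFun h i) k
  rwa [Matrix.mul_apply, Matrix.one_apply] at this

lemma sharp_apply (B : E →L[ℝ] E →L[ℝ] ℝ) (α : E →L[ℝ] ℝ) :
    sharp B α = ∑ i, ∑ j, (gram B)⁻¹ i j • α (realBasis E i) • realBasis E j := by
  simp [sharp]

/-- The vector `sharp B α` represents `α`. -/
lemma IsHermitianInner.inner_sharp {B : E →L[ℝ] E →L[ℝ] ℝ} (hB : IsHermitianInner B)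
    (α : E →L[ℝ] ℝ) (w : E) : B (sharp B α) w = α w := by
  have key : ∀ k, B (sharp B α) (realBasis E k) = α (realBasis E k) := by
    intro k
    rw [sharp_apply]
    simp only [map_sum, sum_apply, map_smul, smul_apply, smul_eq_mul]
    calc _ = ∑ i, α (realBasis E i) * ∑ j, (gram B)⁻¹ i j * gram B j k := by
          simp only [Finset.mul_sum, gram_apply]
          exact Finset.sum_congr rfl fun i _ => Finset.sum_congr rfl fun j _ => by ring
      _ = _ := by simp [hB.sum_gram_inv_mul]
  have h : (B (sharp B α)).toLinearMap = α.toLinearMap := (realBasis E).ext key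
  exact LinearMap.congr_fun h w

/-- The vector `∑ Bⁱʲ α(eᵢ) eⱼ` that represents a linear form `α`, which need not be bundled. -/
def sharpFun (B : E →L[ℝ] E →L[ℝ] ℝ) (α : E → ℝ) : E :=
  ∑ i, ∑ j, ((gram B)⁻¹ i j * α (realBasis E i)) • realBasis E j

lemma sharp_eq_sharpFun (B : E →L[ℝ] E →L[ℝ] ℝ) (α : E →L[ℝ] ℝ) : sharp B α = sharpFun B α := by
  simp only [sharp_apply, sharpFun, smul_smul]

lemma IsHermitianInner.inner_sharpFun {B : E →L[ℝ] E →L[ℝ] ℝ} (hB : IsHermitianInner B)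
    {α : E → ℝ} (hα : IsLinearMap ℝ α) (w : E) : B (sharpFun B α) w = α w := by
  have : FiniteDimensional ℝ E := FiniteDimensional.complexToReal E
  have h := hB.inner_sharp (LinearMap.toContinuousLinearMap (hα.mk' α)) w
  rw [sharp_eq_sharpFun] at h
  exact h

/-- The coordinates of a vector, in terms of the inner products with the basis vectors. -/
lemma IsHermitianInner.repr_eq {B : E →L[ℝ] E →L[ℝ] ℝ} (hB : IsHermitianInner B) (v : E) (i) :
    (realBasis E).repr v i = ∑ j, (gram B)⁻¹ i j * B v (realBasis E j) := by
  have h : ∀ j, B v (realBasis E j) = ∑ k, gram B j k * (realBasis E).repr v k := by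
    intro j
    conv_lhs => rw [← (realBasis E).sum_repr v]
    simp only [map_sum, sum_apply, map_smul, smul_apply, smul_eq_mul, gram_apply]
    exact Finset.sum_congr rfl fun k _ => by rw [hB.symm, mul_comm]
  simp only [h, Finset.mul_sum]
  rw [Finset.sum_comm]
  simp only [← mul_assoc, ← Finset.sum_mul, hB.sum_gram_inv_mul]
  simp

/-- The trace `∑ Bⁱʲ T(eᵢ, eⱼ)` of a bilinear form `T` with respect to an inner product `B`. It is
defined for all functions of two vectors, so that bilinear forms need not be bundled. -/
def mtrace (B : E →L[ℝ] E →L[ℝ] ℝ) (T : E → E → ℝ) : ℝ :=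
  ∑ i, ∑ j, (gram B)⁻¹ i j * T (realBasis E i) (realBasis E j)

lemma mtrace_add (B : E →L[ℝ] E →L[ℝ] ℝ) (T T' : E → E → ℝ) :
    mtrace B (fun a b => T a b + T' a b) = mtrace B T + mtrace B T' := by
  simp [mtrace, mul_add, Finset.sum_add_distrib]

lemma mtrace_sub (B : E →L[ℝ] E →L[ℝ] ℝ) (T T' : E → E → ℝ) :
    mtrace B (fun a b => T a b - T' a b) = mtrace B T - mtrace B T' := by
  simp [mtrace, mul_sub, Finset.sum_sub_distrib]

lemma mtrace_neg (B : E →L[ℝ] E →L[ℝ] ℝ) (T : E → E → ℝ) :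
    mtrace B (fun a b => -T a b) = -mtrace B T := by
  simp [mtrace]

lemma mtrace_const_mul (B : E →L[ℝ] E →L[ℝ] ℝ) (c : ℝ) (T : E → E → ℝ) :
    mtrace B (fun a b => c * T a b) = c * mtrace B T := by
  simp only [mtrace, Finset.mul_sum]
  exact Finset.sum_congr rfl fun i _ => Finset.sum_congr rfl fun j _ => by ring

lemma mtrace_flip {B : E →L[ℝ] E →L[ℝ] ℝ} (hB : IsHermitianInner B) (T : E → E → ℝ) :
    mtrace B (fun a b => T b a) = mtrace B T := by
  unfold mtrace
  rw [Finset.sum_comm]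
  exact Finset.sum_congr rfl fun i _ => Finset.sum_congr rfl fun j _ => by
    rw [hB.gram_inv_symm]

/-- The metric trace of the form `B(A v, w)` is the trace of `A`. -/
lemma mtrace_endo {B : E →L[ℝ] E →L[ℝ] ℝ} (hB : IsHermitianInner B) (A : E →ₗ[ℝ] E) :
    mtrace B (fun v w => B (A v) w) = LinearMap.trace ℝ E A := by
  rw [LinearMap.trace_eq_matrix_trace ℝ (realBasis E), Matrix.trace]
  simp only [Matrix.diag, LinearMap.toMatrix_apply, hB.repr_eq]
  rfl

/-- The endomorphism that represents a bilinear form. -/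
lemma exists_endo {B : E →L[ℝ] E →L[ℝ] ℝ} (hB : IsHermitianInner B) {T : E → E → ℝ}
    (hT : IsBilinearMap ℝ T) : ∃ A : E →ₗ[ℝ] E, ∀ v w, B (A v) w = T v w := by
  have : FiniteDimensional ℝ E := FiniteDimensional.complexToReal E
  refine ⟨sharp B ∘ₗ (LinearMap.toContinuousLinearMap (𝕜 := ℝ) (E := E) (F' := ℝ)).toLinearMap ∘ₗ
    hT.toLinearMap, fun v w => ?_⟩
  simp only [LinearMap.comp_apply, hB.inner_sharp]
  rfl

/-- The metric trace is invariant under the complex structure, because `J` is an isometry. -/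
lemma mtrace_smul_I {B : E →L[ℝ] E →L[ℝ] ℝ} (hB : IsHermitianInner B) {T : E → E → ℝ}
    (hT : IsBilinearMap ℝ T) :
    mtrace B (fun a b => T (Complex.I • a) (Complex.I • b)) = mtrace B T := by
  obtain ⟨A, hA⟩ := exists_endo hB hT
  have h1 : mtrace B T = LinearMap.trace ℝ E A := by
    rw [← mtrace_endo hB]; simp only [hA]
  set J : E →ₗ[ℝ] E := (cplxJ E).toLinearMap
  have hJ : ∀ v, J v = Complex.I • v := fun v => rfl
  have h2 : mtrace B (fun a b => T (Complex.I • a) (Complex.I • b)) =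
      LinearMap.trace ℝ E (-(J * (A * J))) := by
    rw [← mtrace_endo hB]
    congr 1
    ext v w
    simp only [LinearMap.neg_apply, Module.End.mul_apply, hJ, map_neg, neg_apply, hB.smul_I_left,
      hA, neg_neg]
  have h3 : -(A * J * J) = A := by
    ext v
    simp [Module.End.mul_apply, hJ, I_smul_I_smul]
  rw [h1, h2, map_neg, LinearMap.trace_mul_comm, ← map_neg, h3]

/-- The metric trace of the composition of a symmetric form with `J` vanishes; the symmetry enters
through the equivalent condition `T(i a, i b) = -T(b, a)`. -/
lemma mtrace_eq_zero {B : E →L[ℝ] E →L[ℝ] ℝ} (hB : IsHermitianInner B) {T : E → E → ℝ}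
    (hT : IsBilinearMap ℝ T) (h : ∀ a b, T (Complex.I • a) (Complex.I • b) = -T b a) :
    mtrace B T = 0 := by
  have h1 := mtrace_smul_I hB hT
  simp only [h] at h1
  rw [mtrace_neg, mtrace_flip hB] at h1
  linarith

/-- Moving the complex structure from one argument to the other. -/
lemma mtrace_smul_I_left {B : E →L[ℝ] E →L[ℝ] ℝ} (hB : IsHermitianInner B) {T : E → E → ℝ}
    (hT : IsBilinearMap ℝ T) :
    mtrace B (fun a b => T (Complex.I • a) b) = -mtrace B (fun a b => T a (Complex.I • b)) := by
  have hT' : IsBilinearMap ℝ (fun a b => T a (Complex.I • b)) :=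
    ⟨fun a b c => hT.add_left _ _ _, fun c a b => hT.smul_left _ _ _,
      fun a b c => by simp only [smul_add, hT.add_right],
      fun c a b => by simp only [smul_comm Complex.I c, hT.smul_right]⟩
  rw [← mtrace_smul_I hB hT', ← mtrace_neg]
  congr 1
  ext a b
  have : T (Complex.I • a) (-b) = -T (Complex.I • a) b := by
    rw [← neg_one_smul ℝ b, hT.smul_right, neg_one_smul]
  rw [I_smul_I_smul, this, neg_neg]

/-- The metric trace is natural under linear isomorphisms. -/
lemma mtrace_pullback {B B' : E →L[ℝ] E →L[ℝ] ℝ} (hB : IsHermitianInner B)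
    (hB' : IsHermitianInner B') (L : E ≃ₗ[ℝ] E) (hL : ∀ v w, B' v w = B (L v) (L w))
    {T : E → E → ℝ} (hT : IsBilinearMap ℝ T) :
    mtrace B' (fun a b => T (L a) (L b)) = mtrace B T := by
  obtain ⟨A, hA⟩ := exists_endo hB hT
  have h1 : mtrace B T = LinearMap.trace ℝ E A := by
    rw [← mtrace_endo hB]; simp only [hA]
  have h2 : mtrace B' (fun a b => T (L a) (L b)) = LinearMap.trace ℝ E (L.symm.conj A) := by
    rw [← mtrace_endo hB']
    congr 1
    ext v w
    simp [hL, LinearEquiv.conj_apply, hA]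
  rw [h1, h2, LinearMap.trace_conj']

/-- The real trace of a complex linear endomorphism. -/
lemma trace_restrictScalars_real (A : E →ₗ[ℂ] E) :
    LinearMap.trace ℝ E (A.restrictScalars ℝ) = 2 * (LinearMap.trace ℂ E A).re := by
  rw [LinearMap.trace_eq_matrix_trace ℝ (Complex.basisOneI.smulTower' (finBasis ℂ E)),
    LinearMap.trace_eq_matrix_trace ℂ (finBasis ℂ E), Matrix.trace, Matrix.trace,
    Fintype.sum_prod_type, Complex.re_sum, Finset.mul_sum]
  refine Finset.sum_congr rfl fun k _ => ?_
  simp [LinearMap.toMatrix_apply, Basis.smulTower'_repr, Basis.smulTower'_apply]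
  ring

end MetricTrace

/-! ### The Bismut connection on first jets of hermitian metrics -/

section Jets

variable {E : Type*} [NormedAddCommGroup E] [NormedSpace ℂ E]

/-- The possible derivatives of hermitian metrics at a point. -/
structure IsHermitianJet (D : E → E → E → ℝ) : Prop where
  add_left : ∀ u u' v w, D (u + u') v w = D u v w + D u' v w
  smul_left : ∀ (c : ℝ) u v w, D (c • u) v w = c * D u v w
  add_mid : ∀ u v v' w, D u (v + v') w = D u v w + D u v' w
  smul_mid : ∀ (c : ℝ) u v w, D u (c • v) w = c * D u v w
  symm : ∀ u v w, D u v w = D u w v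
  inv : ∀ u v w, D u (Complex.I • v) (Complex.I • w) = D u v w

namespace IsHermitianJet

variable {D : E → E → E → ℝ} (hD : IsHermitianJet D)
include hD

lemma add_right (u v w w' : E) : D u v (w + w') = D u v w + D u v w' := by
  rw [hD.symm, hD.add_mid, hD.symm u w, hD.symm u w']

lemma smul_right (c : ℝ) (u v w : E) : D u v (c • w) = c * D u v w := by
  rw [hD.symm, hD.smul_mid, hD.symm u w]

lemma neg_left (u v w : E) : D (-u) v w = -D u v w := by
  rw [← neg_one_smul ℝ, hD.smul_left, neg_one_mul]

lemma neg_mid (u v w : E) : D u (-v) w = -D u v w := by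
  rw [← neg_one_smul ℝ, hD.smul_mid, neg_one_mul]

lemma neg_right (u v w : E) : D u v (-w) = -D u v w := by
  rw [hD.symm, hD.neg_mid, hD.symm]

lemma smul_I_mid (u v w : E) : D u (Complex.I • v) w = -D u v (Complex.I • w) := by
  have h := hD.inv u v (Complex.I • w)
  rw [I_smul_I_smul, hD.neg_right] at h
  linarith

lemma isBilinearMap (u : E) : IsBilinearMap ℝ (fun a b => D u a b) :=
  ⟨hD.add_mid u, fun c => hD.smul_mid c u, hD.add_right u, fun c => hD.smul_right c u⟩

lemma isBilinearMap_mid (u : E) : IsBilinearMap ℝ (fun a b => D a u b) :=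
  ⟨fun a b c => hD.add_left a b u c, fun c a b => hD.smul_left c a u b,
    fun a b c => hD.add_right a u b c, fun c a b => hD.smul_right c a u b⟩

end IsHermitianJet

/-- The symbols of the first kind of the Bismut connection, `g(∇ᴮ_u v, w)` for constant
coordinate fields, in terms of the derivative `D` of the metric. -/
def bismutFirst (D : E → E → E → ℝ) (u v w : E) : ℝ :=
  (2 : ℝ)⁻¹ * (D u v w + D v u w - D w u v) -
    (2 : ℝ)⁻¹ * (D (Complex.I • u) v (Complex.I • w) - D (Complex.I • v) u (Complex.I • w) +
      D (Complex.I • w) u (Complex.I • v))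

variable [FiniteDimensional ℂ E]

/-- The symbols of the Bismut connection, for a metric `B` with derivative `D`. -/
def bismutSymbol (B : E →L[ℝ] E →L[ℝ] ℝ) (D : E → E → E → ℝ) (u v : E) : E :=
  sharpFun B (bismutFirst D u v)

variable {B B' : E →L[ℝ] E →L[ℝ] ℝ} {D D' : E → E → E → ℝ}

lemma inner_bismutSymbol (hB : IsHermitianInner B) (hD : IsHermitianJet D) (u v w : E) :
    B (bismutSymbol B D u v) w = bismutFirst D u v w := by
  refine hB.inner_sharpFun ⟨fun w w' => ?_, fun c w => ?_⟩ w
  · simp only [bismutFirst, smul_add, hD.add_left, hD.add_right]; ring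
  · simp only [bismutFirst, smul_comm Complex.I c, hD.smul_left, hD.smul_right, smul_eq_mul]; ring

lemma bismutSymbol_add_right (hB : IsHermitianInner B) (hD : IsHermitianJet D) (u v v' : E) :
    bismutSymbol B D u (v + v') = bismutSymbol B D u v + bismutSymbol B D u v' := by
  refine hB.ext_left fun w => ?_
  simp only [inner_add, inner_bismutSymbol hB hD, bismutFirst, smul_add, hD.add_left,
    hD.add_mid, hD.add_right]
  ring

lemma bismutSymbol_smul_right (hB : IsHermitianInner B) (hD : IsHermitianJet D) (u : E) (c : ℝ)
    (v : E) : bismutSymbol B D u (c • v) = c • bismutSymbol B D u v := by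
  refine hB.ext_left fun w => ?_
  simp only [inner_smul, inner_bismutSymbol hB hD, bismutFirst, smul_comm Complex.I c,
    hD.smul_left, hD.smul_mid, hD.smul_right]
  ring

lemma bismutSymbol_add_left (hB : IsHermitianInner B) (hD : IsHermitianJet D) (u u' v : E) :
    bismutSymbol B D (u + u') v = bismutSymbol B D u v + bismutSymbol B D u' v := by
  refine hB.ext_left fun w => ?_
  simp only [inner_add, inner_bismutSymbol hB hD, bismutFirst, smul_add, hD.add_left, hD.add_mid]
  ring

lemma bismutSymbol_smul_left (hB : IsHermitianInner B) (hD : IsHermitianJet D) (c : ℝ) (u v : E) :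
    bismutSymbol B D (c • u) v = c • bismutSymbol B D u v := by
  refine hB.ext_left fun w => ?_
  simp only [inner_smul, inner_bismutSymbol hB hD, bismutFirst, smul_comm Complex.I c,
    hD.smul_left, hD.smul_mid]
  ring

/-- The Bismut connection is compatible with the metric. -/
lemma bismutSymbol_metric (hB : IsHermitianInner B) (hD : IsHermitianJet D) (u v w : E) :
    B (bismutSymbol B D u v) w + B v (bismutSymbol B D u w) = D u v w := by
  rw [hB.symm v, inner_bismutSymbol hB hD, inner_bismutSymbol hB hD, bismutFirst, bismutFirst,
    hD.symm u w v, hD.symm w u v, hD.symm v u w, hD.symm (Complex.I • u) w,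
    hD.smul_I_mid (Complex.I • u)]
  ring

/-- The Bismut connection is compatible with the complex structure. -/
lemma bismutSymbol_smul_I (hB : IsHermitianInner B) (hD : IsHermitianJet D) (u v : E) :
    bismutSymbol B D u (Complex.I • v) = Complex.I • bismutSymbol B D u v := by
  refine hB.ext_left fun w => ?_
  rw [hB.smul_I_left, inner_bismutSymbol hB hD, inner_bismutSymbol hB hD, bismutFirst, bismutFirst]
  simp only [I_smul_I_smul, hD.neg_left, hD.neg_right, hD.smul_I_mid]
  ring

/-- The endomorphism `v ↦ ∇ᴮ_u v` (on constant coordinate fields), which is complex linear. -/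
def bismutEnd (hB : IsHermitianInner B) (hD : IsHermitianJet D) (u : E) : E →ₗ[ℂ] E where
  toFun := bismutSymbol B D u
  map_add' := bismutSymbol_add_right hB hD u
  map_smul' c v := by
    have h : ∀ w : E, c • w = c.re • w + c.im • Complex.I • w := by
      intro w
      conv_lhs => rw [← Complex.re_add_im c, add_smul, mul_smul]
      rfl
    simp only [h, RingHom.id_apply, bismutSymbol_add_right hB hD, bismutSymbol_smul_right hB hD,
      bismutSymbol_smul_I hB hD]

/-- The codifferential of the Kähler form, in terms of the metric `B` and of its derivative `D`. -/
def kahlerCodiff (B : E →L[ℝ] E →L[ℝ] ℝ) (D : E → E → E → ℝ) (u : E) : ℝ :=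
  mtrace B (fun a b => D a u (Complex.I • b)) +
    (2 : ℝ)⁻¹ * mtrace B (fun a b => D (Complex.I • u) a b)

lemma kahlerCodiff_add (hD : IsHermitianJet D) (u u' : E) :
    kahlerCodiff B D (u + u') = kahlerCodiff B D u + kahlerCodiff B D u' := by
  simp only [kahlerCodiff, hD.add_left, hD.add_mid, smul_add, mtrace_add]
  ring

lemma kahlerCodiff_smul (hD : IsHermitianJet D) (c : ℝ) (u : E) :
    kahlerCodiff B D (c • u) = c * kahlerCodiff B D u := by
  simp only [kahlerCodiff, hD.smul_left, hD.smul_mid, smul_comm Complex.I c, mtrace_const_mul]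
  ring

/-- The real trace of the Bismut symbols. -/
lemma trace_bismutEnd (hB : IsHermitianInner B) (hD : IsHermitianJet D) (u : E) :
    LinearMap.trace ℝ E ((bismutEnd hB hD u).restrictScalars ℝ) =
      (2 : ℝ)⁻¹ * mtrace B (fun a b => D u a b) := by
  rw [← mtrace_endo hB]
  have h : mtrace B (fun a b => D u a b) =
      mtrace B (fun v w => B (((bismutEnd hB hD u).restrictScalars ℝ) v) w) +
      mtrace B (fun v w => B (((bismutEnd hB hD u).restrictScalars ℝ) w) v) := by
    rw [← mtrace_add]
    congr 1
    ext v w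
    rw [← bismutSymbol_metric hB hD, hB.symm v]
    rfl
  have h' : mtrace B (fun v w => B (((bismutEnd hB hD u).restrictScalars ℝ) w) v) =
      mtrace B (fun v w => B (((bismutEnd hB hD u).restrictScalars ℝ) v) w) :=
    mtrace_flip hB (fun v w => B (((bismutEnd hB hD u).restrictScalars ℝ) v) w)
  rw [h, h']
  ring

/-- The trace of `J ∇ᴮ_u` on constant coordinate fields. This is the computation that relates the
connection induced on the canonical bundle by the Bismut connection to `d*ω`. -/
lemma trace_I_bismutEnd (hB : IsHermitianInner B) (hD : IsHermitianJet D) (u : E) :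
    LinearMap.trace ℝ E ((Complex.I • bismutEnd hB hD u).restrictScalars ℝ) =
      -2 * kahlerCodiff B D u + (2 : ℝ)⁻¹ * mtrace B (fun a b => D (Complex.I • u) a b) := by
  rw [← mtrace_endo hB]
  set S := mtrace B (fun a b => D a u (Complex.I • b))
  have e : ∀ v w : E, B (((Complex.I • bismutEnd hB hD u).restrictScalars ℝ) v) w =
      -((2 : ℝ)⁻¹ * (D u v (Complex.I • w) + D v u (Complex.I • w) - D (Complex.I • w) u v)) -
      (2 : ℝ)⁻¹ * (D (Complex.I • u) v w - D (Complex.I • v) u w + D w u (Complex.I • v)) := by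
    intro v w
    have : ((Complex.I • bismutEnd hB hD u).restrictScalars ℝ) v =
      Complex.I • bismutSymbol B D u v := rfl
    rw [this, hB.smul_I_left, inner_bismutSymbol hB hD, bismutFirst]
    simp only [I_smul_I_smul, hD.neg_right, hD.neg_left]
    ring
  simp only [e, mtrace_sub, mtrace_add, mtrace_neg, mtrace_const_mul]
  have hbil := hD.isBilinearMap_mid u
  have h0 : mtrace B (fun v w => D u v (Complex.I • w)) = 0 := by
    have h := mtrace_smul_I_left hB (hD.isBilinearMap u)
    simp only [hD.smul_I_mid, mtrace_neg] at h
    have h' : mtrace B (fun v w => D u v (Complex.I • w)) =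
        mtrace B (fun v w => -D u v (Complex.I • w)) := by
      rw [← mtrace_flip hB]
      congr 1
      ext v w
      rw [hD.symm, hD.smul_I_mid]
    rw [mtrace_neg] at h'
    linarith
  have h1 : mtrace B (fun v w => D (Complex.I • v) u w) = -S := mtrace_smul_I_left hB hbil
  have h2 : mtrace B (fun v w => D (Complex.I • w) u v) = -S := by
    rw [← h1]; exact mtrace_flip hB (fun v w => D (Complex.I • v) u w)
  have h3 : mtrace B (fun v w => D w u (Complex.I • v)) = S :=
    mtrace_flip hB (fun v w => D v u (Complex.I • w))
  rw [h0, h1, h2, h3, kahlerCodiff]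
  simp only [S]
  ring

/-- The complex trace of the Bismut symbols. -/
lemma complex_trace_bismutEnd (hB : IsHermitianInner B) (hD : IsHermitianJet D) (u : E) :
    LinearMap.trace ℂ E (bismutEnd hB hD u) =
      ((4 : ℝ)⁻¹ * mtrace B (fun a b => D u a b) : ℝ) +
      (kahlerCodiff B D u - (4 : ℝ)⁻¹ * mtrace B (fun a b => D (Complex.I • u) a b) : ℝ) *
        Complex.I := by
  have h1 := trace_restrictScalars_real (bismutEnd hB hD u)
  have h2 := trace_restrictScalars_real (Complex.I • bismutEnd hB hD u)
  rw [trace_bismutEnd] at h1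
  rw [trace_I_bismutEnd, LinearMap.map_smul, smul_eq_mul, Complex.mul_re, Complex.I_re, Complex.I_im] at h2
  apply Complex.ext
  · simp
    linarith
  · simp
    linarith

/-! #### Changes of coordinates -/

/-- `D'` is the derivative of the pullback of a metric `B` with derivative `D` by a holomorphic map
with derivative `L` and second derivative `H`. -/
def IsPullbackJet (B : E →L[ℝ] E →L[ℝ] ℝ) (D D' : E → E → E → ℝ) (L : E ≃ₗ[ℂ] E)
    (H : E →ₗ[ℂ] E →ₗ[ℂ] E) : Prop :=
  ∀ u v w, D' u v w = D (L u) (L v) (L w) + B (H u v) (L w) + B (L v) (H u w)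

section Pullback

variable {L : E ≃ₗ[ℂ] E} {H : E →ₗ[ℂ] E →ₗ[ℂ] E}

/-- The transformation of the Bismut symbols. -/
lemma bismutSymbol_pullback (hB : IsHermitianInner B) (hB' : IsHermitianInner B')
    (hD : IsHermitianJet D) (hD' : IsHermitianJet D') (hH : ∀ u v, H u v = H v u)
    (hL : ∀ v w, B' v w = B (L v) (L w)) (h : IsPullbackJet B D D' L H) (u v : E) :
    L (bismutSymbol B' D' u v) = bismutSymbol B D (L u) (L v) + H u v := by
  refine hB.ext_left fun w => ?_
  obtain ⟨w, rfl⟩ := L.surjective w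
  rw [← hL, inner_bismutSymbol hB' hD', inner_add, inner_bismutSymbol hB hD]
  simp only [bismutFirst, h _ _ _, LinearEquiv.map_smul, LinearMap.map_smul, LinearMap.smul_apply,
    hB.smul_I_left, I_smul_I_smul, ContinuousLinearMap.map_neg]
  rw [hH v u, hH w u, hH w v, hB.symm (L u) (H v w), hB.symm (L v) (H u w)]
  ring

/-- `d*ω` is natural. -/
lemma kahlerCodiff_pullback (hB : IsHermitianInner B) (hB' : IsHermitianInner B')
    (hD : IsHermitianJet D) (hH : ∀ u v, H u v = H v u)
    (hL : ∀ v w, B' v w = B (L v) (L w)) (h : IsPullbackJet B D D' L H) (u : E) :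
    kahlerCodiff B' D' u = kahlerCodiff B D (L u) := by
  have hp : ∀ {T : E → E → ℝ}, IsBilinearMap ℝ T →
      mtrace B' (fun a b => T (L a) (L b)) = mtrace B T := fun hT =>
    mtrace_pullback hB hB' (L.restrictScalars ℝ) hL hT
  have t1 : mtrace B' (fun a b => D (L a) (L u) (Complex.I • L b)) =
      mtrace B (fun a b => D a (L u) (Complex.I • b)) := by
    refine hp (T := fun a b => D a (L u) (Complex.I • b))
      ⟨fun a b c => hD.add_left _ _ _ _, fun c a b => hD.smul_left _ _ _ _,
        fun a b c => ?_, fun c a b => ?_⟩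
    · simp only [smul_add, hD.add_right]
    · simp only [smul_comm Complex.I c, hD.smul_right, smul_eq_mul]
  have t2 : mtrace B' (fun a b => D (Complex.I • L u) (L a) (L b)) =
      mtrace B (fun a b => D (Complex.I • L u) a b) := hp (hD.isBilinearMap _)
  have hHr : ∀ (c : ℝ) (a b : E), H a (c • b) = c • H a b :=
    fun c a b => ((H a).restrictScalars ℝ).map_smul c b
  have hHl : ∀ (c : ℝ) (a b : E), H (c • a) b = c • H a b := fun c a b => by
    rw [hH, hHr, hH]
  -- the complex Hessian has no `(1,1)` part, so its trace against `J` vanishes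
  have t3 : mtrace B' (fun a b => B (Complex.I • H a b) (L u)) = 0 := by
    refine mtrace_eq_zero hB' ⟨fun a b c => ?_, fun c a b => ?_, fun a b c => ?_,
      fun c a b => ?_⟩ fun a b => ?_
    · rw [LinearMap.map_add, LinearMap.add_apply, smul_add, inner_add]
    · rw [hHl, smul_comm, inner_smul, smul_eq_mul]
    · rw [LinearMap.map_add, smul_add, inner_add]
    · rw [hHr, smul_comm, inner_smul, smul_eq_mul]
    · rw [LinearMap.map_smul, LinearMap.map_smul, LinearMap.smul_apply, I_smul_I_smul,
        hH b a, ← neg_one_smul ℝ (Complex.I • H a b), inner_smul, neg_one_mul]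
  have t4 : mtrace B' (fun a b => B (L a) (Complex.I • H u b)) =
      -mtrace B' (fun a b => B (H u a) (Complex.I • L b)) := by
    rw [← mtrace_flip hB', ← mtrace_neg]
    congr 1
    ext a b
    rw [hB.symm, hB.smul_I_left]
  have e1 : ∀ a b, D' a u (Complex.I • b) = D (L a) (L u) (Complex.I • L b) +
      B (H u a) (Complex.I • L b) + B (Complex.I • H a b) (L u) := by
    intro a b
    rw [h, L.map_smul, LinearMap.map_smul, hB.symm (L u), hH a u]
  have e2 : ∀ a b, D' (Complex.I • u) a b = D (Complex.I • L u) (L a) (L b) -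
      B (H u a) (Complex.I • L b) + B (L a) (Complex.I • H u b) := by
    intro a b
    rw [h, L.map_smul, LinearMap.map_smul, LinearMap.smul_apply, LinearMap.smul_apply,
      hB.smul_I_left]
    ring
  simp only [kahlerCodiff, e1, e2, mtrace_add, mtrace_sub, t1, t2, t3, t4]
  ring

end Pullback

end Jets

/-! ### Hermitian normal form -/

open scoped ComplexOrder MatrixOrder Matrix.Norms.L2Operator in
lemma posSemidef_factor {n : Type*} [Fintype n] [DecidableEq n] {M : Matrix n n ℂ}
    (hM : M.PosSemidef) : ∃ Q : Matrix n n ℂ, M = star Q * Q :=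
  CStarAlgebra.nonneg_iff_eq_star_mul_self.1 (Matrix.nonneg_iff_posSemidef.2 hM)

variable {E : Type*} [NormedAddCommGroup E] [NormedSpace ℂ E] [FiniteDimensional ℂ E]

/-- The pairs `(k, a)` as indices of the real basis. -/
def realIndex (E : Type*) [NormedAddCommGroup E] [NormedSpace ℂ E] [FiniteDimensional ℂ E] :
    Fin (finrank ℂ E) × Fin 2 ≃ Fin (2 * finrank ℂ E) :=
  finProdFinEquiv.trans (finCongr (mul_comm _ _))

lemma realBasis_realIndex (p : Fin (finrank ℂ E) × Fin 2) :
    realBasis E (realIndex E p) = Complex.basisOneI p.2 • finBasis ℂ E p.1 := by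
  simp [realBasis, realIndex, Basis.smulTower'_apply]

lemma realBasis_repr_realIndex (v : E) (p : Fin (finrank ℂ E) × Fin 2) :
    (realBasis E).repr v (realIndex E p) =
      Complex.basisOneI.repr ((finBasis ℂ E).repr v p.1) p.2 := by
  rw [← Basis.smulTower'_repr, realBasis, Basis.repr_reindex_apply]
  congr 1
  exact Equiv.symm_apply_apply _ p

/-- The sum of the products of the real coordinates. -/
lemma sum_realBasis_repr_mul (v w : E) :
    ∑ i, (realBasis E).repr v i * (realBasis E).repr w i =
      (∑ k, star ((finBasis ℂ E).repr v k) * (finBasis ℂ E).repr w k).re := by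
  rw [← (realIndex E).sum_comp, Fintype.sum_prod_type, Complex.re_sum]
  refine Finset.sum_congr rfl fun k _ => ?_
  simp [realBasis_repr_realIndex]

variable {B : E →L[ℝ] E →L[ℝ] ℝ}

open scoped ComplexOrder in
/-- A hermitian inner product is standard in suitable complex coordinates. -/
lemma IsHermitianInner.exists_standard (hB : IsHermitianInner B) :
    ∃ Q : E ≃ₗ[ℂ] E, ∀ v w, B v w =
      ∑ i, (realBasis E).repr (Q v) i * (realBasis E).repr (Q w) i := by
  let b := finBasis ℂ E
  -- the hermitian form with real part `B`, conjugate linear in the first argument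
  let h : E → E → ℂ := fun v w => B v w + B (Complex.I • v) w * Complex.I
  have hr : ∀ v w, (h v w).re = B v w := fun v w => by simp [h]
  have hstar : ∀ v w, star (h v w) = h w v := fun v w => by
    apply Complex.ext
    · simp [h, hB.symm v w]
    · simp [h, hB.smul_I_left, hB.symm w (Complex.I • v)]
  have hadd : ∀ v w w', h v (w + w') = h v w + h v w' := fun v w w' => by
    simp only [h, map_add, Complex.ofReal_add]; ring
  have hsmul : ∀ (c : ℂ) v w, h v (c • w) = c * h v w := fun c v w => by
    have e : c • w = c.re • w + c.im • Complex.I • w := by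
      conv_lhs => rw [← Complex.re_add_im c, add_smul, mul_smul]
      rfl
    apply Complex.ext
    · simp only [e, h, map_add, (B _).map_smul, smul_eq_mul]
      simp [hB.smul_I_left]
    · simp only [e, h, map_add, (B _).map_smul, smul_eq_mul]
      simp [hB.smul_I_left, I_smul_I_smul]
  let hl : E → E →ₗ[ℂ] ℂ := fun v =>
    { toFun := h v, map_add' := hadd v, map_smul' := fun c w => hsmul c v w }
  have hsum : ∀ v w, h v w = ∑ k, ∑ l, star (b.repr v k) * h (b k) (b l) * b.repr w l := by
    intro v w
    have h1 : ∀ v w, h v w = ∑ l, b.repr w l * h v (b l) := fun v w => by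
      change hl v w = ∑ l, b.repr w l * hl v (b l)
      conv_lhs => rw [← b.sum_repr w]
      rw [map_sum]
      exact Finset.sum_congr rfl fun l _ => by rw [LinearMap.map_smul, smul_eq_mul]
    rw [h1, Finset.sum_comm]
    refine Finset.sum_congr rfl fun l _ => ?_
    rw [← hstar, h1, star_sum, Finset.mul_sum]
    refine Finset.sum_congr rfl fun k _ => ?_
    rw [star_mul, hstar]; ring
  let M : Matrix (Fin (finrank ℂ E)) (Fin (finrank ℂ E)) ℂ := Matrix.of fun k l => h (b k) (b l)
  have hMv : ∀ v w, h v w = star (b.repr v : _ → ℂ) ⬝ᵥ M.mulVec (b.repr w) := fun v w => by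
    rw [hsum]
    simp [dotProduct, Matrix.mulVec, Finset.mul_sum, M, mul_assoc]
  have hM : M.PosSemidef := by
    refine Matrix.PosSemidef.of_dotProduct_mulVec_nonneg ?_ fun x => ?_
    · ext k l
      exact hstar _ _
    · have hx : x = b.repr (b.equivFun.symm x) := by
        ext k; rw [← Basis.equivFun_apply, LinearEquiv.apply_symm_apply]
      rw [hx, ← hMv]
      set v := b.equivFun.symm x
      rw [Complex.le_def]
      refine ⟨?_, ?_⟩
      · rw [hr]
        by_cases hv : v = 0
        · simp [hv]
        · exact (hB.pos v hv).le
      · have := congrArg Complex.im (hstar v v)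
        simp only [Complex.star_def, Complex.conj_im] at this
        simp only [Complex.zero_im]
        linarith
  obtain ⟨P, hP⟩ := posSemidef_factor hM
  let Q₀ : E →ₗ[ℂ] E := Matrix.toLin b b P
  have hQ₀ : ∀ v w, B v w =
      ∑ i, (realBasis E).repr (Q₀ v) i * (realBasis E).repr (Q₀ w) i := by
    intro v w
    have e : ∀ v, (b.repr (Q₀ v) : _ → ℂ) = P.mulVec (b.repr v) := fun v => Matrix.repr_toLin b b P v
    rw [sum_realBasis_repr_mul, ← hr, hMv, hP]
    change _ = (star (b.repr (Q₀ v) : _ → ℂ) ⬝ᵥ (b.repr (Q₀ w) : _ → ℂ)).re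
    rw [e, e, Matrix.star_mulVec, ← Matrix.dotProduct_mulVec, Matrix.mulVec_mulVec]
    rfl
  have hinj : Function.Injective Q₀ := by
    rw [injective_iff_map_eq_zero]
    intro v hv
    by_contra hne
    have := hB.pos v hne
    rw [hQ₀, hv] at this
    simp at this
  refine ⟨LinearEquiv.ofInjectiveEndo Q₀ hinj, hQ₀⟩

/-! ### The Hodge star operator on forms of degree `2` and of codegree `1` -/

lemma IsHermitianInner.exists_orthonormal (hB : IsHermitianInner B) :
    ∃ b : Basis (Fin (2 * finrank ℂ E)) ℝ E, ∀ i j, B (b i) (b j) = if i = j then 1 else 0 := by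
  obtain ⟨Q, hQ⟩ := hB.exists_standard
  refine ⟨(realBasis E).map (Q.symm.restrictScalars ℝ), fun i j => ?_⟩
  rw [hQ]
  simp [Finsupp.single_apply]

section Orthonormal

variable {b : Basis (Fin (2 * finrank ℂ E)) ℝ E}

lemma transpose_mul_gram_mul (hb : ∀ i j, B (b i) (b j) = if i = j then 1 else 0) :
    ((realBasis E).toMatrix b).transpose * (gram B * (realBasis E).toMatrix b) = 1 := by
  ext i j
  rw [Matrix.one_apply, ← hb, inner_eq_sum]
  simp [Matrix.mul_apply, Basis.toMatrix_apply, Finset.mul_sum, mul_assoc]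

lemma gram_inv_eq_sum (hb : ∀ i j, B (b i) (b j) = if i = j then 1 else 0) (i j) :
    (gram B)⁻¹ i j = ∑ c, (realBasis E).repr (b c) i * (realBasis E).repr (b c) j := by
  have h1 := mul_eq_one_comm.1 (transpose_mul_gram_mul hb)
  rw [Matrix.mul_assoc] at h1
  rw [Matrix.inv_eq_right_inv h1]
  simp [Matrix.mul_apply, Basis.toMatrix_apply]

lemma det_gram_mul_sq (hb : ∀ i j, B (b i) (b j) = if i = j then 1 else 0) :
    (gram B).det * (realBasis E).det b ^ 2 = 1 := by
  have := congrArg Matrix.det (transpose_mul_gram_mul hb)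
  rw [Matrix.det_mul, Matrix.det_mul, Matrix.det_transpose, Matrix.det_one] at this
  rw [Basis.det_apply, ← this]
  ring

lemma MultilinearMap.apply_basis_comp {k : ℕ} (F : MultilinearMap ℝ (fun _ : Fin k => E) ℝ)
    (c : Fin k → Fin (2 * finrank ℂ E)) :
    F (b ∘ c) = ∑ i : Fin k → Fin (2 * finrank ℂ E),
      (∏ a, (realBasis E).repr (b (c a)) (i a)) * F (realBasis E ∘ i) := by
  have h : b ∘ c = fun a => ∑ i, (realBasis E).repr (b (c a)) i • realBasis E i := by
    ext a
    exact ((realBasis E).sum_repr _).symm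
  rw [h, F.map_sum]
  refine Finset.sum_congr rfl fun i _ => ?_
  rw [F.map_smul_univ]
  rfl

/-- The scalar product of covariant tensors in an orthonormal basis. -/
lemma sum_gram_inv_prod (hb : ∀ i j, B (b i) (b j) = if i = j then 1 else 0) {k : ℕ}
    (F H : MultilinearMap ℝ (fun _ : Fin k => E) ℝ) :
    ∑ i : Fin k → Fin (2 * finrank ℂ E), ∑ j : Fin k → Fin (2 * finrank ℂ E),
      (F (realBasis E ∘ i) * ∏ a, (gram B)⁻¹ (i a) (j a)) * H (realBasis E ∘ j) =
    ∑ c : Fin k → Fin (2 * finrank ℂ E), F (b ∘ c) * H (b ∘ c) := by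
  have hp : ∀ i j : Fin k → Fin (2 * finrank ℂ E), ∏ a, (gram B)⁻¹ (i a) (j a) =
      ∑ c : Fin k → Fin (2 * finrank ℂ E), (∏ a, (realBasis E).repr (b (c a)) (i a)) *
        ∏ a, (realBasis E).repr (b (c a)) (j a) := fun i j => by
    simp only [gram_inv_eq_sum hb, Finset.prod_univ_sum, Fintype.piFinset_univ,
      Finset.prod_mul_distrib]
  simp only [MultilinearMap.apply_basis_comp (b := b), Fintype.sum_mul_sum]
  conv_rhs => rw [Finset.sum_comm]
  refine Finset.sum_congr rfl fun i _ => ?_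
  conv_rhs => rw [Finset.sum_comm]
  refine Finset.sum_congr rfl fun j _ => ?_
  rw [hp, Finset.mul_sum, Finset.sum_mul]
  refine Finset.sum_congr rfl fun c _ => ?_
  ring

end Orthonormal

section Top

variable {V : Type*} [AddCommGroup V] [Module ℝ V] [FiniteDimensional ℝ V] {k : ℕ}

/-- A linear form `α` and a form `d` of top degree have wedge product zero. -/
lemma sum_linear_mul_top (hk : finrank ℝ V = k) (d : V [⋀^Fin k]→ₗ[ℝ] ℝ) (α : V →ₗ[ℝ] ℝ)
    (x : Fin (k + 1) → V) :
    ∑ r : Fin (k + 1), (-1) ^ (r : ℕ) * (α (x r) * d (Fin.removeNth r x)) = 0 := by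
  have h := AlternatingMap.alternatizeUncurryFin_apply (α.smulRight d) x
  have hdep : ¬ LinearIndependent ℝ x := fun hx => by
    have := hx.fintype_card_le_finrank
    simp [hk] at this
  rw [AlternatingMap.map_linearDependent _ _ hdep] at h
  rw [h]
  refine Finset.sum_congr rfl fun r _ => ?_
  simp

/-- Cramer's rule for a form `d` of top degree: `α(u) d(w)` is the sum of the `α(wᵣ) d(…, u, …)`,
with `u` in place of `wᵣ`. -/
lemma linear_mul_top (hk : finrank ℝ V = k + 1) (d : V [⋀^Fin (k + 1)]→ₗ[ℝ] ℝ) (α : V →ₗ[ℝ] ℝ)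
    (u : V) (w : Fin (k + 1) → V) :
    α u * d w = ∑ r : Fin (k + 1),
      α (w r) * ((-1) ^ (r : ℕ) * d (Fin.cons u (Fin.removeNth r w))) := by
  have h := sum_linear_mul_top hk d α (Fin.cons u w)
  rw [Fin.sum_univ_succ] at h
  have h0 : Fin.removeNth 0 (Fin.cons u w : Fin (k + 2) → V) = w := by
    ext i; simp [Fin.removeNth]
  have hs : ∀ r : Fin (k + 1), Fin.removeNth r.succ (Fin.cons u w : Fin (k + 2) → V) =
      Fin.cons u (Fin.removeNth r w) := by
    intro r
    ext i
    refine Fin.cases ?_ (fun i => ?_) i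
    · simp [Fin.removeNth]
    · simp [Fin.removeNth]
  simp only [h0, hs, Fin.cons_zero, Fin.cons_succ, Fin.val_zero, pow_zero, one_mul,
    Fin.val_succ] at h
  rw [eq_neg_of_add_eq_zero_left h, ← Finset.sum_neg_distrib]
  refine Finset.sum_congr rfl fun r _ => ?_
  ring

/-- The identity `α ∧ ι_q ι_p d = α(q) ι_p d - α(p) ι_q d` for a form `d` of top degree. It evaluates
the exterior derivative of `⋆ω`. -/
lemma sum_linear_mul_top_two (hk : finrank ℝ V = k + 2) (d : V [⋀^Fin (k + 2)]→ₗ[ℝ] ℝ)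
    (α : V →ₗ[ℝ] ℝ) (p q : V) (v : Fin (k + 1) → V) :
    ∑ r : Fin (k + 1), (-1) ^ (r : ℕ) * (α (v r) * d (Fin.cons p (Fin.cons q (Fin.removeNth r v))))
      = α q * d (Fin.cons p v) - α p * d (Fin.cons q v) := by
  have h := linear_mul_top hk d α p (Fin.cons q v)
  rw [Fin.sum_univ_succ] at h
  have h0 : Fin.removeNth 0 (Fin.cons q v : Fin (k + 2) → V) = v := by
    ext i; simp [Fin.removeNth]
  have hs : ∀ r : Fin (k + 1), Fin.removeNth r.succ (Fin.cons q v : Fin (k + 2) → V) =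
      Fin.cons q (Fin.removeNth r v) := by
    intro r
    ext i
    refine Fin.cases ?_ (fun i => ?_) i
    · simp [Fin.removeNth]
    · simp [Fin.removeNth]
  simp only [h0, hs, Fin.cons_zero, Fin.cons_succ, Fin.val_zero, pow_zero, one_mul,
    Fin.val_succ] at h
  have hneg : ∑ r : Fin (k + 1), α (v r) * ((-1) ^ ((r : ℕ) + 1) *
      d (Fin.cons p (Fin.cons q (Fin.removeNth r v)))) = -∑ r : Fin (k + 1), (-1) ^ (r : ℕ) *
      (α (v r) * d (Fin.cons p (Fin.cons q (Fin.removeNth r v)))) := by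
    rw [← Finset.sum_neg_distrib]
    refine Finset.sum_congr rfl fun r _ => ?_
    ring
  rw [hneg] at h
  linarith

omit [FiniteDimensional ℝ V] in
/-- The sum of the squares of the determinants of the families of basis vectors. -/
lemma sum_det_sq (b : Basis (Fin k) ℝ V) :
    ∑ c : Fin k → Fin k, b.det (b ∘ c) ^ 2 = k.factorial := by
  have h1 : ∀ c : Fin k → Fin k, b.det (b ∘ c) =
      ∑ σ : Equiv.Perm (Fin k), if c = σ then ((Equiv.Perm.sign σ : ℤ) : ℝ) else 0 := by
    intro c
    rw [Basis.det_apply, Matrix.det_apply]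
    refine Finset.sum_congr rfl fun σ _ => ?_
    simp only [Basis.toMatrix_apply, Function.comp, Basis.repr_self, Finsupp.single_apply]
    split_ifs with h
    · subst h
      simp [Units.smul_def]
    · have : ∃ a, c a ≠ σ a := Function.ne_iff.1 h
      obtain ⟨a, ha⟩ := this
      rw [Finset.prod_eq_zero (Finset.mem_univ a) (if_neg ha), smul_zero]
  have h2 : ∀ σ : Equiv.Perm (Fin k), b.det (b ∘ σ) = ((Equiv.Perm.sign σ : ℤ) : ℝ) := by
    intro σ
    rw [AlternatingMap.map_perm, b.det_self]
    simp [Units.smul_def]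
  simp only [pow_two]
  have h3 : ∀ c : Fin k → Fin k, b.det (b ∘ c) * b.det (b ∘ c) = ∑ σ : Equiv.Perm (Fin k),
      if c = σ then ((Equiv.Perm.sign σ : ℤ) : ℝ) * b.det (b ∘ c) else 0 := by
    intro c
    conv_lhs => lhs; rw [h1 c]
    rw [Finset.sum_mul]
    exact Finset.sum_congr rfl fun σ _ => by split_ifs <;> simp
  simp only [h3]
  rw [Finset.sum_comm]
  simp only [Finset.sum_ite_eq', Finset.mem_univ, if_true]
  simp only [h2, ← Int.cast_mul, ← Units.val_mul, Int.units_mul_self]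
  simp [Fintype.card_perm]

/-- Contraction of two forms of top degree minus one along an orthonormal basis `b`. -/
lemma sum_top_mul_top (hk : finrank ℝ V = k + 1) (d : V [⋀^Fin (k + 1)]→ₗ[ℝ] ℝ)
    (b : Basis (Fin (k + 1)) ℝ V) (α : V →ₗ[ℝ] ℝ) (Y u : V) (hα : ∑ t, α (b t) • b t = Y) :
    ∑ c : Fin k → Fin (k + 1), d (Fin.cons Y (b ∘ c)) * d (Fin.cons u (b ∘ c)) =
      k.factorial * d b ^ 2 * α u := by
  have hd : ∀ c : Fin (k + 1) → Fin (k + 1), d (b ∘ c) = d b * b.det (b ∘ c) := fun c => by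
    conv_lhs => rw [d.eq_smul_basis_det b]
    simp
  have h1 : α u * ∑ c : Fin (k + 1) → Fin (k + 1), d (b ∘ c) ^ 2 =
      ∑ r : Fin (k + 1), ∑ c : Fin (k + 1) → Fin (k + 1), α (b (c r)) *
        ((-1) ^ (r : ℕ) * d (Fin.cons u (Fin.removeNth r (b ∘ c)))) * d (b ∘ c) := by
    rw [Finset.mul_sum, Finset.sum_comm]
    refine Finset.sum_congr rfl fun c _ => ?_
    rw [pow_two, ← mul_assoc, linear_mul_top hk d α u (b ∘ c), Finset.sum_mul]
    rfl
  have h2 : ∀ r : Fin (k + 1), ∑ c : Fin (k + 1) → Fin (k + 1), α (b (c r)) *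
        ((-1) ^ (r : ℕ) * d (Fin.cons u (Fin.removeNth r (b ∘ c)))) * d (b ∘ c) =
      ∑ c : Fin k → Fin (k + 1), d (Fin.cons Y (b ∘ c)) * d (Fin.cons u (b ∘ c)) := by
    intro r
    rw [← (Fin.insertNthEquiv (fun _ => Fin (k + 1)) r).sum_comp, Fintype.sum_prod_type,
      Finset.sum_comm]
    refine Finset.sum_congr rfl fun c _ => ?_
    have e1 : ∀ t, b ∘ (Fin.insertNthEquiv (fun _ => Fin (k + 1)) r (t, c)) =
        r.insertNth (b t) (b ∘ c) := fun t => by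
      ext i
      refine r.succAboveCases ?_ (fun j => ?_) i <;> simp [Fin.insertNthEquiv]
    have e2 : ∀ t, d (r.insertNth (b t) (b ∘ c)) =
        (-1) ^ (r : ℕ) * d (Fin.cons (b t) (b ∘ c)) := fun t => by
      rw [AlternatingMap.map_insertNth]
      simp [Matrix.vecCons]
    have e3 : ∀ t, (Fin.insertNthEquiv (fun _ => Fin (k + 1)) r (t, c)) r = t := fun t => by
      simp [Fin.insertNthEquiv]
    simp only [e1, e2, e3, Fin.removeNth_insertNth]
    have e4 : d (Fin.cons Y (b ∘ c)) = ∑ t, α (b t) * d (Fin.cons (b t) (b ∘ c)) := by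
      let X : V →ₗ[ℝ] ℝ :=
        { toFun := fun p => d (Fin.cons p (b ∘ c))
          map_add' := fun p q => d.toMultilinearMap.cons_add _ _ _
          map_smul' := fun s p => d.toMultilinearMap.cons_smul _ _ _ }
      change X Y = ∑ t, α (b t) * X (b t)
      rw [← hα, map_sum]
      simp
    rw [e4, Finset.sum_mul]
    refine Finset.sum_congr rfl fun t _ => ?_
    have : ((-1 : ℝ) ^ (r : ℕ)) * (-1) ^ (r : ℕ) = 1 := by
      rw [← mul_pow]; simp
    linear_combination (α (b t) * d (Fin.cons u (b ∘ c)) * d (Fin.cons (b t) (b ∘ c))) * this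
  simp only [h2, Finset.sum_const, Finset.card_univ, Fintype.card_fin, nsmul_eq_mul] at h1
  simp only [hd, mul_pow, ← Finset.mul_sum, sum_det_sq, Nat.factorial_succ] at h1
  have hk0 : ((k + 1 : ℕ) : ℝ) ≠ 0 := by positivity
  apply mul_left_cancel₀ hk0
  rw [← h1]
  push_cast
  ring

end Top

/-! #### The operator `⋆` in terms of the volume form -/

lemma volForm_apply (B : E →L[ℝ] E →L[ℝ] ℝ) {m : ℕ} (h : 2 * finrank ℂ E = m) (v : Fin m → E) :
    volForm B h v = √(gram B).det * ((realBasis E).reindex (finCongr h)).det v := rfl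

omit [FiniteDimensional ℂ E] in
lemma contract_apply {l : ℕ} (k : ℕ) (β : E [⋀^Fin (l + k)]→L[ℝ] ℝ) (u : Fin k → E)
    (w : Fin l → E) :
    contract k β u w = β fun i : Fin (l + k) =>
      if h : (i : ℕ) < k then u ⟨i, h⟩ else w ⟨i - k, by omega⟩ := by
  induction k with
  | zero =>
    simp [contract]
  | succ k ih =>
    have h1 : contract (k + 1) β u w = contract k (β.curryLeft (u 0)) (Fin.tail u) w := rfl
    rw [h1, ih, ContinuousAlternatingMap.curryLeft_apply_apply]
    congr 1
    ext i
    refine Fin.cases ?_ (fun i => ?_) i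
    · simp
    · simp [Fin.tail]

lemma volForm_cast (B : E →L[ℝ] E →L[ℝ] ℝ) {m m' : ℕ} (e : m' = m) (h : 2 * finrank ℂ E = m)
    (h' : 2 * finrank ℂ E = m') (v : Fin m → E) :
    volForm B h v = volForm B h' (v ∘ Fin.cast e) := by
  subst e
  rfl

/-- The expansion of the value at `v` of a linear form. -/
lemma linear_eq_mtrace (hB : IsHermitianInner B) (X : E →ₗ[ℝ] ℝ) (v : E) :
    X v = mtrace B (fun a b => B v a * X b) := by
  conv_lhs => rw [← (realBasis E).sum_repr v, map_sum]
  rw [mtrace, Finset.sum_comm]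
  refine Finset.sum_congr rfl fun j _ => ?_
  rw [X.map_smul, smul_eq_mul, hB.repr_eq, Finset.sum_mul]
  refine Finset.sum_congr rfl fun i _ => ?_
  rw [hB.gram_inv_symm]
  ring

lemma linear_sharpFun (B : E →L[ℝ] E →L[ℝ] ℝ) (X : E →ₗ[ℝ] ℝ) (α : E → ℝ) :
    X (sharpFun B α) = mtrace B (fun a b => α a * X b) := by
  rw [sharpFun, map_sum, mtrace]
  refine Finset.sum_congr rfl fun i _ => ?_
  rw [map_sum]
  refine Finset.sum_congr rfl fun j _ => ?_
  rw [X.map_smul, smul_eq_mul]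
  ring

lemma hodgeStar_apply (B : E →L[ℝ] E →L[ℝ] ℝ) {k l : ℕ} (h : 2 * finrank ℂ E = l + k)
    (β : E [⋀^Fin k]→L[ℝ] ℝ) (w : Fin l → E) :
    hodgeStar B l β w = (k.factorial : ℝ)⁻¹ * ∑ i : Fin k → Fin (2 * finrank ℂ E),
      ∑ j : Fin k → Fin (2 * finrank ℂ E),
        (β (realBasis E ∘ i) * ∏ a, (gram B)⁻¹ (i a) (j a)) *
          contract k (volForm B h) (realBasis E ∘ j) w := by
  rw [hodgeStar, dif_pos h]
  simp [ContinuousAlternatingMap.sum_apply]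

/-- A form as a linear function of its first argument. -/
def firstArg {k : ℕ} (d : E [⋀^Fin (k + 1)]→L[ℝ] ℝ) (w : Fin k → E) : E →ₗ[ℝ] ℝ where
  toFun p := d (Fin.cons p w)
  map_add' _ _ := d.toMultilinearMap.cons_add _ _ _
  map_smul' _ _ := d.toMultilinearMap.cons_smul _ _ _

omit [FiniteDimensional ℂ E] in
lemma firstArg_apply {k : ℕ} (d : E [⋀^Fin (k + 1)]→L[ℝ] ℝ) (w : Fin k → E) (p : E) :
    firstArg d w p = d (Fin.cons p w) := rfl

/-- A form as a linear function of its second argument. -/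
def secondArg {k : ℕ} (d : E [⋀^Fin (k + 2)]→L[ℝ] ℝ) (p : E) (w : Fin k → E) : E →ₗ[ℝ] ℝ :=
  firstArg (d.curryLeft p) w

omit [FiniteDimensional ℂ E] in
lemma secondArg_apply {k : ℕ} (d : E [⋀^Fin (k + 2)]→L[ℝ] ℝ) (p : E) (w : Fin k → E) (q : E) :
    secondArg d p w q = d (Fin.cons p (Fin.cons q w)) := rfl

/-- The Hodge star operator on two-forms that are represented by an endomorphism `A`. -/
lemma hodgeStar_two (hB : IsHermitianInner B) {l : ℕ} (h : 2 * finrank ℂ E = l + 2)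
    (β : E [⋀^Fin 2]→L[ℝ] ℝ) (A : E → E) (hβ : ∀ v, β v = B (A (v 0)) (v 1)) (w : Fin l → E) :
    hodgeStar B l β w =
      (2 : ℝ)⁻¹ * mtrace B (fun a b => volForm B h (Fin.cons a (Fin.cons (A b) w))) := by
  have hc : ∀ u : Fin 2 → E, contract 2 (volForm B h) u w =
      secondArg (volForm B h) (u 0) w (u 1) := fun u => rfl
  rw [hodgeStar_apply B h]
  simp only [hc, hβ, ← (finTwoArrowEquiv _).symm.sum_comp, Fintype.sum_prod_type,
    Fin.prod_univ_two, finTwoArrowEquiv_symm_apply, Function.comp, Matrix.cons_val_zero,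
    Matrix.cons_val_one]
  rw [show ((Nat.factorial 2 : ℕ) : ℝ) = 2 by norm_num]
  congr 1
  rw [← mtrace_flip hB, mtrace]
  refine Finset.sum_congr rfl fun i _ => ?_
  rw [Finset.sum_comm]
  refine Finset.sum_congr rfl fun j _ => ?_
  rw [← secondArg_apply, linear_eq_mtrace hB, mtrace, Finset.mul_sum]
  refine Finset.sum_congr rfl fun i' _ => ?_
  rw [Finset.mul_sum]
  refine Finset.sum_congr rfl fun j' _ => ?_
  ring

/-- The Hodge star operator on forms of codegree one, which are contractions of the volume form. -/
lemma hodgeStar_codegree_one (hB : IsHermitianInner B) {k : ℕ} (h : 2 * finrank ℂ E = 1 + k)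
    (h' : 2 * finrank ℂ E = k + 1) (η : E [⋀^Fin k]→L[ℝ] ℝ) (Y : E)
    (hη : ∀ v, η v = volForm B h' (Fin.cons Y v)) (u : Fin 1 → E) :
    hodgeStar B 1 η u = -B Y (u 0) := by
  have : FiniteDimensional ℝ E := FiniteDimensional.complexToReal E
  have hdim : finrank ℝ E = k + 1 := by rw [finrank_real_of_complex, h']
  have hodd : (-1 : ℝ) ^ k = -1 := Odd.neg_one_pow (by
    rw [← Nat.not_even_iff_odd]
    rintro ⟨r, hr⟩
    omega)
  -- moving the last argument to the first place is a cyclic permutation of an even number of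
  -- arguments
  have hc : ∀ v : Fin k → E, contract k (volForm B h) v u =
      -volForm B h' (Fin.cons (u 0) v) := by
    intro v
    rw [contract_apply, volForm_cast B (Nat.add_comm k 1) h h']
    have e : (fun i : Fin (1 + k) => if h : (i : ℕ) < k then v ⟨i, h⟩ else u ⟨i - k, by omega⟩) ∘
        Fin.cast (Nat.add_comm k 1) = (Fin.cons (u 0) v : Fin (k + 1) → E) ∘ finRotate (k + 1) := by
      have e1 := Fin.snoc_eq_cons_rotate v (u 0)
      ext i
      change _ = (fun i => @Fin.cons _ (fun _ => E) (u 0) v (finRotate _ i)) i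
      rw [← e1]
      simp only [Fin.snoc, Function.comp, Fin.val_cast]
      split_ifs with hi
      · rfl
      · exact congrArg u (Subsingleton.elim _ _)
    rw [e]
    have := (volForm B h').toAlternatingMap.map_perm (Fin.cons (u 0) v : Fin (k + 1) → E)
      (finRotate (k + 1))
    rw [sign_finRotate] at this
    simp only [Nat.add_sub_cancel, Units.smul_def, Units.val_pow_eq_pow_val, Units.val_neg,
      Units.val_one, zsmul_eq_mul, Int.cast_pow, Int.cast_neg, Int.cast_one, hodd,
      neg_one_mul] at this
    exact this
  obtain ⟨b, hb⟩ := hB.exists_orthonormal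
  have hs := sum_gram_inv_prod hb ((volForm B h').curryLeft Y).toMultilinearMap
    ((volForm B h').curryLeft (u 0)).toMultilinearMap
  have hsum : ∑ i : Fin k → Fin (2 * finrank ℂ E), ∑ j : Fin k → Fin (2 * finrank ℂ E),
        (η (realBasis E ∘ i) * ∏ a, (gram B)⁻¹ (i a) (j a)) *
          contract k (volForm B h) (realBasis E ∘ j) u =
      -∑ c : Fin k → Fin (2 * finrank ℂ E), volForm B h' (Fin.cons Y (b ∘ c)) *
        volForm B h' (Fin.cons (u 0) (b ∘ c)) := by
    rw [← Finset.sum_neg_distrib]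
    refine Eq.trans ?_ ((congrArg Neg.neg hs).trans ?_)
    · rw [← Finset.sum_neg_distrib]
      refine Finset.sum_congr rfl fun i _ => ?_
      rw [← Finset.sum_neg_distrib]
      refine Finset.sum_congr rfl fun j _ => ?_
      rw [hη, hc, mul_neg]
      rfl
    · rw [← Finset.sum_neg_distrib]
      rfl
  set b' : Basis (Fin (k + 1)) ℝ E := b.reindex (finCongr h') with hb'
  have hY : ∑ t, (B Y : E →ₗ[ℝ] ℝ) (b' t) • b' t = Y := by
    rw [← (finCongr h').sum_comp]
    simp only [hb', Basis.reindex_apply, Equiv.symm_apply_apply]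
    refine b.ext_elem fun j => ?_
    have : ∀ v, b.repr v j = B v (b j) := fun v => by
      conv_rhs => rw [← b.sum_repr v]
      simp only [map_sum, sum_apply, map_smul, smul_apply, hb, smul_eq_mul, mul_ite, mul_one,
        mul_zero, Finset.sum_ite_eq', Finset.mem_univ, if_true]
    rw [map_sum, Finsupp.finsetSum_apply]
    simp only [map_smul, Finsupp.smul_apply, Basis.repr_self, Finsupp.single_apply, smul_eq_mul,
      mul_ite, mul_one, mul_zero, Finset.sum_ite_eq', Finset.mem_univ, if_true, this]
    rfl
  have htop := sum_top_mul_top hdim (volForm B h').toAlternatingMap b' (B Y : E →ₗ[ℝ] ℝ) Y (u 0) hY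
  have hvol : (volForm B h').toAlternatingMap b' ^ 2 = 1 := by
    change (√(gram B).det * ((realBasis E).reindex (finCongr h')).det b') ^ 2 = 1
    rw [mul_pow, Real.sq_sqrt hB.det_gram_pos.le, Basis.det_reindex, ← det_gram_mul_sq hb]
    congr 3
    ext i
    simp [hb']
  rw [hvol, mul_one, ← (Equiv.arrowCongr (Equiv.refl (Fin k)) (finCongr h')).sum_comp] at htop
  have hcomp : ∀ c : Fin k → Fin (2 * finrank ℂ E),
      b' ∘ (Equiv.arrowCongr (Equiv.refl (Fin k)) (finCongr h') c) = b ∘ c := fun c => by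
    ext i
    simp [hb']
  simp only [hcomp] at htop
  rw [hodgeStar_apply B h, hsum]
  have hfac : (k.factorial : ℝ) ≠ 0 := by positivity
  have : ∑ c : Fin k → Fin (2 * finrank ℂ E), volForm B h' (Fin.cons Y (b ∘ c)) *
        volForm B h' (Fin.cons (u 0) (b ∘ c)) = k.factorial * B Y (u 0) := htop
  rw [this]
  field_simp

/-! ### Derivatives of local hermitian metrics -/

section Jacobi

variable {V : Type*} [NormedAddCommGroup V] [NormedSpace ℝ V] {n : Type*} [Fintype n]
  [DecidableEq n]

/-- Jacobi's formula. -/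
lemma hasFDerivAt_det {M : V → Matrix n n ℝ} {M' : n → n → V →L[ℝ] ℝ} {y : V}
    (hM : ∀ i j, HasFDerivAt (fun z => M z i j) (M' i j) y) :
    HasFDerivAt (fun z => (M z).det) (∑ i, ∑ j, (M y).adjugate i j • M' j i) y := by
  have h1 : HasFDerivAt (fun z => (M z).det) (∑ σ : Equiv.Perm n,
      ((Equiv.Perm.sign σ : ℤ) : ℝ) • ∑ k, (∏ j ∈ Finset.univ.erase k, M y (σ j) j) •
        M' (σ k) k) y := by
    simp only [Matrix.det_apply, Units.smul_def, ← Int.cast_smul_eq_zsmul ℝ]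
    refine HasFDerivAt.fun_sum fun σ _ => ?_
    exact (HasFDerivAt.finsetProd fun k _ => hM (σ k) k).const_smul ((Equiv.Perm.sign σ : ℤ) : ℝ)
  convert h1 using 1
  ext u
  simp only [FunLike.coe_sum, Finset.sum_apply, FunLike.coe_smul, Pi.smul_apply, smul_eq_mul]
  calc ∑ i, ∑ j, (M y).adjugate i j * M' j i u
      = ∑ i, ((M y).updateCol i fun j => M' j i u).det := by
        refine Finset.sum_congr rfl fun i _ => ?_
        rw [← Matrix.cramer_apply, Matrix.cramer_eq_adjugate_mulVec]
        rfl
    _ = _ := by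
        simp only [Matrix.det_apply, Units.smul_def, ← Int.cast_smul_eq_zsmul ℝ, Finset.mul_sum,
          smul_eq_mul]
        rw [Finset.sum_comm]
        refine Finset.sum_congr rfl fun σ _ => Finset.sum_congr rfl fun k _ => ?_
        rw [← Finset.mul_prod_erase _ _ (Finset.mem_univ k), Matrix.updateCol_self, mul_comm (M' _ _ u)]
        congr 2
        refine Finset.prod_congr rfl fun j hj => ?_
        rw [Matrix.updateCol_ne (Finset.ne_of_mem_erase hj)]

lemma differentiableAt_inv_apply {M : V → Matrix n n ℝ} {y : V}
    (hM : ∀ i j, DifferentiableAt ℝ (fun z => M z i j) y) (h0 : (M y).det ≠ 0) (i j : n) :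
    DifferentiableAt ℝ (fun z => (M z)⁻¹ i j) y := by
  have hd : ∀ N : V → Matrix n n ℝ, (∀ i j, DifferentiableAt ℝ (fun z => N z i j) y) →
      DifferentiableAt ℝ (fun z => (N z).det) y := fun N hN =>
    (hasFDerivAt_det fun i j => (hN i j).hasFDerivAt).differentiableAt
  simp only [Matrix.inv_def, Ring.inverse_eq_inv', Matrix.smul_apply, smul_eq_mul,
    Matrix.adjugate_apply]
  refine ((hd M hM).inv h0).mul (hd _ fun i' j' => ?_)
  simp only [Matrix.updateRow_apply]
  split_ifs
  · exact differentiableAt_const _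
  · exact hM _ _

end Jacobi

section Jet

variable {E : Type*} [NormedAddCommGroup E] [NormedSpace ℂ E]

/-- The field of bilinear forms `G` is differentiable at `y` and is a hermitian metric near `y`. -/
structure IsHermitianAt (G : E → E →L[ℝ] E →L[ℝ] ℝ) (y : E) : Prop where
  diff : ∀ v w, DifferentiableAt ℝ (fun z => G z v w) y
  eventually : ∀ᶠ z in 𝓝 y, IsHermitianInner (G z)

/-- The derivative of a field of bilinear forms. -/
def jet (G : E → E →L[ℝ] E →L[ℝ] ℝ) (y u v w : E) : ℝ := fderiv ℝ (fun z => G z v w) y u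

variable {G : E → E →L[ℝ] E →L[ℝ] ℝ} {y : E}

lemma IsHermitianAt.self (hG : IsHermitianAt G y) : IsHermitianInner (G y) :=
  hG.eventually.self_of_nhds

lemma IsHermitianAt.isHermitianJet (hG : IsHermitianAt G y) : IsHermitianJet (jet G y) where
  add_left u u' v w := (fderiv ℝ (fun z => G z v w) y).map_add u u'
  smul_left c u v w := (fderiv ℝ (fun z => G z v w) y).map_smul c u
  add_mid u v v' w := by
    have h : (fun z => G z (v + v') w) = fun z => G z v w + G z v' w := by
      ext z; exact inner_add _ _ _ _
    rw [jet, h, fderiv_fun_add (hG.diff v w) (hG.diff v' w)]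
    rfl
  smul_mid c u v w := by
    have h : (fun z => G z (c • v) w) = fun z => c * G z v w := by
      ext z; exact inner_smul _ _ _ _
    rw [jet, h, fderiv_const_mul (hG.diff v w)]
    rfl
  symm u v w := by
    have h : (fun z => G z v w) =ᶠ[𝓝 y] fun z => G z w v := by
      filter_upwards [hG.eventually] with z hz using hz.symm v w
    rw [jet, h.fderiv_eq]
    rfl
  inv u v w := by
    have h : (fun z => G z (Complex.I • v) (Complex.I • w)) =ᶠ[𝓝 y] fun z => G z v w := by
      filter_upwards [hG.eventually] with z hz using hz.inv v w
    rw [jet, h.fderiv_eq]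
    rfl

variable [FiniteDimensional ℂ E]

/-- Jacobi's formula: `d det G = det G · tr (G⁻¹ dG)`. -/
lemma IsHermitianAt.hasFDerivAt_det_gram (hG : IsHermitianAt G y) :
    DifferentiableAt ℝ (fun z => (gram (G z)).det) y ∧ ∀ u,
      fderiv ℝ (fun z => (gram (G z)).det) y u = (gram (G y)).det * mtrace (G y) (jet G y u) := by
  have h := hasFDerivAt_det (M := fun z => gram (G z))
    (fun i j => (hG.diff (realBasis E i) (realBasis E j)).hasFDerivAt)
  refine ⟨h.differentiableAt, fun u => ?_⟩
  rw [h.fderiv]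
  simp only [FunLike.coe_sum, Finset.sum_apply, FunLike.coe_smul, Pi.smul_apply, smul_eq_mul,
    mtrace, Finset.mul_sum]
  refine Finset.sum_congr rfl fun i _ => Finset.sum_congr rfl fun j _ => ?_
  rw [Matrix.inv_def, Ring.inverse_eq_inv', Matrix.smul_apply, smul_eq_mul,
    hG.isHermitianJet.symm, ← mul_assoc, ← mul_assoc, mul_inv_cancel₀ hG.self.det_gram_pos.ne',
    one_mul]
  rfl

lemma IsHermitianAt.hasFDerivAt_sqrt_det (hG : IsHermitianAt G y) :
    DifferentiableAt ℝ (fun z => √(gram (G z)).det) y ∧ ∀ u,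
      fderiv ℝ (fun z => √(gram (G z)).det) y u =
        √(gram (G y)).det * ((2 : ℝ)⁻¹ * mtrace (G y) (jet G y u)) := by
  have h0 := hG.self.det_gram_pos
  have h := (hG.hasFDerivAt_det_gram.1.hasFDerivAt).sqrt h0.ne'
  refine ⟨h.differentiableAt, fun u => ?_⟩
  rw [h.fderiv, FunLike.coe_smul, Pi.smul_apply, hG.hasFDerivAt_det_gram.2 u, smul_eq_mul]
  have hs : √(gram (G y)).det ≠ 0 := (Real.sqrt_pos.2 h0).ne'
  have hs2 := Real.mul_self_sqrt h0.le
  set s := √(gram (G y)).det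
  rw [← hs2]
  field_simp

lemma IsHermitianAt.differentiableAt_gram_inv (hG : IsHermitianAt G y) (i j) :
    DifferentiableAt ℝ (fun z => (gram (G z))⁻¹ i j) y :=
  differentiableAt_inv_apply (fun i j => hG.diff (realBasis E i) (realBasis E j))
    hG.self.det_gram_pos.ne' i j

/-- The formula `d(G⁻¹) = -G⁻¹ dG G⁻¹`. -/
lemma IsHermitianAt.fderiv_gram_inv (hG : IsHermitianAt G y) (i l) (u : E) :
    fderiv ℝ (fun z => (gram (G z))⁻¹ i l) y u = -∑ j, ∑ k, (gram (G y))⁻¹ i j *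
      jet G y u (realBasis E j) (realBasis E k) * (gram (G y))⁻¹ k l := by
  have hd : ∀ j k, DifferentiableAt ℝ (fun z => gram (G z) j k) y :=
    fun j k => hG.diff (realBasis E j) (realBasis E k)
  have h1 : ∀ k, ∑ j, (fderiv ℝ (fun z => (gram (G z))⁻¹ i j) y u * gram (G y) j k +
      (gram (G y))⁻¹ i j * jet G y u (realBasis E j) (realBasis E k)) = 0 := by
    intro k
    have he : (fun z => ∑ j, (gram (G z))⁻¹ i j * gram (G z) j k) =ᶠ[𝓝 y]
        fun _ => if i = k then 1 else 0 := by
      filter_upwards [hG.eventually] with z hz using hz.sum_gram_inv_mul i k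
    have h2 := he.fderiv_eq (𝕜 := ℝ)
    have hm : ∀ j, DifferentiableAt ℝ (fun z => (gram (G z))⁻¹ i j * gram (G z) j k) y :=
      fun j => (hG.differentiableAt_gram_inv i j).mul (hd j k)
    rw [fderiv_fun_sum fun j _ => hm j] at h2
    have h3 := congrArg (fun f : E →L[ℝ] ℝ => f u) h2
    simp only [fderiv_fun_const, FunLike.coe_sum, Finset.sum_apply] at h3
    refine Eq.trans (Finset.sum_congr rfl fun j _ => ?_) h3
    rw [fderiv_fun_mul (hG.differentiableAt_gram_inv i j) (hd j k)]
    simp only [add_apply, smul_apply, smul_eq_mul]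
    rw [add_comm, mul_comm (gram (G y) j k)]
    rfl
  have hinv : ∀ j, ∑ k, gram (G y) j k * (gram (G y))⁻¹ k l = if j = l then 1 else 0 := by
    intro j
    have h := Matrix.mul_nonsing_inv (gram (G y)) (isUnit_iff_ne_zero.2 hG.self.det_gram_pos.ne')
    have := congrFun (congrFun h j) l
    rwa [Matrix.mul_apply, Matrix.one_apply] at this
  have h4 : ∑ k, (∑ j, (fderiv ℝ (fun z => (gram (G z))⁻¹ i j) y u * gram (G y) j k +
      (gram (G y))⁻¹ i j * jet G y u (realBasis E j) (realBasis E k))) * (gram (G y))⁻¹ k l = 0 := by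
    simp [h1]
  simp only [Finset.sum_mul, add_mul] at h4
  rw [Finset.sum_comm] at h4
  simp only [Finset.sum_add_distrib, mul_assoc, ← Finset.mul_sum, hinv, mul_ite, mul_one, mul_zero,
    Finset.sum_ite_eq', Finset.mem_univ, if_true] at h4
  simp only [mul_assoc, ← Finset.mul_sum]
  linarith

lemma IsHermitianAt.fderiv_gram_inv_mul (hG : IsHermitianAt G y) (i l) (c : ℝ) (u : E) :
    fderiv ℝ (fun z => (gram (G z))⁻¹ i l * c) y u =
      -∑ j, ∑ k, (gram (G y))⁻¹ i j * ((gram (G y))⁻¹ k l *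
        (jet G y u (realBasis E j) (realBasis E k) * c)) := by
  rw [fderiv_mul_const (hG.differentiableAt_gram_inv i l), FunLike.coe_smul, Pi.smul_apply,
    hG.fderiv_gram_inv, smul_eq_mul, mul_neg, Finset.mul_sum]
  refine congrArg Neg.neg (Finset.sum_congr rfl fun j _ => ?_)
  rw [Finset.mul_sum]
  refine Finset.sum_congr rfl fun k _ => ?_
  ring

/-- The derivative of the trace of a constant bilinear form with respect to a varying metric. -/
lemma IsHermitianAt.hasFDerivAt_mtrace (hG : IsHermitianAt G y) {T : E → E → ℝ}
    (hT : IsBilinearMap ℝ T) :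
    DifferentiableAt ℝ (fun z => mtrace (G z) T) y ∧ ∀ u,
      fderiv ℝ (fun z => mtrace (G z) T) y u =
        -mtrace (G y) (fun a b => T a (sharpFun (G y) (jet G y u b))) := by
  have hd : ∀ i l, DifferentiableAt ℝ
      (fun z => (gram (G z))⁻¹ i l * T (realBasis E i) (realBasis E l)) y := fun i l =>
    (hG.differentiableAt_gram_inv i l).mul_const _
  have hd' : ∀ i, DifferentiableAt ℝ
      (fun z => ∑ l, (gram (G z))⁻¹ i l * T (realBasis E i) (realBasis E l)) y := fun i =>
    DifferentiableAt.fun_sum fun l _ => hd i l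
  have e : (fun z => mtrace (G z) T) =
    fun z => ∑ i, ∑ l, (gram (G z))⁻¹ i l * T (realBasis E i) (realBasis E l) := rfl
  rw [e]
  refine ⟨DifferentiableAt.fun_sum fun i _ => hd' i, fun u => ?_⟩
  have hX : ∀ a b, T a (sharpFun (G y) (jet G y u b)) =
      ∑ k, ∑ l, (gram (G y))⁻¹ k l * (jet G y u b (realBasis E k) * T a (realBasis E l)) :=
    fun a b => linear_sharpFun (G y) (hT.toLinearMap a) (jet G y u b)
  rw [fderiv_fun_sum fun i _ => hd' i, FunLike.coe_sum, Finset.sum_apply, mtrace,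
    ← Finset.sum_neg_distrib]
  refine Finset.sum_congr rfl fun i _ => ?_
  rw [fderiv_fun_sum fun l _ => hd i l, FunLike.coe_sum, Finset.sum_apply]
  have h1 : ∀ l, fderiv ℝ (fun z => (gram (G z))⁻¹ i l * T (realBasis E i) (realBasis E l)) y u =
      -∑ j, ∑ k, (gram (G y))⁻¹ i j * ((gram (G y))⁻¹ k l *
        (jet G y u (realBasis E j) (realBasis E k) * T (realBasis E i) (realBasis E l))) :=
    fun l => hG.fderiv_gram_inv_mul i l _ u
  simp only [h1, hX]
  rw [Finset.sum_neg_distrib]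
  refine congrArg Neg.neg (Finset.sum_comm.trans (Finset.sum_congr rfl fun j _ => ?_))
  rw [Finset.mul_sum, Finset.sum_comm]
  refine Finset.sum_congr rfl fun k _ => ?_
  rw [Finset.mul_sum]

/-! #### The codifferential of the Kähler form -/

lemma mtrace_sum (B : E →L[ℝ] E →L[ℝ] ℝ) {ι : Type*} (s : Finset ι) (T : ι → E → E → ℝ) :
    mtrace B (fun a b => ∑ r ∈ s, T r a b) = ∑ r ∈ s, mtrace B (T r) := by
  classical
  induction s using Finset.induction_on with
  | empty => simp [mtrace]
  | insert r s hr ih => simp [Finset.sum_insert hr, mtrace_add, ih]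

lemma mtrace_mtrace_comm (B : E →L[ℝ] E →L[ℝ] ℝ) (T : E → E → E → E → ℝ) :
    mtrace B (fun a b => mtrace B (fun c d => T a b c d)) =
      mtrace B (fun c d => mtrace B (fun a b => T a b c d)) := by
  have h : ∀ c d, mtrace B (fun a b => T a b c d) = ∑ i, ∑ j, (gram B)⁻¹ i j *
    T (realBasis E i) (realBasis E j) c d := fun _ _ => rfl
  have h' : mtrace B (fun a b => mtrace B (fun c d => T a b c d)) = ∑ i, ∑ j, (gram B)⁻¹ i j *
    mtrace B (fun c d => T (realBasis E i) (realBasis E j) c d) := rfl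
  simp only [h, h', mtrace_sum, mtrace_const_mul]

/-- The differential of the form `⋆ω`. Only the volume form and the metric traces enter. -/
lemma extDeriv_star_kahler (hG : IsHermitianAt G y) {l : ℕ} (h : 2 * finrank ℂ E = l + 2)
    {F : E → E [⋀^Fin l]→L[ℝ] ℝ}
    (hF : ∀ᶠ z in 𝓝 y, ∀ w, F z w = (2 : ℝ)⁻¹ *
      mtrace (G z) (fun a b => volForm (G z) h (Fin.cons a (Fin.cons (Complex.I • b) w))))
    (v : Fin (l + 1) → E) :
    extDeriv F y v =
      volForm (G y) h (Fin.cons (sharpFun (G y) (kahlerCodiff (G y) (jet G y))) v) := by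
  have : FiniteDimensional ℝ E := FiniteDimensional.complexToReal E
  have hdim : finrank ℝ E = l + 2 := by rw [finrank_real_of_complex, h]
  have hB := hG.self
  have hD := hG.isHermitianJet
  set B := G y with hBdef
  set D := jet G y with hDdef
  set d0 := volForm B h with hd0
  have hs0 : √(gram B).det ≠ 0 := (Real.sqrt_pos.2 hB.det_gram_pos).ne'
  let T : (Fin l → E) → E → E → ℝ := fun w a b => d0 (Fin.cons a (Fin.cons (Complex.I • b) w))
  have hTbil : ∀ w, IsBilinearMap ℝ (T w) := fun w =>
    ⟨fun a a' b => (firstArg d0 _).map_add a a', fun c a b => (firstArg d0 _).map_smul c a,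
      fun a b b' => by
        simp only [T, smul_add]; exact (secondArg d0 a w).map_add _ _,
      fun c a b => by
        simp only [T, smul_comm Complex.I c]; exact (secondArg d0 a w).map_smul _ _⟩
  have hvol : ∀ z x, volForm (G z) h x = (√(gram (G z)).det / √(gram B).det) * d0 x := by
    intro z x
    simp only [hd0, volForm_apply]
    field_simp
  have hF' : ∀ᶠ z in 𝓝 y, ∀ w, F z w =
      √(gram (G z)).det * ((√(gram B).det)⁻¹ * ((2 : ℝ)⁻¹ * mtrace (G z) (T w))) := by
    filter_upwards [hF] with z hz w
    rw [hz]
    simp only [hvol, mtrace_const_mul, T]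
    ring
  -- `F` is differentiable, being a combination of constant forms with differentiable coefficients
  have hFd : DifferentiableAt ℝ F y := by
    have e : F =ᶠ[𝓝 y] fun z => ∑ i, ∑ j, (√(gram (G z)).det * ((√(gram B).det)⁻¹ *
        ((2 : ℝ)⁻¹ * (gram (G z))⁻¹ i j))) •
          ((d0.curryLeft (realBasis E i)).curryLeft (Complex.I • realBasis E j)) := by
      filter_upwards [hF'] with z hz
      ext w
      rw [hz]
      simp only [ContinuousAlternatingMap.sum_apply, ContinuousAlternatingMap.smul_apply, mtrace,
        Finset.mul_sum, smul_eq_mul]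
      refine Finset.sum_congr rfl fun i _ => Finset.sum_congr rfl fun j _ => ?_
      have : ((d0.curryLeft (realBasis E i)).curryLeft (Complex.I • realBasis E j)) w =
        T w (realBasis E i) (realBasis E j) := rfl
      rw [this]
      ring
    refine DifferentiableAt.congr_of_eventuallyEq ?_ e
    refine DifferentiableAt.fun_sum fun i _ => DifferentiableAt.fun_sum fun j _ => ?_
    exact ((hG.hasFDerivAt_sqrt_det.1).mul (((hG.differentiableAt_gram_inv i j).const_mul
      _).const_mul _)).smul_const _
  have hderiv : ∀ w u, fderiv ℝ (fun z => F z w) y u =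
      (4 : ℝ)⁻¹ * mtrace B (D u) * mtrace B (T w) -
        (2 : ℝ)⁻¹ * mtrace B (fun a b => T w a (sharpFun B (D u b))) := by
    intro w u
    have e : (fun z => F z w) =ᶠ[𝓝 y] fun z => √(gram (G z)).det *
        ((√(gram B).det)⁻¹ * ((2 : ℝ)⁻¹ * mtrace (G z) (T w))) := by
      filter_upwards [hF'] with z hz using hz w
    obtain ⟨hm1, hm2⟩ := hG.hasFDerivAt_mtrace (hTbil w)
    rw [e.fderiv_eq, fderiv_fun_mul hG.hasFDerivAt_sqrt_det.1 ((hm1.const_mul _).const_mul _),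
      fderiv_const_mul (hm1.const_mul _), fderiv_const_mul hm1]
    simp only [add_apply, smul_apply, smul_eq_mul, hG.hasFDerivAt_sqrt_det.2, hm2, ← hBdef,
      ← hDdef]
    field_simp
    ring
  rw [extDeriv_apply hFd]
  simp only [hderiv, zsmul_eq_mul, Int.cast_pow, Int.cast_neg, Int.cast_one]
  -- the linear form `X(p) = vol(p, v)`, and the traces that occur in `d*ω`
  set X := firstArg d0 v with hX
  let S : E → ℝ := fun c => mtrace B (fun a b => D a c (Complex.I • b))
  let α : E →ₗ[ℝ] ℝ :=
    { toFun := fun u => mtrace B (D u)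
      map_add' := fun u u' => by
        rw [← mtrace_add]; congr 1; ext a b; exact hD.add_left u u' a b
      map_smul' := fun c u => by
        rw [RingHom.id_apply, smul_eq_mul, ← mtrace_const_mul]; congr 1; ext a b
        exact hD.smul_left c u a b }
  have hdX : ∀ (β : E →ₗ[ℝ] ℝ) (p q : E), ∑ r : Fin (l + 1), (-1) ^ (r : ℕ) *
      (β (v r) * d0 (Fin.cons p (Fin.cons q (Fin.removeNth r v)))) = β q * X p - β p * X q :=
    fun β p q => sum_linear_mul_top_two hdim d0.toAlternatingMap β p q v
  have hIX : ∀ β : E →ₗ[ℝ] ℝ, mtrace B (fun a b => β a * X (Complex.I • b)) =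
      -mtrace B (fun a b => β (Complex.I • a) * X b) := by
    intro β
    have hbil : IsBilinearMap ℝ (fun a b => β a * X b) :=
      ⟨fun a b c => by simp only [map_add]; ring,
        fun c a b => by simp only [LinearMap.map_smul, smul_eq_mul]; ring,
        fun a b c => by simp only [map_add]; ring,
        fun c a b => by simp only [LinearMap.map_smul, smul_eq_mul]; ring⟩
    have := mtrace_smul_I_left hB hbil
    linarith
  have t1 : ∑ r : Fin (l + 1), (-1) ^ (r : ℕ) * (α (v r) * mtrace B (T (Fin.removeNth r v))) =
      2 * mtrace B (fun a b => α (Complex.I • a) * X b) := by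
    have e : ∀ r : Fin (l + 1), (-1) ^ (r : ℕ) * (α (v r) * mtrace B (T (Fin.removeNth r v))) =
        mtrace B (fun a b => (-1) ^ (r : ℕ) * (α (v r) *
          d0 (Fin.cons a (Fin.cons (Complex.I • b) (Fin.removeNth r v))))) := by
      intro r
      rw [← mtrace_const_mul, ← mtrace_const_mul]
    simp only [e, ← mtrace_sum, hdX, mtrace_sub, hIX]
    rw [← mtrace_flip hB]
    ring
  have t2 : ∑ r : Fin (l + 1), (-1) ^ (r : ℕ) *
      mtrace B (fun a b => T (Fin.removeNth r v) a (sharpFun B (D (v r) b))) =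
      -2 * mtrace B (fun a b => S a * X b) := by
    have e : ∀ r : Fin (l + 1), (-1) ^ (r : ℕ) *
        mtrace B (fun a b => T (Fin.removeNth r v) a (sharpFun B (D (v r) b))) =
        mtrace B (fun a b => mtrace B (fun c d => (-1) ^ (r : ℕ) * (D (v r) b c *
          d0 (Fin.cons a (Fin.cons (Complex.I • d) (Fin.removeNth r v)))))) := by
      intro r
      rw [← mtrace_const_mul]
      congr 1
      ext a b
      have := linear_sharpFun B ((hTbil (Fin.removeNth r v)).toLinearMap a) (D (v r) b)
      rw [mtrace_const_mul]
      exact congrArg _ this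
    let β : E → E → E →ₗ[ℝ] ℝ := fun b c =>
      { toFun := fun u => D u b c
        map_add' := fun u u' => hD.add_left u u' b c
        map_smul' := fun s u => hD.smul_left s u b c }
    have hβ : ∀ a b c d, ∑ r : Fin (l + 1), (-1) ^ (r : ℕ) * (D (v r) b c *
        d0 (Fin.cons a (Fin.cons (Complex.I • d) (Fin.removeNth r v)))) =
        D (Complex.I • d) b c * X a - D a b c * X (Complex.I • d) := fun a b c d =>
      hdX (β b c) a (Complex.I • d)
    simp only [e, ← mtrace_sum, hβ, mtrace_sub]
    have e1 : mtrace B (fun a b => mtrace B (fun c d => D (Complex.I • d) b c * X a)) =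
        -mtrace B (fun a b => S a * X b) := by
      have : ∀ b, mtrace B (fun c d => D (Complex.I • d) b c) = -S b := fun b => by
        have h1 := mtrace_smul_I_left hB (hD.isBilinearMap_mid b)
        rw [← mtrace_flip hB] at h1
        exact h1
      simp only [mul_comm _ (X _), mtrace_const_mul, this]
      rw [← mtrace_flip hB, ← mtrace_neg]
      congr 1
      ext a b
      ring
    have e2 : mtrace B (fun a b => mtrace B (fun c d => D a b c * X (Complex.I • d))) =
        mtrace B (fun a b => S a * X b) := by
      rw [mtrace_mtrace_comm]
      let τ : E →ₗ[ℝ] ℝ :=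
        { toFun := fun c => mtrace B (fun a b => D a b c)
          map_add' := fun u u' => by
            rw [← mtrace_add]; congr 1; ext a b; exact hD.add_right a b u u'
          map_smul' := fun c u => by
            rw [RingHom.id_apply, smul_eq_mul, ← mtrace_const_mul]; congr 1; ext a b
            exact hD.smul_right c a b u }
      have hτ : ∀ c, τ (Complex.I • c) = -S c := by
        intro c
        change mtrace B (fun a b => D a b (Complex.I • c)) = -mtrace B _
        rw [← mtrace_neg]
        congr 1
        ext a b
        rw [hD.symm, hD.smul_I_mid]
      have hm : ∀ c d, mtrace B (fun a b => D a b c * X (Complex.I • d)) =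
          τ c * X (Complex.I • d) := fun c d => by
        simp only [mul_comm _ (X _), mtrace_const_mul]
        rfl
      simp only [hm, hIX, hτ]
      rw [← mtrace_neg]
      congr 1
      ext a b
      ring
    rw [e1, e2]
    ring
  have e0 : ∀ r : Fin (l + 1), (-1) ^ (r : ℕ) * ((4 : ℝ)⁻¹ * mtrace B (D (v r)) *
      mtrace B (T (Fin.removeNth r v)) -
        (2 : ℝ)⁻¹ * mtrace B (fun a b => T (Fin.removeNth r v) a (sharpFun B (D (v r) b)))) =
      (4 : ℝ)⁻¹ * ((-1) ^ (r : ℕ) * (α (v r) * mtrace B (T (Fin.removeNth r v)))) -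
      (2 : ℝ)⁻¹ * ((-1) ^ (r : ℕ) *
        mtrace B (fun a b => T (Fin.removeNth r v) a (sharpFun B (D (v r) b)))) := fun r => by
    have : α (v r) = mtrace B (D (v r)) := rfl
    rw [this]
    ring
  simp only [e0]
  rw [Finset.sum_sub_distrib, ← Finset.mul_sum, ← Finset.mul_sum, t1, t2, ← firstArg_apply,
    linear_sharpFun]
  have e3 : ∀ a b, kahlerCodiff B D a * X b = S a * X b + (2 : ℝ)⁻¹ * (α (Complex.I • a) * X b) :=
    fun a b => by
      change (S a + (2 : ℝ)⁻¹ * α (Complex.I • a)) * X b = _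
      ring
  rw [← hX]
  simp only [e3, mtrace_add, mtrace_const_mul]
  ring

end Jet

/-! ### The norm of a holomorphic volume form -/

section Wedge

variable {E : Type*} [NormedAddCommGroup E] [NormedSpace ℂ E] {A : Type*} [CommRing A] [Algebra ℝ A]

/-- The wedge product of alternatizations is the alternatization of the product. -/
lemma wedge_alternatization {k l : ℕ} (a : MultilinearMap ℝ (fun _ : Fin k => E) A)
    (b : MultilinearMap ℝ (fun _ : Fin l => E) A) (v : Fin (k + l) → E) :
    wedge (MultilinearMap.alternatization a) (MultilinearMap.alternatization b) v =
      ∑ σ : Equiv.Perm (Fin (k + l)), Equiv.Perm.sign σ •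
        (a (fun i => v (σ (Fin.castAdd l i))) * b (fun j => v (σ (Fin.natAdd k j)))) := by
  rw [wedge, ← MultilinearMap.domCoprod_alternization, AlternatingMap.domDomCongr_apply,
    LinearMap.compAlternatingMap_apply, MultilinearMap.alternatization_apply, map_sum]
  refine Fintype.sum_equiv (Equiv.permCongr finSumFinEquiv) _ _ fun σ => ?_
  rw [Equiv.Perm.sign_permCongr]
  rw [LinearMap.map_smul_of_tower]
  congr 1
  simp [Equiv.permCongr_apply, Function.comp_def]

end Wedge

section Constants

variable {E : Type*} [NormedAddCommGroup E] [NormedSpace ℂ E] [FiniteDimensional ℂ E]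

/-- The real part of the `k`-th complex coordinate. -/
def reCoord (k : Fin (finrank ℂ E)) : E →ₗ[ℝ] ℝ :=
  Complex.reLm ∘ₗ ((finBasis ℂ E).coord k).restrictScalars ℝ

/-- The imaginary part of the `k`-th complex coordinate. -/
def imCoord (k : Fin (finrank ℂ E)) : E →ₗ[ℝ] ℝ :=
  Complex.imLm ∘ₗ ((finBasis ℂ E).coord k).restrictScalars ℝ

lemma reCoord_realIndex (k : Fin (finrank ℂ E)) (p) :
    reCoord k (realBasis E (realIndex E p)) = if p = (k, 0) then 1 else 0 := by
  obtain ⟨j, a⟩ := p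
  fin_cases a <;>
  simp [reCoord, realBasis_realIndex, Finsupp.single_apply, Prod.ext_iff] <;>
  split_ifs <;> simp

lemma imCoord_realIndex (k : Fin (finrank ℂ E)) (p) :
    imCoord k (realBasis E (realIndex E p)) = if p = (k, 1) then 1 else 0 := by
  obtain ⟨j, a⟩ := p
  fin_cases a <;>
  simp [imCoord, realBasis_realIndex, Finsupp.single_apply, Prod.ext_iff] <;>
  split_ifs <;> simp

/-- The bilinear form `∑ xₖ ⊗ yₖ`, whose alternatization is the standard Kähler form. -/
def halfKahler (Q : E →ₗ[ℝ] E) : MultilinearMap ℝ (fun _ : Fin 2 => E) ℝ :=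
  ∑ k, (MultilinearMap.mkPiAlgebra ℝ (Fin 2) ℝ).compLinearMap
    ![reCoord k ∘ₗ Q, imCoord k ∘ₗ Q]

lemma halfKahler_apply (Q : E →ₗ[ℝ] E) (v : Fin 2 → E) :
    halfKahler Q v = ∑ k, reCoord k (Q (v 0)) * imCoord k (Q (v 1)) := by
  simp [halfKahler, Fin.prod_univ_two]

/-- The powers of the bilinear form `halfKahler`. -/
def halfKahlerPow (Q : E →ₗ[ℝ] E) : (m : ℕ) → MultilinearMap ℝ (fun _ : Fin (2 * m) => E) ℝ
  | 0 => (show MultilinearMap ℝ (fun _ : Fin 0 => E) ℝ from MultilinearMap.constOfIsEmpty ℝ _ 1)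
  | m + 1 => ((LinearMap.mul' ℝ ℝ).compMultilinearMap
      (MultilinearMap.domCoprod (halfKahlerPow Q m) (halfKahler Q))).domDomCongr finSumFinEquiv

lemma halfKahlerPow_apply (Q : E →ₗ[ℝ] E) (m : ℕ) (v : Fin (2 * m) → E) :
    halfKahlerPow Q m v = ∏ k : Fin m, ∑ l,
      reCoord l (Q (v ⟨2 * k, by omega⟩)) * imCoord l (Q (v ⟨2 * k + 1, by omega⟩)) := by
  induction m with
  | zero => rfl
  | succ m ih =>
    rw [Fin.prod_univ_castSucc]
    have h : halfKahlerPow Q (m + 1) v = halfKahlerPow Q m (fun i => v (Fin.castAdd 2 i)) *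
        halfKahler Q (fun j => v (Fin.natAdd (2 * m) j)) := by
      simp [halfKahlerPow]
      rfl
    rw [h, ih, halfKahler_apply]
    rfl

/-- Powers of the Kähler form are alternatizations of products. In this form they can be evaluated on
the real basis by a sum over permutations. -/
lemma wedgePow_eq_alternatization {β : E [⋀^Fin 2]→ₗ[ℝ] ℝ} (Q : E →ₗ[ℝ] E)
    (hβ : β = MultilinearMap.alternatization (halfKahler Q)) (m : ℕ) :
    wedgePow β m = MultilinearMap.alternatization (halfKahlerPow Q m) := by
  induction m with
  | zero =>
    ext v
    simp [wedgePow, halfKahlerPow, MultilinearMap.alternatization_apply]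
  | succ m ih =>
    ext v
    rw [wedgePow, ih, hβ, wedge_alternatization, MultilinearMap.alternatization_apply]
    refine Finset.sum_congr rfl fun σ _ => ?_
    simp [halfKahlerPow]
    rfl

/-- The standard value of the top power of the Kähler form is positive. -/
lemma alternatization_halfKahlerPow_pos :
    0 < MultilinearMap.alternatization (halfKahlerPow (LinearMap.id : E →ₗ[ℝ] E) (finrank ℂ E))
      (realBasis E) := by
  set n := finrank ℂ E with hn
  have hidx0 : ∀ k : Fin n, (⟨2 * k, by omega⟩ : Fin (2 * n)) = realIndex E (k, 0) := fun k => by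
    ext; simp [realIndex, finProdFinEquiv]
  have hidx1 : ∀ k : Fin n, (⟨2 * k + 1, by omega⟩ : Fin (2 * n)) = realIndex E (k, 1) :=
    fun k => by ext; simp [realIndex, finProdFinEquiv]; ring
  let η : Fin n × Fin 2 → Fin n × Fin 2 → ℝ := fun p q =>
    ∑ l : Fin n, (if p = (l, 0) then 1 else 0) * (if q = (l, 1) then 1 else 0)
  have hη0 : ∀ p q, η p q = 0 ∨ ∃ l, p = (l, 0) ∧ q = (l, 1) := by
    intro p q
    by_cases h : ∃ l, p = (l, 0) ∧ q = (l, 1)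
    · exact Or.inr h
    · refine Or.inl (Finset.sum_eq_zero fun l _ => ?_)
      by_contra hne
      refine h ⟨l, ?_⟩
      constructor <;> by_contra hh <;> simp [hh] at hne
  have hηn : ∀ p q, 0 ≤ η p q := fun p q => Finset.sum_nonneg fun l _ => by
    split_ifs <;> simp
  have hη1 : ∀ k, 0 < η (k, 0) (k, 1) := fun k => by
    refine Finset.sum_pos' (fun l _ => by split_ifs <;> simp) ⟨k, Finset.mem_univ _, by simp⟩
  have hsum : MultilinearMap.alternatization
      (halfKahlerPow (LinearMap.id : E →ₗ[ℝ] E) n) (realBasis E) =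
      ∑ σ : Equiv.Perm (Fin n × Fin 2), ((Equiv.Perm.sign σ : ℤ) : ℝ) *
        ∏ k : Fin n, η (σ (k, 0)) (σ (k, 1)) := by
    rw [MultilinearMap.alternatization_apply]
    refine Fintype.sum_equiv (Equiv.permCongr (realIndex E).symm) _ _ fun σ => ?_
    rw [Equiv.Perm.sign_permCongr, Units.smul_def, zsmul_eq_mul]
    congr 1
    rw [MultilinearMap.domDomCongr_apply, halfKahlerPow_apply]
    refine Finset.prod_congr rfl fun k _ => Finset.sum_congr rfl fun l _ => ?_
    have h := fun i => (realIndex E).apply_symm_apply (σ i)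
    rw [hidx0, hidx1, LinearMap.id_apply, LinearMap.id_apply, ← h (realIndex E (k, 0)),
      ← h (realIndex E (k, 1)), reCoord_realIndex, imCoord_realIndex]
    rfl
  rw [hsum]
  refine Finset.sum_pos' (fun σ _ => ?_) ⟨1, Finset.mem_univ _, ?_⟩
  · by_cases h : ∏ k : Fin n, η (σ (k, 0)) (σ (k, 1)) = 0
    · simp [h]
    · -- the permutation respects the pairs, so that its sign is a square
      have h' := fun k => (hη0 _ _).resolve_left (Finset.prod_ne_zero_iff.1 h k (Finset.mem_univ k))
      choose L hL0 hL1 using h'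
      have hinj : Function.Injective L := fun k k' hk => by
        have : σ (k, 0) = σ (k', 0) := by rw [hL0, hL0, hk]
        exact (Prod.ext_iff.1 (σ.injective this)).1
      let ρ : Equiv.Perm (Fin n) := Equiv.ofBijective L (Finite.injective_iff_bijective.1 hinj)
      have hσ : σ = Equiv.prodCongrLeft (fun _ : Fin 2 => ρ) := by
        ext1 ⟨k, a⟩
        rw [Equiv.prodCongrLeft_apply]
        fin_cases a
        · exact hL0 k
        · exact hL1 k
      have hsign : Equiv.Perm.sign σ = 1 := by
        rw [hσ, Equiv.Perm.sign_prodCongrLeft, Fin.prod_univ_two, Int.units_mul_self]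
      rw [hsign]
      simpa using Finset.prod_nonneg fun k _ => hηn _ _
  · simpa using Finset.prod_pos fun k _ => hη1 k

variable {B : E →L[ℝ] E →L[ℝ] ℝ}

lemma det_restrictScalars_real (Q : E →ₗ[ℂ] E) :
    LinearMap.det (Q.restrictScalars ℝ) = ‖LinearMap.det Q‖ ^ 2 := by
  rw [LinearMap.det_restrictScalars, Algebra.norm_complex_apply, Complex.normSq_eq_norm_sq]

/-- The determinant of the Gram matrix of a pulled back inner product. -/
lemma det_gram_pullback {B B' : E →L[ℝ] E →L[ℝ] ℝ} (L : E →ₗ[ℝ] E)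
    (hL : ∀ v w, B' v w = B (L v) (L w)) :
    (gram B').det = LinearMap.det L ^ 2 * (gram B).det := by
  have h : gram B' = (LinearMap.toMatrix (realBasis E) (realBasis E) L).transpose *
      (gram B * LinearMap.toMatrix (realBasis E) (realBasis E) L) := by
    ext i j
    rw [gram_apply, hL, inner_eq_sum]
    simp [Matrix.mul_apply, LinearMap.toMatrix_apply, Finset.mul_sum, mul_assoc]
  rw [h, Matrix.det_mul, Matrix.det_mul, Matrix.det_transpose, LinearMap.det_toMatrix]
  ring

/-- The volume of the Kähler form: `ωⁿ` is a universal multiple of the volume form. -/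
lemma wedgePow_kahler (hB : IsHermitianInner B) (β : E [⋀^Fin 2]→ₗ[ℝ] ℝ)
    (hβ : ∀ v, β v = B (Complex.I • v 0) (v 1)) :
    wedgePow β (finrank ℂ E) (realBasis E) = √(gram B).det *
      MultilinearMap.alternatization (halfKahlerPow (LinearMap.id : E →ₗ[ℝ] E) (finrank ℂ E))
        (realBasis E) := by
  obtain ⟨Q, hQ⟩ := hB.exists_standard
  set Q' : E →ₗ[ℝ] E := (Q : E →ₗ[ℂ] E).restrictScalars ℝ with hQ'
  have hβ' : β = MultilinearMap.alternatization (halfKahler Q') := by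
    ext v
    rw [hβ, hQ, ← (realIndex E).sum_comp, Fintype.sum_prod_type,
      MultilinearMap.alternatization_apply]
    have : (Finset.univ : Finset (Equiv.Perm (Fin 2))) = {1, Equiv.swap 0 1} := by decide
    rw [this, Finset.sum_pair (by decide), Equiv.Perm.sign_swap (by decide), Equiv.Perm.sign_one]
    simp only [MultilinearMap.domDomCongr_apply, halfKahler_apply, one_smul, Units.neg_smul,
      Equiv.Perm.coe_one, id_eq, Equiv.swap_apply_left, Equiv.swap_apply_right, ← sub_eq_add_neg,
      ← Finset.sum_sub_distrib]
    refine Finset.sum_congr rfl fun k _ => ?_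
    simp [Fin.sum_univ_two, realBasis_repr_realIndex, reCoord, imCoord, hQ']
    ring
  have hcomp : ∀ v, halfKahlerPow Q' (finrank ℂ E) v =
      halfKahlerPow LinearMap.id (finrank ℂ E) (Q' ∘ v) := fun v => by
    simp [halfKahlerPow_apply]
  have hdet : √(gram B).det = LinearMap.det Q' := by
    have h1 : gram B = (LinearMap.toMatrix (realBasis E) (realBasis E) Q').transpose *
        LinearMap.toMatrix (realBasis E) (realBasis E) Q' := by
      ext i j
      rw [gram_apply, hQ]
      simp [Matrix.mul_apply, LinearMap.toMatrix_apply, hQ']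
    rw [h1, Matrix.det_mul, Matrix.det_transpose, LinearMap.det_toMatrix,
      Real.sqrt_mul_self_eq_abs, abs_of_nonneg]
    rw [hQ', det_restrictScalars_real]
    positivity
  rw [wedgePow_eq_alternatization Q' hβ', hdet]
  have h2 : MultilinearMap.alternatization (halfKahlerPow Q' (finrank ℂ E)) (realBasis E) =
      MultilinearMap.alternatization (halfKahlerPow LinearMap.id (finrank ℂ E))
        (Q' ∘ realBasis E) := by
    simp only [MultilinearMap.alternatization_apply, MultilinearMap.domDomCongr_apply, hcomp]
    rfl
  rw [h2, AlternatingMap.eq_smul_basis_det (realBasis E)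
    (MultilinearMap.alternatization (halfKahlerPow LinearMap.id (finrank ℂ E)))]
  simp only [AlternatingMap.smul_apply, Basis.det_comp, Basis.det_self, smul_eq_mul, mul_one]
  ring

end Constants

/-- The shuffle `0, …, n-1, n, …, 2n-1 ↦ 0, 2, …, 2n-2, 1, 3, …, 2n-1`. -/
def shuffle (n : ℕ) : Equiv.Perm (Fin (n + n)) :=
  finSumFinEquiv.symm.trans (((Equiv.boolProdEquivSum (Fin n)).symm.trans
    ((Equiv.prodComm _ _).trans (Equiv.prodCongr (Equiv.refl _) finTwoEquiv.symm))).trans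
    (finProdFinEquiv.trans (finCongr (mul_two n))))

lemma shuffle_castAdd {n : ℕ} (k : Fin n) : (shuffle n (Fin.castAdd n k) : ℕ) = 2 * k := by
  simp [shuffle, finProdFinEquiv, finTwoEquiv]

lemma shuffle_natAdd {n : ℕ} (k : Fin n) : (shuffle n (Fin.natAdd n k) : ℕ) = 2 * k + 1 := by
  simp [shuffle, finProdFinEquiv, finTwoEquiv, add_comm, -Fin.natAdd_eq_addNat]

/-- The number of inversions of the shuffle is `0 + 1 + ⋯ + (n - 1)`. This sign cancels the factor
`(-1) ^ (n (n - 1) / 2)` in the definition of `‖Ω‖`. -/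
lemma sign_shuffle (n : ℕ) :
    ((Equiv.Perm.sign (shuffle n) : ℤ)) = (-1) ^ (n * (n - 1) / 2) := by
  have h1 : ∀ a : Fin n, (∏ j ∈ Finset.Ioi (Fin.castAdd n a),
      if shuffle n (Fin.castAdd n a) < shuffle n j then (1 : ℤˣ) else -1) = (-1) ^ (a : ℕ) := by
    intro a
    rw [← Finset.filter_lt_eq_Ioi, Finset.prod_filter, Fin.prod_univ_add]
    have e1 : ∀ b : Fin n, (if Fin.castAdd n a < Fin.castAdd n b then
        if shuffle n (Fin.castAdd n a) < shuffle n (Fin.castAdd n b) then (1 : ℤˣ) else -1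
        else 1) = 1 := fun b => by
      simp only [Fin.lt_def, shuffle_castAdd, Fin.val_castAdd]
      split_ifs <;> first | rfl | omega
    have e2 : ∀ b : Fin n, (if Fin.castAdd n a < Fin.natAdd n b then
        if shuffle n (Fin.castAdd n a) < shuffle n (Fin.natAdd n b) then (1 : ℤˣ) else -1
        else 1) = if b < a then -1 else 1 := fun b => by
      simp only [Fin.lt_def, shuffle_castAdd, shuffle_natAdd, Fin.val_castAdd, Fin.val_natAdd]
      split_ifs <;> first | rfl | omega
    simp only [e1, e2, Finset.prod_const_one, one_mul]
    rw [← Finset.prod_filter, Finset.prod_const, Finset.filter_gt_eq_Iio, Fin.card_Iio]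
  have h2 : ∀ a : Fin n, (∏ j ∈ Finset.Ioi (Fin.natAdd n a),
      if shuffle n (Fin.natAdd n a) < shuffle n j then (1 : ℤˣ) else -1) = 1 := by
    intro a
    refine Finset.prod_eq_one fun j hj => ?_
    induction j using Fin.addCases with
    | left b =>
      have := Finset.mem_Ioi.1 hj
      simp only [Fin.lt_def, Fin.val_castAdd, Fin.val_natAdd] at this
      omega
    | right b =>
      have := Finset.mem_Ioi.1 hj
      simp only [Fin.lt_def, Fin.val_natAdd] at this
      rw [if_pos]
      simp only [Fin.lt_def, shuffle_natAdd]
      omega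
  rw [Equiv.Perm.sign_eq_prod_prod_Ioi, Fin.prod_univ_add]
  simp only [h1, h2, Finset.prod_const_one, mul_one]
  rw [Finset.prod_pow_eq_pow_sum, Fin.sum_univ_eq_sum_range (fun i => i), Finset.sum_range_id]
  simp

section Norm

variable {E : Type*} [NormedAddCommGroup E] [NormedSpace ℂ E] [FiniteDimensional ℂ E]

/-- The top form `Ω ∧ Ω̄` at the real basis, for `Ω = c dz₁ ∧ ⋯ ∧ dzₙ`: it is `|c|²` times the
determinant of the matrix of the `zₖ` and `z̄ₖ` at the basis. -/
lemma wedge_conj_realBasis : ∀ α : E [⋀^Fin (finrank ℂ E)]→L[ℂ] ℂ,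
    (-1) ^ (finrank ℂ E * (finrank ℂ E - 1) / 2) * Complex.I ^ finrank ℂ E *
      wedge (α.restrictScalars ℝ).toAlternatingMap
        (conjForm (α.restrictScalars ℝ).toAlternatingMap)
        (realBasis E ∘ Fin.cast (two_mul (finrank ℂ E)).symm) =
      ((2 ^ finrank ℂ E * ‖α (finBasis ℂ E)‖ ^ 2 : ℝ) : ℂ) := by
  set n := finrank ℂ E with hn
  intro α
  set c := α (finBasis ℂ E) with hc
  let z : Fin n → E →ₗ[ℝ] ℂ := fun k => ((finBasis ℂ E).coord k).restrictScalars ℝ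
  let a : MultilinearMap ℝ (fun _ : Fin n => E) ℂ :=
    c • (MultilinearMap.mkPiAlgebra ℝ (Fin n) ℂ).compLinearMap z
  let b : MultilinearMap ℝ (fun _ : Fin n => E) ℂ :=
    (starRingEnd ℂ c) • (MultilinearMap.mkPiAlgebra ℝ (Fin n) ℂ).compLinearMap
      (fun k => Complex.conjAe.toLinearMap ∘ₗ z k)
  have hα : ∀ v, α v = ∑ σ : Equiv.Perm (Fin n), Equiv.Perm.sign σ •
      (c * ∏ i, z i (v (σ i))) := fun v => by
    change α.toAlternatingMap v = _
    rw [AlternatingMap.eq_smul_basis_det (finBasis ℂ E) α.toAlternatingMap,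
      AlternatingMap.smul_apply,
      Basis.det_apply, ← Matrix.det_transpose, Matrix.det_apply, smul_eq_mul, Finset.mul_sum]
    refine Finset.sum_congr rfl fun σ _ => ?_
    rw [mul_smul_comm]
    rfl
  have ha : (α.restrictScalars ℝ).toAlternatingMap = MultilinearMap.alternatization a := by
    ext v
    rw [MultilinearMap.alternatization_apply]
    exact hα v
  have hb : conjForm (α.restrictScalars ℝ).toAlternatingMap = MultilinearMap.alternatization b := by
    ext v
    rw [MultilinearMap.alternatization_apply]
    change starRingEnd ℂ (α v) = _
    rw [hα, map_sum]
    refine Finset.sum_congr rfl fun σ _ => ?_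
    simp [b, Units.smul_def, map_prod]
  let e : Fin (n + n) → E := realBasis E ∘ Fin.cast (two_mul n).symm
  let M : Matrix (Fin (n + n)) (Fin (n + n)) ℂ := Matrix.of fun q i =>
    Fin.addCases (fun k => z k (e q)) (fun k => starRingEnd ℂ (z k (e q))) i
  have hM : wedge (α.restrictScalars ℝ).toAlternatingMap
        (conjForm (α.restrictScalars ℝ).toAlternatingMap) e =
      c * starRingEnd ℂ c * M.det := by
    rw [hb, ha, wedge_alternatization, Matrix.det_apply, Finset.mul_sum]
    refine Finset.sum_congr rfl fun σ _ => ?_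
    rw [mul_smul_comm, Fin.prod_univ_add]
    congr 1
    simp [a, b, M, -Fin.natAdd_eq_addNat]
    ring
  have hz0 : ∀ k j : Fin n, z k (e (shuffle n (Fin.castAdd n j))) = if j = k then 1 else 0 := by
    intro k j
    have : Fin.cast (two_mul n).symm (shuffle n (Fin.castAdd n j)) = realIndex E (j, 0) := by
      ext; simp [shuffle_castAdd, realIndex, finProdFinEquiv]
    simp only [e, Function.comp_apply, this, realBasis_realIndex]
    simp [z, Finsupp.single_apply]
  have hz1 : ∀ k j : Fin n,
      z k (e (shuffle n (Fin.natAdd n j))) = if j = k then Complex.I else 0 := by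
    intro k j
    have : Fin.cast (two_mul n).symm (shuffle n (Fin.natAdd n j)) = realIndex E (j, 1) := by
      ext; simp [shuffle_natAdd, realIndex, finProdFinEquiv, add_comm, -Fin.natAdd_eq_addNat]
    simp only [e, Function.comp_apply, this, realBasis_realIndex]
    simp [z, Finsupp.single_apply]
  -- after the shuffle of the basis, `M` has the blocks `1, 1, i, -i`
  have hdet : (-1) ^ (n * (n - 1) / 2) * M.det = (-2 * Complex.I) ^ n := by
    have h1 : (M.submatrix (shuffle n) id).det = (-1) ^ (n * (n - 1) / 2) * M.det := by
      rw [Matrix.det_permute, sign_shuffle]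
      simp
    rw [← h1, ← Matrix.det_submatrix_equiv_self finSumFinEquiv]
    have h2 : (M.submatrix (shuffle n) id).submatrix finSumFinEquiv finSumFinEquiv =
        Matrix.fromBlocks 1 1 (Complex.I • (1 : Matrix (Fin n) (Fin n) ℂ))
          ((-Complex.I) • (1 : Matrix (Fin n) (Fin n) ℂ)) := by
      ext i j
      rcases i with i | i <;> rcases j with j | j <;>
        simp [M, hz0, hz1, Matrix.one_apply, apply_ite, -Fin.natAdd_eq_addNat] <;> tauto
    rw [h2, Matrix.det_fromBlocks_one₁₁, mul_one, ← sub_smul, Matrix.det_smul, Matrix.det_one,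
      mul_one, Fintype.card_fin]
    congr 1
    ring
  change (-1) ^ (n * (n - 1) / 2) * Complex.I ^ n * wedge _ _ e = _
  rw [hM]
  have h3 : Complex.I ^ n * (-2 * Complex.I) ^ n = 2 ^ n := by
    rw [← mul_pow]
    congr 1
    linear_combination (-2 : ℂ) * Complex.I_mul_I
  calc (-1) ^ (n * (n - 1) / 2) * Complex.I ^ n * (c * starRingEnd ℂ c * M.det)
      = c * starRingEnd ℂ c * (Complex.I ^ n * ((-1) ^ (n * (n - 1) / 2) * M.det)) := by ring
    _ = _ := by
      rw [hdet, h3, Complex.mul_conj, Complex.normSq_eq_norm_sq]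
      push_cast
      ring

end Norm

section Hermitian

variable {E : Type*} [NormedAddCommGroup E] [NormedSpace ℂ E] [FiniteDimensional ℂ E]
  {X : Type*} [TopologicalSpace X] [ChartedSpace E X] [IsManifold 𝓘(ℂ, E) ω X]

lemma HermitianMetric.isHermitianInner (g : HermitianMetric E X) (x : X) :
    IsHermitianInner (g.at x) where
  symm := g.symm x
  pos := g.pos x
  inv := g.hermitian x

/-- The volume form as a complex multilinear form on `E`. -/
abbrev HolomorphicVolumeForm.at (Ω : HolomorphicVolumeForm E X) (x : X) :
    E [⋀^Fin (finrank ℂ E)]→L[ℂ] ℂ := Ω.toForm x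

/-- The constant in the comparison of `‖Ω‖²` with `|Ω(e₁, …, eₙ)|² / √det g`. -/
def normConst (E : Type*) [NormedAddCommGroup E] [NormedSpace ℂ E] [FiniteDimensional ℂ E] : ℝ :=
  2 ^ finrank ℂ E / (((finrank ℂ E).factorial : ℝ)⁻¹ *
    MultilinearMap.alternatization (halfKahlerPow (LinearMap.id : E →ₗ[ℝ] E) (finrank ℂ E))
      (realBasis E))

lemma normConst_pos : 0 < normConst E := by
  have := alternatization_halfKahlerPow_pos (E := E)
  unfold normConst
  positivity

/-- The norm of `Ω`, as a positive number: both top forms in its definition are evaluated on the real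
basis. -/
lemma HermitianMetric.normOmega_eq (g : HermitianMetric E X) (Ω : HolomorphicVolumeForm E X)
    (x : X) : g.normOmega Ω x =
      √(normConst E * (‖Ω.at x (finBasis ℂ E)‖ ^ 2 / √(gram (g.at x)).det)) := by
  have h := wedge_conj_realBasis (Ω.at x)
  have h' := wedgePow_kahler (g.isHermitianInner x)
    (show E [⋀^Fin 2]→L[ℝ] ℝ from g.kahlerForm x).toAlternatingMap (fun v => rfl)
  unfold HermitianMetric.normOmega
  dsimp only
  have h2 : ∀ w : ℂ, w = ((2 ^ finrank ℂ E * ‖Ω.at x (finBasis ℂ E)‖ ^ 2 : ℝ) : ℂ) → w.re =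
      2 ^ finrank ℂ E * ‖Ω.at x (finBasis ℂ E)‖ ^ 2 := fun w hw => by rw [hw, Complex.ofReal_re]
  rw [h', h2 _ h, normConst]
  congr 1
  field_simp

lemma HolomorphicVolumeForm.apply_finBasis_ne_zero (Ω : HolomorphicVolumeForm E X) (x : X) :
    Ω.at x (finBasis ℂ E) ≠ 0 := fun h => by
  refine Ω.ne_zero x ?_
  have h1 : (Ω.at x).toAlternatingMap = 0 := by
    rw [AlternatingMap.eq_smul_basis_det (finBasis ℂ E) (Ω.at x).toAlternatingMap]
    have : (Ω.at x).toAlternatingMap (finBasis ℂ E) = 0 := h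
    rw [this, zero_smul]
  exact ContinuousAlternatingMap.toAlternatingMap_injective h1

lemma HermitianMetric.log_normOmega (g : HermitianMetric E X) (Ω : HolomorphicVolumeForm E X)
    (x : X) : Real.log (g.normOmega Ω x) = Real.log (normConst E) / 2 +
      Real.log ‖Ω.at x (finBasis ℂ E)‖ - Real.log (gram (g.at x)).det / 4 := by
  have h1 := normConst_pos (E := E)
  have h2 := norm_pos_iff.2 (Ω.apply_finBasis_ne_zero x)
  have h3 := (g.isHermitianInner x).det_gram_pos
  have h4 := Real.sqrt_pos.2 h3
  rw [g.normOmega_eq, Real.log_sqrt (by positivity), Real.log_mul h1.ne' (by positivity),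
    Real.log_div (by positivity) h4.ne', Real.log_sqrt h3.le, Real.log_pow]
  push_cast
  ring

end Hermitian

/-! ### Changes of charts -/

section Charts

variable {E : Type*} [NormedAddCommGroup E] [NormedSpace ℂ E]
  {X : Type*} [TopologicalSpace X] [ChartedSpace E X]

/-- The preferred chart at `x`, as a partial equivalence with values in `E`. -/
abbrev chart (E : Type*) [NormedAddCommGroup E] [NormedSpace ℂ E] {X : Type*}
    [TopologicalSpace X] [ChartedSpace E X] (x : X) : PartialEquiv X E := extChartAt 𝓘(ℝ, E) x

/-- The change of charts from the preferred chart at `x` to the preferred chart at `x'`. -/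
def transition (x x' : X) : E → E := chart E x' ∘ (chart E x).symm

/-- The domain of definition of `transition x x'`. -/
def overlap (x x' : X) : Set E := (chart E x).target ∩ (chart E x).symm ⁻¹' (chart E x').source

lemma isOpen_overlap (x x' : X) : IsOpen (overlap x x' : Set E) :=
  (continuousOn_extChartAt_symm x).isOpen_inter_preimage (isOpen_extChartAt_target x)
    (isOpen_extChartAt_source x')

lemma chart_mem_overlap {x x' z : X} (h : z ∈ (chart E x).source) (h' : z ∈ (chart E x').source) :
    chart E x z ∈ overlap x x' :=
  ⟨(chart E x).map_source h, by rwa [mem_preimage, (chart E x).left_inv h]⟩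

lemma transition_chart {x x' z : X} (h : z ∈ (chart E x).source) :
    transition x x' (chart E x z) = chart E x' z := by
  rw [transition, Function.comp_apply, (chart E x).left_inv h]

lemma transition_mem_target {x x' : X} {y : E} (hy : y ∈ overlap x x') :
    transition x x' y ∈ (chart E x').target := (chart E x').map_source hy.2

lemma symm_transition {x x' : X} {y : E} (hy : y ∈ overlap x x') :
    (chart E x').symm (transition x x' y) = (chart E x).symm y := (chart E x').left_inv hy.2

lemma transition_mem_overlap {x x' : X} {y : E} (hy : y ∈ overlap x x') :
    transition x x' y ∈ overlap x' x :=
  chart_mem_overlap hy.2 ((chart E x).map_target hy.1)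

lemma transition_transition {x x' : X} {y : E} (hy : y ∈ overlap x x') :
    transition x' x (transition x x' y) = y := by
  rw [transition, Function.comp_apply, symm_transition hy, (chart E x).right_inv hy.1]

variable [IsManifold 𝓘(ℂ, E) ω X]

lemma contDiffOn_transition (x x' : X) :
    ContDiffOn ℂ ω (transition (E := E) x x') (overlap x x') := by
  have h := contDiffOn_ext_coord_change (I := 𝓘(ℂ, E)) (n := ω) x' x
  exact h

lemma contDiffAt_transition {x x' : X} {y : E} (hy : y ∈ overlap x x') :
    ContDiffAt ℂ ω (transition x x') y :=
  (contDiffOn_transition x x').contDiffAt ((isOpen_overlap x x').mem_nhds hy)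

/-- The derivative of a change of charts. -/
def jac (x x' : X) (y : E) : E →L[ℂ] E := fderiv ℂ (transition x x') y

lemma hasFDerivAt_transition {x x' : X} {y : E} (hy : y ∈ overlap x x') :
    HasFDerivAt (transition x x') (jac x x' y) y :=
  ((contDiffAt_transition hy).differentiableAt (by simp)).hasFDerivAt

lemma hasFDerivAt_transition_real {x x' : X} {y : E} (hy : y ∈ overlap x x') :
    HasFDerivAt (𝕜 := ℝ) (transition x x') ((jac x x' y).restrictScalars ℝ) y :=
  (hasFDerivAt_transition hy).restrictScalars ℝ

/-- The chain rule for changes of charts. -/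
lemma jac_comp_jac {x x' x'' : X} {y : E} (hy : y ∈ overlap x x') (hy' : y ∈ overlap x x'') (v : E) :
    jac x' x'' (transition x x' y) (jac x x' y v) = jac x x'' y v := by
  have hm : transition x x' y ∈ overlap x' x'' :=
    ⟨transition_mem_target hy, by
      rw [mem_preimage, symm_transition hy]; exact hy'.2⟩
  have h1 := (hasFDerivAt_transition hm).comp y (hasFDerivAt_transition hy)
  have h2 : transition x' x'' ∘ transition x x' =ᶠ[𝓝 y] transition x x'' := by
    filter_upwards [(isOpen_overlap x x').mem_nhds hy] with z hz
    simp only [Function.comp_apply, transition]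
    rw [(chart E x').left_inv hz.2]
  have h3 := (h1.congr_of_eventuallyEq h2.symm).unique (hasFDerivAt_transition hy')
  exact congrArg (fun A : E →L[ℂ] E => A v) h3

lemma jac_self {x : X} {y : E} (hy : y ∈ (chart E x).target) (v : E) : jac x x y v = v := by
  have h1 : transition x x =ᶠ[𝓝 y] id := by
    filter_upwards [(isOpen_extChartAt_target x).mem_nhds hy] with z hz
    exact (chart E x).right_inv hz
  rw [jac, h1.fderiv_eq, fderiv_id]
  rfl

lemma jac_jac {x x' : X} {y : E} (hy : y ∈ overlap x x') (v : E) :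
    jac x' x (transition x x' y) (jac x x' y v) = v := by
  rw [jac_comp_jac hy ⟨hy.1, (chart E x).map_target hy.1⟩, jac_self hy.1]

/-- The second derivative of a change of charts. -/
def hess (x x' : X) (y : E) (u v : E) : E := fderiv ℂ (jac x x') y u v

lemma differentiableAt_jac {x x' : X} {y : E} (hy : y ∈ overlap x x') :
    DifferentiableAt ℂ (jac x x') y :=
  ((contDiffAt_transition hy).fderiv_right (m := 1) (by simp)).differentiableAt (by simp)

lemma hasFDerivAt_jac_apply {x x' : X} {y : E} (hy : y ∈ overlap x x') (v : E) :
    HasFDerivAt (𝕜 := ℝ) (fun z => jac x x' z v)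
      (((fderiv ℂ (jac x x') y).flip v).restrictScalars ℝ) y := by
  have h := ((differentiableAt_jac hy).hasFDerivAt.clm_apply (hasFDerivAt_const v y)).restrictScalars ℝ
  convert h using 1
  ext u
  simp

lemma hess_symm {x x' : X} {y : E} (hy : y ∈ overlap x x') (u v : E) :
    hess x x' y u v = hess x x' y v u :=
  ((contDiffAt_transition hy).isSymmSndFDerivAt (by simp)).eq u v

/-- The isomorphism from `E` to the tangent space at `z` given by the preferred chart at `x`. -/
def frame (x z : X) : E →L[ℝ] E := (trivializationAt E (TangentSpace 𝓘(ℝ, E)) x).symmL ℝ z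

lemma frame_eq_jac {x z : X} (hz : z ∈ (chart E x).source) (v : E) :
    frame x z v = jac x z (chart E x z) v := by
  have h := TangentBundle.symmL_trivializationAt_eq_core (I := 𝓘(ℝ, E)) (b₀ := x) (b := z)
    (by simpa using hz)
  have h2 := (hasFDerivAt_transition_real (chart_mem_overlap hz (mem_extChartAt_source z)))
  have h3 : frame (E := E) x z = fderivWithin ℝ (transition x z) (range 𝓘(ℝ, E)) (chart E x z) := h
  rw [h3, modelWithCornersSelf_coe, range_id, fderivWithin_univ, h2.fderiv]
  rfl

lemma frame_complex_eq_jac {x z : X} (hz : z ∈ (chart E x).source) (v : E) :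
    (trivializationAt E (TangentSpace 𝓘(ℂ, E)) x).symmL ℂ z v = jac x z (chart E x z) v := by
  have h := TangentBundle.symmL_trivializationAt_eq_core (I := 𝓘(ℂ, E)) (b₀ := x) (b := z)
    (by simpa using hz)
  have h3 : (trivializationAt E (TangentSpace 𝓘(ℂ, E)) x).symmL ℂ z =
    fderivWithin ℂ (transition x z) (range 𝓘(ℂ, E)) (chart E x z) := h
  rw [h3, modelWithCornersSelf_coe, range_id, fderivWithin_univ]
  rfl

lemma trivializationAt_snd {x z : X} (hz : z ∈ (chart E x).source)
    (v : E) : (trivializationAt E (TangentSpace 𝓘(ℝ, E)) x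
        (⟨z, v⟩ : TangentBundle 𝓘(ℝ, E) X)).2 = jac z x (chart E z z) v := by
  have h2 := (hasFDerivAt_transition_real (chart_mem_overlap (mem_extChartAt_source z) hz))
  have h3 : (trivializationAt E (TangentSpace 𝓘(ℝ, E)) x
        (⟨z, v⟩ : TangentBundle 𝓘(ℝ, E) X)).2 =
    fderivWithin ℝ (transition z x) (range 𝓘(ℝ, E)) (chart E z z) v := rfl
  rw [h3, modelWithCornersSelf_coe, range_id, fderivWithin_univ, h2.fderiv]
  rfl

end Charts

/-! ### The metric in the charts -/

section MetricCharts

variable {E : Type*} [NormedAddCommGroup E] [NormedSpace ℂ E]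
  {X : Type*} [TopologicalSpace X] [ChartedSpace E X] [IsManifold 𝓘(ℂ, E) ω X]

/-- The coefficients of the metric in the preferred chart at `x`, on the target of the chart. -/
def HermitianMetric.local (g : HermitianMetric E X) (x : X) (y : E) : E →L[ℝ] E →L[ℝ] ℝ :=
  g.coeff x ((chart E x).symm y)

lemma HermitianMetric.local_apply (g : HermitianMetric E X) {x : X} {y : E}
    (hy : y ∈ (chart E x).target) (v w : E) :
    g.local x y v w = g.at ((chart E x).symm y) (jac x ((chart E x).symm y) y v)
      (jac x ((chart E x).symm y) y w) := by
  have h := fun v => frame_eq_jac ((chart E x).map_target hy) v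
  rw [(chart E x).right_inv hy] at h
  rw [← h, ← h]
  rfl

lemma mem_overlap_self {x : X} {y : E} (hy : y ∈ (chart E x).target) :
    y ∈ overlap x ((chart E x).symm y) :=
  ⟨hy, mem_extChartAt_source _⟩

lemma HermitianMetric.local_transition (g : HermitianMetric E X) {x x' : X} {y : E}
    (hy : y ∈ overlap x x') (v w : E) :
    g.local x y v w = g.local x' (transition x x' y) (jac x x' y v) (jac x x' y w) := by
  rw [g.local_apply hy.1, g.local_apply (transition_mem_target hy), symm_transition hy,
    jac_comp_jac hy (mem_overlap_self hy.1), jac_comp_jac hy (mem_overlap_self hy.1)]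

lemma HermitianMetric.local_center (g : HermitianMetric E X) (x : X) :
    g.local x (chart E x x) = g.at x := by
  have h : (chart E x).symm (chart E x x) = x := (chart E x).left_inv (mem_extChartAt_source x)
  ext v w
  rw [g.local_apply (mem_extChartAt_target x), h, jac_self (mem_extChartAt_target x),
    jac_self (mem_extChartAt_target x)]

lemma HermitianMetric.contMDiffOn_coeff (g : HermitianMetric E X) (x : X) (v w : E) :
    ContMDiffOn 𝓘(ℝ, E) 𝓘(ℝ, ℝ) ∞ (fun z => g.coeff x z v w) (chart E x).source := by
  let σ : E → ∀ z : X, TangentSpace 𝓘(ℝ, E) z := fun v z =>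
    (trivializationAt E (TangentSpace 𝓘(ℝ, E)) x).symmL ℝ z v
  have hs : ∀ v : E, ContMDiffOn 𝓘(ℝ, E) (𝓘(ℝ, E).prod 𝓘(ℝ, E)) ∞
      (fun z : X => (⟨z, σ v z⟩ : TangentBundle 𝓘(ℝ, E) X)) (chart E x).source := by
    intro v z hz
    refine ContMDiffAt.contMDiffWithinAt ?_
    have h1 := ((trivializationAt E (TangentSpace 𝓘(ℝ, E)) x).contMDiffAt_section_iff
      (IB := 𝓘(ℝ, E)) (n := ∞) (s := σ v) (x₀ := z) (by simpa using hz)).2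
    refine h1 ?_
    refine (contMDiffAt_const (c := v)).congr_of_eventuallyEq ?_
    filter_upwards [(isOpen_extChartAt_source x).mem_nhds hz] with z' hz'
    have h2 : σ v z' = (trivializationAt E (TangentSpace 𝓘(ℝ, E)) x).symm z' v :=
      Trivialization.symmL_apply _ (by simpa using hz') v
    rw [h2]
    exact congrArg Prod.snd ((trivializationAt E (TangentSpace 𝓘(ℝ, E)) x).apply_mk_symm
      (b := z') (by simpa using hz') v)
  intro z hz
  have : ContMDiffWithinAt 𝓘(ℝ, E) (𝓘(ℝ, E).prod 𝓘(ℝ)) ∞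
      (fun m ↦ TotalSpace.mk' ℝ (E := Bundle.Trivial X ℝ) m (g.inner m (σ v m) (σ w m))) (chart E x).source z := by
    apply ContMDiffWithinAt.clm_bundle_apply₂ (F₁ := E) (F₂ := E)
    · exact (g.contMDiff z).contMDiffWithinAt
    · exact hs v z hz
    · exact hs w z hz
  simp only [contMDiffWithinAt_totalSpace] at this
  exact this.2

lemma HermitianMetric.contDiffOn_local (g : HermitianMetric E X) (x : X) (v w : E) :
    ContDiffOn ℝ ∞ (fun y => g.local x y v w) (chart E x).target := by
  rw [← contMDiffOn_iff_contDiffOn]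
  exact (g.contMDiffOn_coeff x v w).comp (contMDiffOn_extChartAt_symm x)
    (fun y hy => (chart E x).map_target hy)

lemma HermitianMetric.contDiffAt_local (g : HermitianMetric E X) {x : X} {y : E}
    (hy : y ∈ (chart E x).target) (v w : E) : ContDiffAt ℝ ∞ (fun y => g.local x y v w) y :=
  (g.contDiffOn_local x v w).contDiffAt ((isOpen_extChartAt_target x).mem_nhds hy)

/-- The derivative of a change of charts, as an isomorphism. -/
def jacEquiv {x x' : X} {y : E} (hy : y ∈ overlap x x') : E ≃ₗ[ℂ] E :=
  LinearEquiv.ofLinearMap (jac x x' y : E →ₗ[ℂ] E) (jac x' x (transition x x' y) : E →ₗ[ℂ] E)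
    (by
      ext v
      have h := jac_jac (transition_mem_overlap hy) v
      rw [transition_transition hy] at h
      exact h)
    (by ext v; exact jac_jac hy v)

/-- The second derivative of a change of charts, as a bilinear map. -/
def hessBilin (x x' : X) (y : E) : E →ₗ[ℂ] E →ₗ[ℂ] E :=
  (ContinuousLinearMap.coeLM ℂ) ∘ₗ (fderiv ℂ (jac x x') y : E →ₗ[ℂ] E →L[ℂ] E)

lemma HermitianMetric.isHermitianInner_local (g : HermitianMetric E X) {x : X} {y : E}
    (hy : y ∈ (chart E x).target) : IsHermitianInner (g.local x y) where
  symm v w := by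
    rw [g.local_apply hy, g.local_apply hy]
    exact g.symm _ _ _
  pos v hv := by
    rw [g.local_apply hy]
    refine g.pos _ _ fun h => hv ?_
    have := jac_jac (mem_overlap_self hy) v
    rw [← this]
    have h0 : jac x ((chart E x).symm y) y v = 0 := h
    rw [h0, ContinuousLinearMap.map_zero]
  inv v w := by
    rw [g.local_apply hy, g.local_apply hy, ContinuousLinearMap.map_smul,
      ContinuousLinearMap.map_smul]
    exact g.hermitian _ _ _

lemma HermitianMetric.isHermitianAt_local (g : HermitianMetric E X) {x : X} {y : E}
    (hy : y ∈ (chart E x).target) : IsHermitianAt (g.local x) y where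
  diff v w := (g.contDiffAt_local hy v w).differentiableAt (by simp)
  eventually := by
    filter_upwards [(isOpen_extChartAt_target x).mem_nhds hy] with z hz
    exact g.isHermitianInner_local hz

variable [FiniteDimensional ℂ E]

lemma differentiableAt_of_clm_apply {V F : Type*} [NormedAddCommGroup V] [NormedSpace ℝ V]
    [NormedAddCommGroup F] [NormedSpace ℝ F] {A : V → E →L[ℝ] F} {y : V}
    (hA : ∀ v, DifferentiableAt ℝ (fun z => A z v) y) : DifferentiableAt ℝ A y := by
  have : FiniteDimensional ℝ E := FiniteDimensional.complexToReal E
  have h : A = fun z => ∑ i, ContinuousLinearMap.smulRightL ℝ E F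
      (LinearMap.toContinuousLinearMap ((realBasis E).coord i)) (A z (realBasis E i)) := by
    ext z v
    conv_lhs => rw [← (realBasis E).sum_repr v, map_sum]
    simp
  rw [h]
  exact DifferentiableAt.fun_sum fun i _ =>
    (ContinuousLinearMap.differentiableAt _).comp y (hA _)

/-- A field of bilinear forms with differentiable coefficients, applied to vector fields. -/
lemma hasFDerivAt_field_apply {V : Type*} [NormedAddCommGroup V] [NormedSpace ℝ V]
    {G : V → E →L[ℝ] E →L[ℝ] ℝ} {y : V}
    (hG : ∀ v w, DifferentiableAt ℝ (fun z => G z v w) y) {a b : V → E} {a' b' : V →L[ℝ] E}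
    (ha : HasFDerivAt a a' y) (hb : HasFDerivAt b b' y) (u : V) :
    DifferentiableAt ℝ (fun z => G z (a z) (b z)) y ∧
    fderiv ℝ (fun z => G z (a z) (b z)) y u = fderiv ℝ (fun z => G z (a y) (b y)) y u +
      G y (a' u) (b y) + G y (a y) (b' u) := by
  have : FiniteDimensional ℝ E := FiniteDimensional.complexToReal E
  have hG' : DifferentiableAt ℝ G y := by
    exact differentiableAt_of_clm_apply fun v => differentiableAt_of_clm_apply fun w => hG v w
  have h1 := (hG'.hasFDerivAt.clm_apply ha).clm_apply hb
  refine ⟨h1.differentiableAt, ?_⟩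
  have h2 := (hG'.hasFDerivAt.clm_apply (hasFDerivAt_const (a y) y)).clm_apply
    (hasFDerivAt_const (b y) y)
  rw [h1.fderiv, h2.fderiv]
  simp
  ring

/-- The product rule for the transformation law of the metric: its first jet in one chart is the
pullback of its first jet in the other, with the Hessian of the change of charts as second order
term. -/
lemma HermitianMetric.isPullbackJet (g : HermitianMetric E X) {x x' : X} {y : E}
    (hy : y ∈ overlap x x') :
    IsPullbackJet (g.local x' (transition x x' y)) (jet (g.local x') (transition x x' y))
      (jet (g.local x) y) (jacEquiv hy) (hessBilin x x' y) := by
  intro u v w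
  have hG := g.isHermitianAt_local (transition_mem_target hy)
  have h1 : (fun z => g.local x z v w) =ᶠ[𝓝 y] fun z =>
      g.local x' (transition x x' z) (jac x x' z v) (jac x x' z w) := by
    filter_upwards [(isOpen_overlap x x').mem_nhds hy] with z hz
    exact g.local_transition hz v w
  have ht := hasFDerivAt_transition_real hy
  have h3 : ∀ v w, HasFDerivAt (fun z => g.local x' (transition x x' z) v w)
      ((fderiv ℝ (fun z => g.local x' z v w) (transition x x' y)).comp
        ((jac x x' y).restrictScalars ℝ)) y :=
    fun v w => (hG.diff v w).hasFDerivAt.comp y ht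
  have h2 := (hasFDerivAt_field_apply (fun v w => (h3 v w).differentiableAt)
    (hasFDerivAt_jac_apply hy v) (hasFDerivAt_jac_apply hy w) u).2
  rw [jet, h1.fderiv_eq, h2, (h3 _ _).fderiv]
  rfl

/-- The Bismut symbols in the preferred chart at `x`. -/
def HermitianMetric.symbol (g : HermitianMetric E X) (x : X) (y u v : E) : E :=
  bismutSymbol (g.local x y) (jet (g.local x) y) u v

/-- The form `d*ω` in the preferred chart at `x`. -/
def HermitianMetric.localCodiff (g : HermitianMetric E X) (x : X) (y u : E) : ℝ :=
  kahlerCodiff (g.local x y) (jet (g.local x) y) u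

/-- The affine transformation law of the connection symbols. -/
lemma HermitianMetric.symbol_transition (g : HermitianMetric E X) {x x' : X} {y : E}
    (hy : y ∈ overlap x x') (u v : E) :
    jac x x' y (g.symbol x y u v) =
      g.symbol x' (transition x x' y) (jac x x' y u) (jac x x' y v) + hess x x' y u v :=
  bismutSymbol_pullback (g.isHermitianInner_local (transition_mem_target hy))
    (g.isHermitianInner_local hy.1)
    (g.isHermitianAt_local (transition_mem_target hy)).isHermitianJet
    (g.isHermitianAt_local hy.1).isHermitianJet (hess_symm hy) (g.local_transition hy)
    (g.isPullbackJet hy) u v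

lemma HermitianMetric.localCodiff_transition (g : HermitianMetric E X) {x x' : X} {y : E}
    (hy : y ∈ overlap x x') (u : E) :
    g.localCodiff x y u = g.localCodiff x' (transition x x' y) (jac x x' y u) :=
  kahlerCodiff_pullback (g.isHermitianInner_local (transition_mem_target hy))
    (g.isHermitianInner_local hy.1)
    (g.isHermitianAt_local (transition_mem_target hy)).isHermitianJet
    (hess_symm hy) (g.local_transition hy) (g.isPullbackJet hy) u

end MetricCharts

/-! ### The Bismut connection in the charts -/

section Bismut

variable {E : Type*} [NormedAddCommGroup E] [NormedSpace ℂ E] [FiniteDimensional ℂ E]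
  {X : Type*} [TopologicalSpace X] [ChartedSpace E X] [IsManifold 𝓘(ℂ, E) ω X]

lemma HermitianMetric.differentiableAt_local (g : HermitianMetric E X) {x : X} {y : E}
    (hy : y ∈ (chart E x).target) : DifferentiableAt ℝ (g.local x) y :=
  differentiableAt_of_clm_apply fun v => differentiableAt_of_clm_apply fun w =>
    (g.isHermitianAt_local hy).diff v w

/-- The derivative at `x` of the coefficients of the metric in the preferred chart at `x`. -/
def HermitianMetric.coeffDeriv (g : HermitianMetric E X) (x : X) : E →L[ℝ] E →L[ℝ] E →L[ℝ] ℝ :=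
  mvfderiv 𝓘(ℝ, E) (g.coeff x) x

/-- The manifold derivative of the metric coefficients at the centre of a chart is the derivative of
the local expression. -/
lemma HermitianMetric.coeffDeriv_apply (g : HermitianMetric E X) (x : X) (u v w : E) :
    g.coeffDeriv x u v w = jet (g.local x) (chart E x x) u v w := by
  have hd := g.differentiableAt_local (mem_extChartAt_target (I := 𝓘(ℝ, E)) x)
  have hm : MDifferentiableAt 𝓘(ℝ, E) 𝓘(ℝ, E →L[ℝ] E →L[ℝ] ℝ) (g.coeff x) x := by
    rw [mdifferentiableAt_iff]
    refine ⟨?_, ?_⟩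
    · have h1 : ContinuousAt (g.local x ∘ chart E x) x :=
        ContinuousAt.comp hd.continuousAt (continuousAt_extChartAt x)
      refine h1.congr ?_
      filter_upwards [extChartAt_source_mem_nhds (I := 𝓘(ℝ, E)) x] with z hz
      simp only [Function.comp_apply, HermitianMetric.local, (chart E x).left_inv hz]
    · exact hd.differentiableWithinAt
  have h1 : g.coeffDeriv x = fderiv ℝ (g.local x) (chart E x x) := by
    have h2 := hm.mfderiv
    rw [modelWithCornersSelf_coe, range_id, fderivWithin_univ] at h2
    unfold HermitianMetric.coeffDeriv mvfderiv
    rw [h2]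
    rfl
  have h3 := (hd.hasFDerivAt.clm_apply (hasFDerivAt_const v _)).clm_apply (hasFDerivAt_const w _)
  rw [h1, jet, h3.fderiv]
  simp

lemma HermitianMetric.inner_christoffel (g : HermitianMetric E X) (x : X) (u v w : E) :
    g.at x (g.christoffel x u v) w =
      (2 : ℝ)⁻¹ * (jet (g.local x) (chart E x x) u v w + jet (g.local x) (chart E x x) v u w -
        jet (g.local x) (chart E x x) w u v) := by
  rw [← g.coeffDeriv_apply, ← g.coeffDeriv_apply, ← g.coeffDeriv_apply]
  exact (g.isHermitianInner x).inner_sharp _ _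

/-- The Kähler form in the preferred chart at `x`. -/
lemma HermitianMetric.kahlerForm_inChart (g : HermitianMetric E X) {x : X} {y : E}
    (hy : y ∈ (chart E x).target) (v : Fin 2 → E) :
    g.kahlerForm.inChart x y v = g.local x y (Complex.I • v 0) (v 1) := by
  have h := fun v => frame_eq_jac ((chart E x).map_target hy) v
  rw [(chart E x).right_inv hy] at h
  rw [g.local_apply hy, ContinuousLinearMap.map_smul, ← h, ← h]
  rfl

lemma HermitianMetric.differentiableAt_kahlerForm_inChart (g : HermitianMetric E X) {x : X} {y : E}
    (hy : y ∈ (chart E x).target) :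
    DifferentiableAt ℝ (g.kahlerForm.inChart x) y := by
  have : FiniteDimensional ℝ E := FiniteDimensional.complexToReal E
  -- the form is a combination of constant forms with differentiable coefficients
  let c : Fin (2 * finrank ℂ E) → E →L[ℝ] ℝ := fun i =>
    LinearMap.toContinuousLinearMap ((realBasis E).coord i)
  let β : Fin (2 * finrank ℂ E) → Fin (2 * finrank ℂ E) → E [⋀^Fin 2]→L[ℝ] ℝ := fun i j =>
    ContinuousAlternatingMap.alternatizeUncurryFin
      ((c i).smulRight (ContinuousAlternatingMap.ofSubsingleton ℝ E ℝ (0 : Fin 1) (c j)))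
  have hβ : ∀ i j v, β i j v = (realBasis E).repr (v 0) i * (realBasis E).repr (v 1) j -
      (realBasis E).repr (v 1) i * (realBasis E).repr (v 0) j := fun i j v => by
    simp [β, c, ContinuousAlternatingMap.alternatizeUncurryFin_apply, Fin.sum_univ_two,
      Fin.removeNth, sub_eq_add_neg]
  have e : g.kahlerForm.inChart x =ᶠ[𝓝 y] fun z => ∑ i, ∑ j,
      ((2 : ℝ)⁻¹ * g.local x z (Complex.I • realBasis E i) (realBasis E j)) • β i j := by
    filter_upwards [(isOpen_extChartAt_target x).mem_nhds hy] with z hz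
    ext v
    have hexp : ∀ a b : E, g.local x z (Complex.I • a) b = ∑ i, ∑ j,
        g.local x z (Complex.I • realBasis E i) (realBasis E j) *
          ((realBasis E).repr a i * (realBasis E).repr b j) := by
      intro a b
      refine (inner_eq_sum ((g.local x z).comp (cplxJ E)) a b).trans ?_
      refine Finset.sum_congr rfl fun i _ => Finset.sum_congr rfl fun j _ => ?_
      rw [gram_apply, ContinuousLinearMap.comp_apply, cplxJ_apply]
      ring
    have hanti : g.local x z (Complex.I • v 1) (v 0) = -g.local x z (Complex.I • v 0) (v 1) := by
      rw [(g.isHermitianInner_local hz).smul_I_left, (g.isHermitianInner_local hz).symm]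
    rw [g.kahlerForm_inChart hz]
    simp only [ContinuousAlternatingMap.sum_apply, ContinuousAlternatingMap.smul_apply, hβ,
      smul_eq_mul]
    have h2 : g.local x z (Complex.I • v 0) (v 1) = (2 : ℝ)⁻¹ *
        (g.local x z (Complex.I • v 0) (v 1) - g.local x z (Complex.I • v 1) (v 0)) := by
      rw [hanti]; ring
    rw [h2, hexp, hexp, ← Finset.sum_sub_distrib, Finset.mul_sum]
    refine Finset.sum_congr rfl fun i _ => ?_
    rw [← Finset.sum_sub_distrib, Finset.mul_sum]
    refine Finset.sum_congr rfl fun j _ => by ring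
  refine DifferentiableAt.congr_of_eventuallyEq ?_ e
  exact DifferentiableAt.fun_sum fun i _ => DifferentiableAt.fun_sum fun j _ =>
    (((g.isHermitianAt_local hy).diff _ _).const_mul _).smul_const _

lemma HermitianMetric.d_kahlerForm (g : HermitianMetric E X) (x : X) (v : Fin 3 → E) :
    (show E [⋀^Fin 3]→L[ℝ] ℝ from g.kahlerForm.d x) v =
      jet (g.local x) (chart E x x) (v 0) (Complex.I • v 1) (v 2) -
      jet (g.local x) (chart E x x) (v 1) (Complex.I • v 0) (v 2) +
      jet (g.local x) (chart E x x) (v 2) (Complex.I • v 0) (v 1) := by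
  have hx := mem_extChartAt_target (I := 𝓘(ℝ, E)) x
  have h1 : ∀ v : E, (trivializationAt E (TangentSpace 𝓘(ℝ, E)) x).continuousLinearMapAt ℝ x v = v := by
    intro v
    have := trivializationAt_snd (mem_extChartAt_source (I := 𝓘(ℝ, E)) x) v
    rw [jac_self hx] at this
    exact (Trivialization.continuousLinearMapAt_apply_of_mem ℝ _
      (FiberBundle.mem_baseSet_trivializationAt' x) _).trans this
  have h2 : (show E [⋀^Fin 3]→L[ℝ] ℝ from g.kahlerForm.d x) v =
      extDeriv (g.kahlerForm.inChart x) (chart E x x) v := by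
    change extDeriv (g.kahlerForm.inChart x) (chart E x x) (fun i =>
      (trivializationAt E (TangentSpace 𝓘(ℝ, E)) x).continuousLinearMapAt ℝ x (v i)) = _
    congr 1
    ext i
    exact h1 _
  have h3 : ∀ w : Fin 2 → E, fderiv ℝ (fun y => g.kahlerForm.inChart x y w) (chart E x x) =
      fderiv ℝ (fun y => g.local x y (Complex.I • w 0) (w 1)) (chart E x x) := fun w => by
    refine Filter.EventuallyEq.fderiv_eq ?_
    filter_upwards [(isOpen_extChartAt_target x).mem_nhds hx] with z hz
    exact g.kahlerForm_inChart hz w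
  rw [h2, extDeriv_apply (g.differentiableAt_kahlerForm_inChart hx), Fin.sum_univ_three]
  simp only [h3]
  simp [jet, Fin.removeNth]
  rfl

/-- The form `d^c ω` at `x`. -/
lemma HermitianMetric.dc_kahlerForm (g : HermitianMetric E X) (x : X) (v : Fin 3 → E) :
    (show E [⋀^Fin 3]→L[ℝ] ℝ from Form.dc g.kahlerForm x) v =
      jet (g.local x) (chart E x x) (Complex.I • v 0) (v 1) (Complex.I • v 2) -
      jet (g.local x) (chart E x x) (Complex.I • v 1) (v 0) (Complex.I • v 2) +
      jet (g.local x) (chart E x x) (Complex.I • v 2) (v 0) (Complex.I • v 1) := by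
  have h1 : (fun x => (-1 : ℝ) ^ 2 • Form.actJ g.kahlerForm x) = g.kahlerForm := by
    ext x v
    have : ((-1 : ℝ) ^ 2 * ((-1 : ℝ) ^ 2 * g.at x (Complex.I • Complex.I • (show E from v 0))
      (Complex.I • (show E from v 1)))) = g.at x (Complex.I • (show E from v 0)) (show E from v 1) := by
      rw [(g.isHermitianInner x).inv]
      ring
    exact this
  have h2 : (show E [⋀^Fin 3]→L[ℝ] ℝ from Form.dc g.kahlerForm x) v =
      (-1 : ℝ) ^ 3 * (show E [⋀^Fin 3]→L[ℝ] ℝ from g.kahlerForm.d x)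
        (fun i => Complex.I • v i) := by
    rw [Form.dc, h1]
    rfl
  have hD := (g.isHermitianAt_local (mem_extChartAt_target (I := 𝓘(ℝ, E)) x)).isHermitianJet
  rw [h2, g.d_kahlerForm]
  simp only [I_smul_I_smul, hD.neg_mid]
  ring

lemma HermitianMetric.inner_torsionTerm (g : HermitianMetric E X) (x : X) (u v w : E) :
    g.at x (g.torsionTerm x u v) w =
      (show E [⋀^Fin 3]→L[ℝ] ℝ from Form.dc g.kahlerForm x) ![u, v, w] := by
  refine ((g.isHermitianInner x).inner_sharp _ _).trans ?_
  change (show E [⋀^Fin 3]→L[ℝ] ℝ from Form.dc g.kahlerForm x) (Fin.cons u (Fin.cons v fun _ => w)) = _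
  congr 1
  ext i
  fin_cases i <;> rfl

/-- The canonical extension of a tangent vector has constant coordinates near the base point. -/
lemma coordDeriv_extend (x : X) (w : E) :
    coordDeriv (FiberBundle.extend E (show TangentSpace 𝓘(ℝ, E) x from w)) x = 0 := by
  have h : coords (FiberBundle.extend E (show TangentSpace 𝓘(ℝ, E) x from w)) x =ᶠ[𝓝 x]
      fun _ => (trivializationAt E (TangentSpace 𝓘(ℝ, E)) x
        (⟨x, w⟩ : TangentBundle 𝓘(ℝ, E) X)).2 := by
    filter_upwards [(trivializationAt E (TangentSpace 𝓘(ℝ, E)) x).open_baseSet.mem_nhds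
      (FiberBundle.mem_baseSet_trivializationAt' x)] with z hz
    have h1 := (trivializationAt E (TangentSpace 𝓘(ℝ, E)) x).apply_mk_symm hz
      (trivializationAt E (TangentSpace 𝓘(ℝ, E)) x (⟨x, w⟩ : TangentBundle 𝓘(ℝ, E) X)).2
    have h2 := congrArg Prod.snd h1
    exact h2
  ext u
  simp only [coordDeriv, mvfderiv, h.mfderiv_eq, mfderiv_const]
  rfl

/-- The Bismut connection on the fields that are constant in the preferred chart at `x`. -/
lemma HermitianMetric.bismut_extend (g : HermitianMetric E X) (x : X) (u w : E) :
    (show E →L[ℝ] E from g.bismut (FiberBundle.extend E (show TangentSpace 𝓘(ℝ, E) x from w)) x) u =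
      g.symbol x (chart E x x) u w := by
  have h1 : (show E →L[ℝ] E from
      g.bismut (FiberBundle.extend E (show TangentSpace 𝓘(ℝ, E) x from w)) x) u =
      coordDeriv (FiberBundle.extend E (show TangentSpace 𝓘(ℝ, E) x from w)) x u +
      g.christoffel x u (FiberBundle.extend E (show TangentSpace 𝓘(ℝ, E) x from w) x) +
      (-(2 : ℝ)⁻¹) • g.torsionTerm x u
        (FiberBundle.extend E (show TangentSpace 𝓘(ℝ, E) x from w) x) := rfl
  rw [h1, FiberBundle.extend_apply_self, coordDeriv_extend]
  have hx := mem_extChartAt_target (I := 𝓘(ℝ, E)) x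
  have hG := g.isHermitianAt_local hx
  refine (g.isHermitianInner x).ext_left fun a => ?_
  have h2 : g.at x (g.symbol x (chart E x x) u w) a = bismutFirst (jet (g.local x) (chart E x x)) u w a := by
    rw [HermitianMetric.symbol, ← g.local_center]
    exact inner_bismutSymbol hG.self hG.isHermitianJet u w a
  rw [h2, inner_add, inner_smul, inner_add, g.inner_torsionTerm, g.dc_kahlerForm,
    g.inner_christoffel, bismutFirst]
  simp only [Matrix.cons_val_zero, Matrix.cons_val_one, Matrix.cons_val]
  have h0 : g.at x ((0 : E →L[ℝ] E) u) a = 0 := by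
    rw [zero_apply, ContinuousLinearMap.map_zero]; rfl
  rw [h0]
  ring

end Bismut

/-! ### The dilatino equation in the charts -/

section Dilatino

variable {E : Type*} [NormedAddCommGroup E] [NormedSpace ℂ E] [FiniteDimensional ℂ E]
  {X : Type*} [TopologicalSpace X] [ChartedSpace E X] [IsManifold 𝓘(ℂ, E) ω X]

lemma volForm_pullback {B B' : E →L[ℝ] E →L[ℝ] ℝ} (L : E →ₗ[ℂ] E)
    (hL : ∀ v w, B' v w = B (L v) (L w)) {m : ℕ} (h : 2 * finrank ℂ E = m) (v : Fin m → E) :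
    volForm B' h v = volForm B h (fun i => L (v i)) := by
  have h1 : (0 : ℝ) ≤ LinearMap.det (L.restrictScalars ℝ) := by
    rw [det_restrictScalars_real]; positivity
  have h2 := Basis.det_comp ((realBasis E).reindex (finCongr h)) (L.restrictScalars ℝ) v
  rw [volForm_apply, volForm_apply, det_gram_pullback (L.restrictScalars ℝ) hL,
    Real.sqrt_mul (sq_nonneg _), Real.sqrt_sq h1]
  have h3 : (fun i => L (v i)) = (L.restrictScalars ℝ) ∘ v := rfl
  rw [h3, h2]
  ring

lemma form_d_apply {k : ℕ} (α : Form ℝ E X ℝ k) (x : X) (v : Fin (k + 1) → E) :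
    (show E [⋀^Fin (k + 1)]→L[ℝ] ℝ from α.d x) v = extDeriv (α.inChart x) (chart E x x) v := by
  change extDeriv (α.inChart x) (chart E x x) (fun i =>
    (trivializationAt E (TangentSpace 𝓘(ℝ, E)) x).continuousLinearMapAt ℝ x (v i)) = _
  congr 1
  ext i
  have h := trivializationAt_snd (mem_extChartAt_source (I := 𝓘(ℝ, E)) x) (v i)
  rw [jac_self (mem_extChartAt_target x)] at h
  exact (Trivialization.continuousLinearMapAt_apply_of_mem ℝ _
    (FiberBundle.mem_baseSet_trivializationAt' x) _).trans h

lemma form_inChart_apply {k : ℕ} (α : Form ℝ E X ℝ k) {x : X} {y : E}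
    (hy : y ∈ (chart E x).target) (v : Fin k → E) :
    α.inChart x y v = (show E [⋀^Fin k]→L[ℝ] ℝ from α ((chart E x).symm y))
      (fun i => jac x ((chart E x).symm y) y (v i)) := by
  have h := fun v => frame_eq_jac ((chart E x).map_target hy) v
  rw [(chart E x).right_inv hy] at h
  simp only [← h]
  rfl

/-- The codifferential of the Kähler form. -/
lemma HermitianMetric.codiff_kahlerForm (hn : 2 ≤ finrank ℂ E) (g : HermitianMetric E X) (x : X)
    (u : Fin 1 → E) : (show E [⋀^Fin 1]→L[ℝ] ℝ from g.codiff (k := 1) g.kahlerForm x) u =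
      g.localCodiff x (chart E x x) (u 0) := by
  set l := 2 * finrank ℂ E - (1 + 1) with hl
  have h : 2 * finrank ℂ E = l + 2 := by omega
  have h' : 2 * finrank ℂ E = 1 + (l + 1) := by omega
  have hx := mem_extChartAt_target (I := 𝓘(ℝ, E)) x
  have hG := g.isHermitianAt_local hx
  have hstar : ∀ z (w : Fin l → E), (show E [⋀^Fin l]→L[ℝ] ℝ from g.star l g.kahlerForm z) w =
      (2 : ℝ)⁻¹ * mtrace (g.at z)
        (fun a b => volForm (g.at z) h (Fin.cons a (Fin.cons (Complex.I • b) w))) := fun z w =>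
    hodgeStar_two (g.isHermitianInner z) h (show E [⋀^Fin 2]→L[ℝ] ℝ from g.kahlerForm z)
      (fun b => Complex.I • b) (fun v => rfl) w
  have hF : ∀ᶠ z in 𝓝 (chart E x x), ∀ w : Fin l → E,
      (g.star l g.kahlerForm).inChart x z w = (2 : ℝ)⁻¹ * mtrace (g.local x z)
        (fun a b => volForm (g.local x z) h (Fin.cons a (Fin.cons (Complex.I • b) w))) := by
    filter_upwards [(isOpen_extChartAt_target x).mem_nhds hx] with z hz w
    rw [form_inChart_apply _ hz, hstar]
    have hpull := fun v w => g.local_apply hz v w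
    set p := (chart E x).symm z with hp
    set L := jacEquiv (mem_overlap_self hz) with hLdef
    set w' : Fin l → E := fun i => jac x p z (w i) with hw'
    have hbil : IsBilinearMap ℝ (fun a b =>
        volForm (g.at p) h (Fin.cons a (Fin.cons (Complex.I • b) w'))) :=
      ⟨fun a a' b => (firstArg (volForm (g.at p) h) _).map_add a a',
        fun c a b => (firstArg (volForm (g.at p) h) _).map_smul c a,
        fun a b b' => by
          simp only [smul_add]; exact (secondArg (volForm (g.at p) h) a w').map_add _ _,
        fun c a b => by
          simp only [smul_comm Complex.I c]
          exact (secondArg (volForm (g.at p) h) a w').map_smul _ _⟩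
    rw [← mtrace_pullback (g.isHermitianInner p) (g.isHermitianInner_local hz)
      (L.restrictScalars ℝ) hpull hbil]
    congr 2
    ext a b
    rw [volForm_pullback (L : E →ₗ[ℂ] E) hpull]
    congr 1
    ext i
    refine Fin.cases rfl (fun i => ?_) i
    refine Fin.cases ?_ (fun i => rfl) i
    exact (L.map_smul Complex.I b).symm
  have hd := extDeriv_star_kahler hG h hF
  rw [g.local_center] at hd
  have h1 := hodgeStar_codegree_one (g.isHermitianInner x) h' h
    (show E [⋀^Fin (l + 1)]→L[ℝ] ℝ from (g.star l g.kahlerForm).d x)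
    (sharpFun (g.at x) (kahlerCodiff (g.at x) (jet (g.local x) (chart E x x))))
    (fun v => by rw [form_d_apply, hd]) u
  have h2 : (show E [⋀^Fin 1]→L[ℝ] ℝ from g.codiff (k := 1) g.kahlerForm x) u =
    -hodgeStar (g.at x) 1 (show E [⋀^Fin (l + 1)]→L[ℝ] ℝ from (g.star l g.kahlerForm).d x) u := rfl
  rw [h2, h1, neg_neg, (g.isHermitianInner x).inner_sharpFun, HermitianMetric.localCodiff,
    g.local_center]
  exact ⟨kahlerCodiff_add hG.isHermitianJet, kahlerCodiff_smul hG.isHermitianJet⟩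

/-- The function `log ‖Ω‖` in the preferred chart at `x`. -/
def HermitianMetric.logNorm (g : HermitianMetric E X) (Ω : HolomorphicVolumeForm E X) (x : X)
    (y : E) : ℝ := Real.log (g.normOmega Ω ((chart E x).symm y))

/-- The coefficient of `Ω` in the preferred chart at `x`. -/
def HolomorphicVolumeForm.coeff (Ω : HolomorphicVolumeForm E X) (x : X) (y : E) : ℂ :=
  Ω.toForm.inChart x y (finBasis ℂ E)

lemma HolomorphicVolumeForm.inChart_apply (Ω : HolomorphicVolumeForm E X) {x : X} {y : E}
    (hy : y ∈ (chart E x).target) (v : Fin (finrank ℂ E) → E) :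
    Ω.toForm.inChart x y v = Ω.at ((chart E x).symm y)
      (fun i => jac x ((chart E x).symm y) y (v i)) := by
  have h := fun v => frame_complex_eq_jac ((chart E x).map_target hy) v
  rw [(chart E x).right_inv hy] at h
  simp only [← h]
  rfl

lemma apply_eq_det_mul (α : E [⋀^Fin (finrank ℂ E)]→L[ℂ] ℂ) (L : E →ₗ[ℂ] E)
    (v : Fin (finrank ℂ E) → E) : α (fun i => L (v i)) = LinearMap.det L * α v := by
  have h : ∀ w, α w = α (finBasis ℂ E) * (finBasis ℂ E).det w := fun w =>
    congrArg (fun β : E [⋀^Fin (finrank ℂ E)]→ₗ[ℂ] ℂ => β w)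
      (AlternatingMap.eq_smul_basis_det (finBasis ℂ E) α.toAlternatingMap)
  rw [h, h v]
  have h2 := Basis.det_comp (finBasis ℂ E) L v
  have h3 : (fun i => L (v i)) = L ∘ v := rfl
  rw [h3, h2]
  ring

lemma HolomorphicVolumeForm.coeff_eq (Ω : HolomorphicVolumeForm E X) {x : X} {y : E}
    (hy : y ∈ (chart E x).target) :
    Ω.coeff x y = LinearMap.det (jac x ((chart E x).symm y) y : E →ₗ[ℂ] E) *
      Ω.at ((chart E x).symm y) (finBasis ℂ E) := by
  rw [HolomorphicVolumeForm.coeff, Ω.inChart_apply hy]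
  exact apply_eq_det_mul _ (jac x ((chart E x).symm y) y : E →ₗ[ℂ] E) _

lemma det_jac_ne_zero {x x' : X} {y : E} (hy : y ∈ overlap x x') :
    LinearMap.det (jac x x' y : E →ₗ[ℂ] E) ≠ 0 :=
  (LinearEquiv.isUnit_det' (jacEquiv hy)).ne_zero

lemma HolomorphicVolumeForm.coeff_ne_zero (Ω : HolomorphicVolumeForm E X) {x : X} {y : E}
    (hy : y ∈ (chart E x).target) : Ω.coeff x y ≠ 0 := by
  rw [Ω.coeff_eq hy]
  exact mul_ne_zero (det_jac_ne_zero (mem_overlap_self hy)) (Ω.apply_finBasis_ne_zero _)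

lemma HolomorphicVolumeForm.differentiableOn_coeff (Ω : HolomorphicVolumeForm E X) (x : X) :
    DifferentiableOn ℂ (Ω.coeff x) (chart E x).target := by
  intro y hy
  have h : DifferentiableWithinAt ℂ (Ω.toForm.inChart x) (chart E x).target y := Ω.holomorphic x y hy
  exact (((ContinuousAlternatingMap.apply ℂ E ℂ (finBasis ℂ E)).differentiableAt).comp_differentiableWithinAt
    y h)

/-- The function `log ‖Ω‖` in holomorphic coordinates. The Jacobian determinants of the change to the
chart centred at the point, which enter through `Ω` and through `det g`, cancel. -/
lemma HermitianMetric.logNorm_eq (g : HermitianMetric E X) (Ω : HolomorphicVolumeForm E X) {x : X}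
    {y : E} (hy : y ∈ (chart E x).target) : g.logNorm Ω x y = Real.log (normConst E) / 2 +
      Real.log ‖Ω.coeff x y‖ - Real.log (gram (g.local x y)).det / 4 := by
  have hd := det_jac_ne_zero (mem_overlap_self hy)
  have h1 := Ω.apply_finBasis_ne_zero ((chart E x).symm y)
  have h2 := (g.isHermitianInner ((chart E x).symm y)).det_gram_pos
  rw [HermitianMetric.logNorm, g.log_normOmega, Ω.coeff_eq hy, norm_mul, Real.log_mul
    (norm_ne_zero_iff.2 hd) (norm_ne_zero_iff.2 h1),
    det_gram_pullback ((jac x ((chart E x).symm y) y : E →ₗ[ℂ] E).restrictScalars ℝ)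
      (fun v w => g.local_apply hy v w), det_restrictScalars_real,
    Real.log_mul (by positivity) h2.ne', ← pow_mul, Real.log_pow]
  push_cast
  ring

/-- The form `d*ω - d^c log ‖Ω‖` in the preferred chart at `x`. -/
def HermitianMetric.defect (g : HermitianMetric E X) (Ω : HolomorphicVolumeForm E X) (x : X)
    (y u : E) : ℝ :=
  g.localCodiff x y u + fderiv ℝ (g.logNorm Ω x) y (Complex.I • u)

lemma HolomorphicVolumeForm.differentiableAt_coeff (Ω : HolomorphicVolumeForm E X) {x : X} {y : E}
    (hy : y ∈ (chart E x).target) : DifferentiableAt ℂ (Ω.coeff x) y :=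
  (Ω.differentiableOn_coeff x).differentiableAt ((isOpen_extChartAt_target x).mem_nhds hy)

lemma HermitianMetric.logNorm_eventuallyEq (g : HermitianMetric E X)
    (Ω : HolomorphicVolumeForm E X) {x : X} {y : E} (hy : y ∈ (chart E x).target) :
    g.logNorm Ω x =ᶠ[𝓝 y] fun y => Real.log (normConst E) / 2 +
      Real.log ‖Ω.coeff x y‖ - Real.log (gram (g.local x y)).det / 4 := by
  filter_upwards [(isOpen_extChartAt_target x).mem_nhds hy] with z hz
  exact g.logNorm_eq Ω hz

/-- The derivative of `log ‖Ω‖`. -/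
lemma HermitianMetric.hasFDerivAt_logNorm (g : HermitianMetric E X)
    (Ω : HolomorphicVolumeForm E X) {x : X} {y : E} (hy : y ∈ (chart E x).target) :
    DifferentiableAt ℝ (g.logNorm Ω x) y ∧ ∀ u, fderiv ℝ (g.logNorm Ω x) y u =
      (fderiv ℂ (Ω.coeff x) y u / Ω.coeff x y).re -
        (4 : ℝ)⁻¹ * mtrace (g.local x y) (jet (g.local x) y u) := by
  have hG := g.isHermitianAt_local hy
  have hne := Ω.coeff_ne_zero hy
  have h1 := (Ω.differentiableAt_coeff hy).hasFDerivAt.restrictScalars ℝ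
  have h2 := (h1.norm_sq).log (by positivity : ‖Ω.coeff x y‖ ^ 2 ≠ 0)
  have h3 := (hG.hasFDerivAt_det_gram.1.hasFDerivAt).log hG.self.det_gram_pos.ne'
  have h4 := ((h2.const_mul (2 : ℝ)⁻¹).const_add (Real.log (normConst E) / 2)).sub
    (h3.const_mul (4 : ℝ)⁻¹)
  have h5 : g.logNorm Ω x =ᶠ[𝓝 y] fun z => (Real.log (normConst E) / 2 +
      (2 : ℝ)⁻¹ * Real.log (‖Ω.coeff x z‖ ^ 2)) - (4 : ℝ)⁻¹ * Real.log (gram (g.local x z)).det := by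
    filter_upwards [g.logNorm_eventuallyEq Ω hy] with z hz
    rw [hz, Real.log_pow]
    push_cast
    ring
  have h6 := h4.congr_of_eventuallyEq h5
  refine ⟨h6.differentiableAt, fun u => ?_⟩
  rw [h6.fderiv]
  have hdet := hG.self.det_gram_pos.ne'
  simp only [sub_apply, smul_apply, smul_eq_mul, hG.hasFDerivAt_det_gram.2]
  have h7 : (innerSL ℝ (Ω.coeff x y)) (fderiv ℂ (Ω.coeff x) y u) =
      ‖Ω.coeff x y‖ ^ 2 * (fderiv ℂ (Ω.coeff x) y u / Ω.coeff x y).re := by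
    rw [innerSL_apply_apply, Complex.inner, Complex.div_re, ← Complex.normSq_eq_norm_sq]
    have := (Complex.normSq_pos.2 hne).ne'
    simp
    field_simp
  have h8 : ∀ A : E →L[ℝ] ℂ, (innerSL ℝ (Ω.coeff x y) ∘L A) u = innerSL ℝ (Ω.coeff x y) (A u) :=
    fun _ => rfl
  rw [h8, ContinuousLinearMap.coe_restrictScalars', h7]
  have := (norm_pos_iff.2 hne).ne'
  field_simp
  ring

lemma HermitianMetric.logNorm_transition (g : HermitianMetric E X)
    (Ω : HolomorphicVolumeForm E X) {x x' : X} {y : E} (hy : y ∈ overlap x x') (u : E) :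
    fderiv ℝ (g.logNorm Ω x) y u =
      fderiv ℝ (g.logNorm Ω x') (transition x x' y) (jac x x' y u) := by
  have h1 : g.logNorm Ω x =ᶠ[𝓝 y] g.logNorm Ω x' ∘ transition x x' := by
    filter_upwards [(isOpen_overlap x x').mem_nhds hy] with z hz
    rw [Function.comp_apply, HermitianMetric.logNorm, HermitianMetric.logNorm, symm_transition hz]
  have h2 := (g.hasFDerivAt_logNorm Ω (transition_mem_target hy)).1.hasFDerivAt.comp y
    (hasFDerivAt_transition_real hy)
  rw [h1.fderiv_eq, h2.fderiv]
  rfl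

/-- The local expressions of `θ` define a global `1`-form. -/
lemma HermitianMetric.defect_transition (g : HermitianMetric E X)
    (Ω : HolomorphicVolumeForm E X) {x x' : X} {y : E} (hy : y ∈ overlap x x') (u : E) :
    g.defect Ω x y u = g.defect Ω x' (transition x x' y) (jac x x' y u) := by
  rw [HermitianMetric.defect, HermitianMetric.defect, g.localCodiff_transition hy,
    g.logNorm_transition Ω hy, ContinuousLinearMap.map_smul]

lemma HermitianMetric.dc_logNorm (g : HermitianMetric E X)
    (Ω : HolomorphicVolumeForm E X) (x : X) (u : Fin 1 → E) :
    (show E [⋀^Fin 1]→L[ℝ] ℝ from Form.dc (k := 0) (fun x : X =>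
      ContinuousAlternatingMap.constOfIsEmpty ℝ (TangentSpace 𝓘(ℝ, E) x) (Fin 0)
        (Real.log (g.normOmega Ω x))) x) u =
      -fderiv ℝ (g.logNorm Ω x) (chart E x x) (Complex.I • u 0) := by
  set f : Form ℝ E X ℝ 0 := fun x : X =>
      ContinuousAlternatingMap.constOfIsEmpty ℝ (TangentSpace 𝓘(ℝ, E) x) (Fin 0)
        (Real.log (g.normOmega Ω x)) with hf
  have hx := mem_extChartAt_target (I := 𝓘(ℝ, E)) x
  have h1 : (fun x => (-1 : ℝ) ^ 0 • Form.actJ f x) = f := by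
    ext x v
    have : (-1 : ℝ) ^ 0 * ((-1 : ℝ) ^ 0 * Real.log (g.normOmega Ω x)) =
      Real.log (g.normOmega Ω x) := by simp
    exact this
  have h2 : (show E [⋀^Fin 1]→L[ℝ] ℝ from Form.dc f x) u =
      (-1 : ℝ) ^ 1 * (show E [⋀^Fin 1]→L[ℝ] ℝ from f.d x) (fun i => Complex.I • u i) := by
    rw [Form.dc, h1]
    rfl
  have h3 : f.inChart x = fun y => (ContinuousAlternatingMap.constOfIsEmptyLIE ℝ E ℝ (Fin 0))
      (g.logNorm Ω x y) := by
    ext y v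
    rfl
  have hd := (g.hasFDerivAt_logNorm Ω hx).1
  rw [h2, form_d_apply, extDeriv_apply]
  · have h4 : ∀ w : Fin 0 → E, (fun y => f.inChart x y w) = g.logNorm Ω x := fun w => by
      ext y; rfl
    simp only [h4]
    simp
  · rw [h3]
    exact (LinearIsometryEquiv.differentiable _).differentiableAt.comp _ hd

/-- The dilatino equation says that the form `defect` vanishes in all the charts. -/
lemma HermitianMetric.isDilatinoSolution_iff (hn : 2 ≤ finrank ℂ E) (g : HermitianMetric E X)
    (Ω : HolomorphicVolumeForm E X) :
    g.IsDilatinoSolution Ω ↔ ∀ x, ∀ y ∈ (chart E x).target, ∀ u, g.defect Ω x y u = 0 := by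
  have h0 : ∀ x (u : E), (show E [⋀^Fin 1]→L[ℝ] ℝ from g.codiff (k := 1) g.kahlerForm x)
      (fun _ => u) - (show E [⋀^Fin 1]→L[ℝ] ℝ from Form.dc (k := 0) (fun x : X =>
      ContinuousAlternatingMap.constOfIsEmpty ℝ (TangentSpace 𝓘(ℝ, E) x) (Fin 0)
        (Real.log (g.normOmega Ω x))) x) (fun _ => u) = g.defect Ω x (chart E x x) u :=
    fun x u => by
      rw [g.codiff_kahlerForm hn, g.dc_logNorm, HermitianMetric.defect]
      ring
  constructor
  · intro h x y hy u
    have hs := mem_overlap_self hy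
    rw [g.defect_transition Ω hs]
    have h1 : transition x ((chart E x).symm y) y =
      chart E ((chart E x).symm y) ((chart E x).symm y) := rfl
    rw [h1, ← h0, h, sub_self]
  · intro h
    refine funext fun x => ContinuousAlternatingMap.ext fun v => ?_
    have hv : v = fun _ => v 0 := funext fun i => congrArg v (Subsingleton.elim _ _)
    have h1 := (h0 x (v 0)).trans (h x (chart E x x) (mem_extChartAt_target x) (v 0))
    rw [hv]
    exact sub_eq_zero.1 h1

/-- The complex trace of the Bismut symbols: the connection form of `∇ᴮ` on the canonical bundle,
in the frame `Ω / ‖Ω‖`, is `-i θ`, where `θ = d*ω - d^c log ‖Ω‖`. -/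
lemma HermitianMetric.trace_symbol (g : HermitianMetric E X)
    (Ω : HolomorphicVolumeForm E X) {x : X} {y : E} (hy : y ∈ (chart E x).target) (u : E) :
    fderiv ℂ (Ω.coeff x) y u / Ω.coeff x y -
      LinearMap.trace ℂ E (bismutEnd (g.isHermitianInner_local hy)
        (g.isHermitianAt_local hy).isHermitianJet u) =
      (fderiv ℝ (g.logNorm Ω x) y u : ℂ) - Complex.I * (g.defect Ω x y u : ℂ) := by
  have h := (g.hasFDerivAt_logNorm Ω hy).2
  rw [complex_trace_bismutEnd, HermitianMetric.defect, h, h, HermitianMetric.localCodiff,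
    ContinuousLinearMap.map_smul, smul_eq_mul, mul_div_assoc]
  generalize fderiv ℂ (Ω.coeff x) y u / Ω.coeff x y = q
  apply Complex.ext
  · simp
  · simp
    ring

end Dilatino

/-! ### Holomorphic functions are smooth -/

section Holomorphic

variable {E : Type*} [NormedAddCommGroup E] [NormedSpace ℂ E]

/-- Cauchy's formula for the directional derivative. -/
lemma fderiv_apply_eq_integral {f : E → ℂ} {U : Set E} (hU : IsOpen U)
    (hf : DifferentiableOn ℂ f U) {y u : E} {R : ℝ} (hR : 0 < R)
    (hy : ∀ ζ ∈ Metric.closedBall (0 : ℂ) R, y + ζ • u ∈ U) :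
    fderiv ℂ f y u = (2 * Real.pi * Complex.I : ℂ)⁻¹ * ∫ t in (0 : ℝ)..2 * Real.pi,
      deriv (circleMap 0 R) t * (circleMap 0 R t ^ 2)⁻¹ * f (y + circleMap 0 R t • u) := by
  let F : ℂ → ℂ := fun ζ => f (y + ζ • u)
  have hV : IsOpen ((fun ζ : ℂ => y + ζ • u) ⁻¹' U) := hU.preimage (by fun_prop)
  have hF : DifferentiableOn ℂ F ((fun ζ : ℂ => y + ζ • u) ⁻¹' U) :=
    hf.comp (g := f) (f := fun ζ : ℂ => y + ζ • u) (by fun_prop) (fun ζ hζ => hζ)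
  have h := Complex.two_pi_I_inv_smul_circleIntegral_sub_sq_inv_smul_of_differentiable hV
    (c := 0) (R := R) (w₀ := 0) hy hF (by simpa using hR)
  have hd : HasDerivAt F (fderiv ℂ f y u) 0 := by
    have h0 : y + (0 : ℂ) • u ∈ U := hy 0 (by simp [hR.le])
    have h1 := (hf.differentiableAt (hU.mem_nhds h0)).hasFDerivAt
    have h2 : HasDerivAt (fun ζ : ℂ => y + ζ • u) u 0 := by
      simpa using ((hasDerivAt_id (0 : ℂ)).smul_const u).const_add y
    have h3 := h1.comp_hasDerivAt (0 : ℂ) h2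
    rw [zero_smul, add_zero] at h3
    exact h3
  rw [hd.deriv] at h
  rw [← h, circleIntegral, smul_eq_mul]
  simp only [sub_zero, smul_eq_mul, F, mul_assoc]

variable [FiniteDimensional ℂ E]

/-- A directional derivative of a holomorphic function is holomorphic, by differentiation under the
integral sign in Cauchy's formula. -/
lemma differentiableOn_fderiv_apply {f : E → ℂ} {U : Set E} (hU : IsOpen U)
    (hf : DifferentiableOn ℂ f U) (u : E) : DifferentiableOn ℂ (fun y => fderiv ℂ f y u) U := by
  intro p hp
  refine DifferentiableAt.differentiableWithinAt ?_
  have hcont : ContinuousAt f p := (hf.differentiableAt (hU.mem_nhds hp)).continuousAt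
  obtain ⟨r, hr, hrU⟩ : ∃ r > 0, ∀ y ∈ Metric.ball p (3 * r), y ∈ U ∧ dist (f y) (f p) < 1 := by
    have h := (hU.eventually_mem hp).and (hcont.eventually (Metric.ball_mem_nhds (f p) one_pos))
    obtain ⟨ε, hε, h⟩ := Metric.eventually_nhds_iff_ball.1 h
    exact ⟨ε / 3, by positivity, fun y hy => h y (by convert hy using 2; ring)⟩
  -- Cauchy's estimate
  have hbound : ∀ y ∈ Metric.ball p (2 * r), ‖fderiv ℂ f y‖ ≤ 2 / r := by
    intro y hy
    have hsub : Metric.ball y r ⊆ Metric.ball p (3 * r) := Metric.ball_subset_ball' (by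
      rw [Metric.mem_ball] at hy; linarith)
    refine Complex.norm_fderiv_le_div_of_mapsTo_ball
      (hf.mono fun z hz => (hrU z (hsub hz)).1) (fun z hz => ?_) hr
    have h1 := (hrU z (hsub hz)).2
    have h2 := (hrU y (hsub (Metric.mem_ball_self hr))).2
    rw [Metric.mem_closedBall]
    calc dist (f z) (f y) ≤ dist (f z) (f p) + dist (f y) (f p) := dist_triangle_right _ _ _
      _ ≤ 2 := by linarith
  obtain ⟨R, hR, hRu⟩ : ∃ R > 0, R * ‖u‖ < r := by
    refine ⟨r / (‖u‖ + 1), by positivity, ?_⟩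
    rw [div_mul_eq_mul_div, div_lt_iff₀ (by positivity)]
    nlinarith [norm_nonneg u]
  have hball : ∀ y ∈ Metric.ball p r, ∀ ζ ∈ Metric.closedBall (0 : ℂ) R,
      y + ζ • u ∈ Metric.ball p (2 * r) := by
    intro y hy ζ hζ
    rw [mem_closedBall_zero_iff] at hζ
    rw [Metric.mem_ball, dist_eq_norm] at hy ⊢
    calc ‖y + ζ • u - p‖ = ‖(y - p) + ζ • u‖ := by congr 1; abel
      _ ≤ ‖y - p‖ + ‖ζ‖ * ‖u‖ := (norm_add_le _ _).trans (by rw [norm_smul])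
      _ < 2 * r := by nlinarith [mul_le_mul_of_nonneg_right hζ (norm_nonneg u)]
  have hballU : ∀ y ∈ Metric.ball p (2 * r), y ∈ U := fun y hy =>
    (hrU y (Metric.ball_subset_ball (by linarith) hy)).1
  have hmem : ∀ t, circleMap 0 R t ∈ Metric.closedBall (0 : ℂ) R := fun t =>
    circleMap_mem_closedBall 0 hR.le t
  let K : ℝ → ℂ := fun t => deriv (circleMap 0 R) t * (circleMap 0 R t ^ 2)⁻¹
  have hK : Continuous K := by
    refine Continuous.mul ?_ ((continuous_circleMap 0 R).pow 2 |>.inv₀ fun t =>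
      pow_ne_zero 2 (circleMap_ne_center hR.ne'))
    rw [show deriv (circleMap 0 R) = fun t => circleMap 0 R t * Complex.I from
      funext fun t => deriv_circleMap 0 R t]
    exact (continuous_circleMap 0 R).mul continuous_const
  have heq : (fun y => fderiv ℂ f y u) =ᶠ[𝓝 p] fun y => (2 * Real.pi * Complex.I : ℂ)⁻¹ *
      ∫ t in (0 : ℝ)..2 * Real.pi, K t * f (y + circleMap 0 R t • u) := by
    filter_upwards [Metric.ball_mem_nhds p hr] with y hy
    exact fderiv_apply_eq_integral hU hf hR fun ζ hζ => hballU _ (hball y hy ζ hζ)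
  refine DifferentiableAt.congr_of_eventuallyEq (DifferentiableAt.const_mul ?_ _) heq
  simp only [intervalIntegral.integral_of_le Real.two_pi_pos.le]
  have hcF : ∀ y ∈ Metric.ball p r, Continuous fun t => K t * f (y + circleMap 0 R t • u) := by
    intro y hy
    refine hK.mul (hf.continuousOn.comp_continuous (f := fun t => y + circleMap 0 R t • u) ?_
      fun t => hballU _ (hball y hy _ (hmem t)))
    exact continuous_const.add ((continuous_circleMap 0 R).smul continuous_const)
  let _ : MeasurableSpace E := borel E
  have : BorelSpace E := ⟨rfl⟩
  have : ProperSpace (E →L[ℂ] ℂ) := FiniteDimensional.proper ℂ _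
  have : ProperSpace E := FiniteDimensional.proper ℂ _
  refine HasFDerivAt.differentiableAt (hasFDerivAt_integral_of_dominated_of_fderiv_le
    (F' := fun y t => K t • fderiv ℂ f (y + circleMap 0 R t • u))
    (bound := fun t => ‖K t‖ * (2 / r))
    (Metric.ball_mem_nhds p hr) ?_ ?_ ?_ ?_ ?_ ?_)
  · filter_upwards [Metric.ball_mem_nhds p hr] with y hy
    exact (hcF y hy).aestronglyMeasurable
  · exact ((hcF p (Metric.mem_ball_self hr)).intervalIntegrable 0 (2 * Real.pi)).1
  · refine hK.aestronglyMeasurable.smul ?_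
    have h : Continuous fun t => p + circleMap 0 R t • u :=
      continuous_const.add ((continuous_circleMap 0 R).smul continuous_const)
    exact ((measurable_fderiv ℂ f).comp h.measurable).aestronglyMeasurable
  · refine Filter.Eventually.of_forall fun t y hy => ?_
    rw [norm_smul]
    exact mul_le_mul_of_nonneg_left (hbound _ (hball y hy _ (hmem t))) (norm_nonneg _)
  · exact (((hK.norm.mul continuous_const).intervalIntegrable 0 (2 * Real.pi))).1
  · refine Filter.Eventually.of_forall fun t y hy => ?_
    have h := (hf.differentiableAt (hU.mem_nhds (hballU _ (hball y hy _ (hmem t))))).hasFDerivAt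
    exact (HasFDerivAt.comp (g := f) y h ((hasFDerivAt_id y).add_const _)).const_mul (K t)

lemma contDiffOn_of_differentiableOn_complex {f : E → ℂ} {U : Set E} (hU : IsOpen U)
    (hf : DifferentiableOn ℂ f U) : ContDiffOn ℂ ∞ f U := by
  rw [contDiffOn_infty]
  intro n
  induction n generalizing f with
  | zero => exact contDiffOn_zero.2 hf.continuousOn
  | succ n ih =>
    rw [Nat.cast_succ]
    refine (contDiffOn_succ_iff_fderiv_of_isOpen hU).2
      ⟨hf, fun h => absurd h (WithTop.coe_ne_top), ?_⟩
    exact contDiffOn_clm_apply.2 fun u => ih (differentiableOn_fderiv_apply hU hf u)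

end Holomorphic

/-! ### Parallel fields of the Bismut connection -/

section Parallel

variable {E : Type*} [NormedAddCommGroup E] [NormedSpace ℂ E] [FiniteDimensional ℂ E]
  {X : Type*} [TopologicalSpace X] [ChartedSpace E X] [IsManifold 𝓘(ℂ, E) ω X]

/-- The infinitesimal form of `α(L v₁, …, L vₙ) = det L · α(v₁, …, vₙ)`. -/
lemma sum_update_eq_trace_mul (α : E [⋀^Fin (finrank ℂ E)]→L[ℂ] ℂ) (A : E →ₗ[ℂ] E)
    (v : Fin (finrank ℂ E) → E) :
    ∑ j, α (Function.update v j (A (v j))) = LinearMap.trace ℂ E A * α v := by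
  let b := finBasis ℂ E
  have h1 : HasDerivAt (fun s : ℂ => α (fun i => v i + s • A (v i)))
      (∑ j, α (Function.update v j (A (v j)))) 0 := by
    have hc : HasDerivAt (fun s : ℂ => fun i => v i + s • A (v i)) (fun i => A (v i)) 0 :=
      hasDerivAt_pi.2 fun i => by
        simpa using ((hasDerivAt_id (0 : ℂ)).smul_const (A (v i))).const_add (v i)
    have h := (α.hasFDerivAt (fun i => v i + (0 : ℂ) • A (v i))).comp_hasDerivAt (0 : ℂ) hc
    refine h.congr_deriv ?_
    simp only [zero_smul, add_zero]
    exact ContinuousMultilinearMap.linearDeriv_apply _ _ _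
  let M := LinearMap.toMatrix b b A
  have h2 : HasDerivAt (fun s : ℂ => α (fun i => v i + s • A (v i)))
      (LinearMap.trace ℂ E A * α v) 0 := by
    have h3 : ∀ s : ℂ, α (fun i => v i + s • A (v i)) = (1 + M.trace * s + Polynomial.eval s
        (1 + (Polynomial.X : Polynomial ℂ) • M.map ⇑(Polynomial.C : ℂ →+* Polynomial ℂ)).det.divX.divX
          * s ^ 2) * α v := fun s => by
      rw [← Matrix.det_one_add_smul]
      have h4 := apply_eq_det_mul α (LinearMap.id + s • A) v
      rw [← LinearMap.det_toMatrix b, map_add, LinearMap.toMatrix_id, LinearEquiv.map_smul] at h4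
      exact h4
    simp only [h3]
    have h5 := ((((hasDerivAt_id (0 : ℂ)).const_mul M.trace).const_add 1).add
      (((1 + (Polynomial.X : Polynomial ℂ) • M.map
        ⇑(Polynomial.C : ℂ →+* Polynomial ℂ)).det.divX.divX.hasDerivAt (0 : ℂ)).mul
        ((hasDerivAt_id (0 : ℂ)).pow 2))).mul_const (α v)
    refine h5.congr_deriv ?_
    rw [LinearMap.trace_eq_matrix_trace ℂ b]
    simp [M]
  exact h1.unique h2

variable (g : HermitianMetric E X) {γ : ℝ → X}

/-- The velocity of a curve, in the preferred chart at the point. -/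
def velocity (γ : ℝ → X) (t : ℝ) : E :=
  mfderivWithin 𝓘(ℝ, ℝ) 𝓘(ℝ, E) γ (Icc 0 1) t (1 : ℝ)

lemma hasDerivWithinAt_chart (hγ : ContMDiffOn 𝓘(ℝ, ℝ) 𝓘(ℝ, E) ∞ γ (Icc 0 1)) {t : ℝ}
    (ht : t ∈ Icc (0 : ℝ) 1) :
    HasDerivWithinAt (fun s => chart E (γ t) (γ s)) (velocity γ t) (Icc 0 1) t := by
  have h := (hγ t ht).mdifferentiableWithinAt (by simp)
  have h1 := h.mfderivWithin
  have h2 : DifferentiableWithinAt ℝ (writtenInExtChartAt 𝓘(ℝ, ℝ) 𝓘(ℝ, E) t γ)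
      ((extChartAt 𝓘(ℝ, ℝ) t).symm ⁻¹' Icc 0 1 ∩ range 𝓘(ℝ, ℝ)) (extChartAt 𝓘(ℝ, ℝ) t t) :=
    h.2
  have h3 := h2.hasFDerivWithinAt.hasDerivWithinAt
  have h4 : velocity (E := E) γ t = fderivWithin ℝ (writtenInExtChartAt 𝓘(ℝ, ℝ) 𝓘(ℝ, E) t γ)
      ((extChartAt 𝓘(ℝ, ℝ) t).symm ⁻¹' Icc 0 1 ∩ range 𝓘(ℝ, ℝ)) (extChartAt 𝓘(ℝ, ℝ) t t) 1 := by
    unfold velocity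
    rw [h1]
    rfl
  rw [← h4] at h3
  refine (h3.mono (s := Icc 0 1) fun s hs => ⟨hs, by simp⟩).congr (fun s _ => rfl) rfl

lemma eventually_mem_source (hγ : ContMDiffOn 𝓘(ℝ, ℝ) 𝓘(ℝ, E) ∞ γ (Icc 0 1)) {t : ℝ}
    (ht : t ∈ Icc (0 : ℝ) 1) : ∀ᶠ s in 𝓝[Icc 0 1] t, γ s ∈ (chart E (γ t)).source :=
  (hγ.continuousOn t ht).eventually ((isOpen_extChartAt_source _).mem_nhds
    (mem_extChartAt_source _))

/-- The coordinates of a tangent vector at `z` in the preferred chart at `x`. -/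
def vecCoord (x z : X) (v : E) : E := jac z x (chart E z z) v

lemma vecCoord_self (x : X) (v : E) : vecCoord x x v = v := jac_self (mem_extChartAt_target x) v

lemma jac_vecCoord {x z : X} (hz : z ∈ (chart E x).source) (v : E) :
    jac x z (chart E x z) (vecCoord x z v) = v := by
  have h := jac_jac (chart_mem_overlap (mem_extChartAt_source (I := 𝓘(ℝ, E)) z) hz) v
  rwa [transition_chart (mem_extChartAt_source z)] at h

lemma HermitianMetric.local_vecCoord {x z : X} (hz : z ∈ (chart E x).source) (v w : E) :
    g.local x (chart E x z) (vecCoord x z v) (vecCoord x z w) = g.at z v w := by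
  rw [g.local_apply ((chart E x).map_source hz), (chart E x).left_inv hz, jac_vecCoord hz,
    jac_vecCoord hz]

lemma HolomorphicVolumeForm.inChart_vecCoord (Ω : HolomorphicVolumeForm E X) {x z : X}
    (hz : z ∈ (chart E x).source) (v : Fin (finrank ℂ E) → E) :
    Ω.toForm.inChart x (chart E x z) (fun i => vecCoord x z (v i)) = Ω.at z v := by
  rw [Ω.inChart_apply ((chart E x).map_source hz), (chart E x).left_inv hz]
  simp only [jac_vecCoord hz]

/-- The equation of the parallel fields, in terms of the Bismut symbols. -/
lemma HermitianMetric.isParallelAlong_iff (hγ : ContMDiffOn 𝓘(ℝ, ℝ) 𝓘(ℝ, E) ∞ γ (Icc 0 1))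
    (V : ℝ → E) : IsParallelAlong g.bismut γ (fun t => (V t : TangentSpace 𝓘(ℝ, E) (γ t))) ↔
      ∀ t ∈ Icc (0 : ℝ) 1, HasDerivWithinAt (fun s => vecCoord (γ t) (γ s) (V s))
        (-g.symbol (γ t) (chart E (γ t) (γ t)) (velocity γ t) (V t)) (Icc 0 1) t := by
  refine forall₂_congr fun t ht => ?_
  rw [← g.bismut_extend]
  refine Filter.EventuallyEq.hasDerivWithinAt_iff_of_mem ?_ ht
  filter_upwards [eventually_mem_source hγ ht] with s hs
  exact trivializationAt_snd hs _

lemma HermitianMetric.jet_eq {x : X} {y : E} (hy : y ∈ (chart E x).target) (u v w : E) :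
    fderiv ℝ (g.local x) y u v w = jet (g.local x) y u v w := by
  have h3 := ((g.differentiableAt_local hy).hasFDerivAt.clm_apply
    (hasFDerivAt_const v _)).clm_apply (hasFDerivAt_const w _)
  rw [jet, h3.fderiv]
  simp

/-- The product rule for a bilinear form along a curve. -/
lemma hasDerivWithinAt_bilin {F : Type*} [NormedAddCommGroup F] [NormedSpace ℝ F]
    {G : F → F →L[ℝ] F →L[ℝ] ℝ} {c a b : ℝ → F} {c' a' b' : F} {s : Set ℝ} {t : ℝ}
    (hG : DifferentiableAt ℝ G (c t)) (hc : HasDerivWithinAt c c' s t)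
    (ha : HasDerivWithinAt a a' s t) (hb : HasDerivWithinAt b b' s t) :
    HasDerivWithinAt (fun r => G (c r) (a r) (b r))
      (fderiv ℝ G (c t) c' (a t) (b t) + G (c t) a' (b t) + G (c t) (a t) b') s t := by
  have h1 : HasDerivWithinAt (fun r => G (c r)) (fderiv ℝ G (c t) c') s t :=
    HasFDerivAt.comp_hasDerivWithinAt (l := G) t hG.hasFDerivAt hc
  have h2 : HasDerivWithinAt (fun r => G (c r) (a r)) (fderiv ℝ G (c t) c' (a t) + G (c t) a') s t :=
    HasDerivWithinAt.clm_apply (c := fun r => G (c r)) h1 ha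
  exact HasDerivWithinAt.clm_apply (c := fun r => G (c r) (a r)) h2 hb

/-- The inner product of parallel fields is constant. -/
lemma HermitianMetric.hasDerivWithinAt_inner (hγ : ContMDiffOn 𝓘(ℝ, ℝ) 𝓘(ℝ, E) ∞ γ (Icc 0 1))
    {V W : ℝ → E} (hV : IsParallelAlong g.bismut γ V) (hW : IsParallelAlong g.bismut γ W) {t : ℝ}
    (ht : t ∈ Icc (0 : ℝ) 1) :
    HasDerivWithinAt (fun s => g.at (γ s) (V s) (W s)) 0 (Icc 0 1) t := by
  have hx := mem_extChartAt_target (I := 𝓘(ℝ, E)) (γ t)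
  have hG := g.isHermitianAt_local hx
  have h1 := (g.isParallelAlong_iff hγ V).1 hV t ht
  have h2 := (g.isParallelAlong_iff hγ W).1 hW t ht
  have h4 := hasDerivWithinAt_bilin (g.differentiableAt_local hx) (hasDerivWithinAt_chart hγ ht)
    h1 h2
  refine (h4.congr_of_eventuallyEq_of_mem ?_ ht).congr_deriv ?_
  · filter_upwards [eventually_mem_source hγ ht] with s hs
    exact (g.local_vecCoord hs _ _).symm
  · have h5 := bismutSymbol_metric hG.self hG.isHermitianJet (velocity γ t) (V t) (W t)
    have h6 : ∀ (B : E →L[ℝ] E →L[ℝ] ℝ) (p v w q : E), B p w + B v q + B (-p) w + B v (-q) = 0 :=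
      fun B p v w q => by
        rw [B.map_neg, (B v).map_neg]
        have h7 : (-B p) w = -B p w := rfl
        rw [h7]
        ring
    rw [vecCoord_self, vecCoord_self, g.jet_eq hx, ← h5]
    exact h6 _ _ _ _ _

/-- The complex structure is parallel. -/
lemma HermitianMetric.isParallelAlong_smul_I (hγ : ContMDiffOn 𝓘(ℝ, ℝ) 𝓘(ℝ, E) ∞ γ (Icc 0 1))
    {V : ℝ → E} (hV : IsParallelAlong g.bismut γ V) :
    IsParallelAlong g.bismut γ (fun t => Complex.I • V t) := by
  refine (g.isParallelAlong_iff hγ _).2 fun t ht => ?_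
  have hx := mem_extChartAt_target (I := 𝓘(ℝ, E)) (γ t)
  have hG := g.isHermitianAt_local hx
  have h1 := ((g.isParallelAlong_iff hγ V).1 hV t ht).const_smul Complex.I
  refine (h1.congr_of_eventuallyEq_of_mem ?_ ht).congr_deriv ?_
  · exact Filter.Eventually.of_forall fun s => ContinuousLinearMap.map_smul _ _ _
  · rw [smul_neg]
    exact congrArg Neg.neg (bismutSymbol_smul_I hG.self hG.isHermitianJet _ _).symm

/-- The values of `Ω / ‖Ω‖` on parallel fields: they are multiplied by `-i θ(γ')`. -/
lemma HermitianMetric.hasDerivWithinAt_volume (Ω : HolomorphicVolumeForm E X)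
    (hγ : ContMDiffOn 𝓘(ℝ, ℝ) 𝓘(ℝ, E) ∞ γ (Icc 0 1)) {V : Fin (finrank ℂ E) → ℝ → E}
    (hV : ∀ i, IsParallelAlong g.bismut γ (V i)) {t : ℝ} (ht : t ∈ Icc (0 : ℝ) 1) :
    HasDerivWithinAt
      (fun s => Ω.at (γ s) (fun i => V i s) * Complex.exp (-Real.log (g.normOmega Ω (γ s)) : ℝ))
      (-(Complex.I * g.defect Ω (γ t) (chart E (γ t) (γ t)) (velocity γ t)) *
        (Ω.at (γ t) (fun i => V i t) * Complex.exp (-Real.log (g.normOmega Ω (γ t)) : ℝ)))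
      (Icc 0 1) t := by
  set x := γ t with hxdef
  set c := chart E x x with hc
  set u : E := velocity γ t with hu
  have hx : c ∈ (chart E x).target := mem_extChartAt_target (I := 𝓘(ℝ, E)) x
  have hG := g.isHermitianAt_local hx
  have hcurve : HasDerivWithinAt (fun s => chart E x (γ s)) u (Icc 0 1) t :=
    hasDerivWithinAt_chart hγ ht
  set β : E [⋀^Fin (finrank ℂ E)]→L[ℂ] ℂ := Ω.at x with hβ
  have hne := Ω.coeff_ne_zero hx
  have hinv : (chart E x).symm c = x := (chart E x).left_inv (mem_extChartAt_source x)
  have hβc : Ω.coeff x c = β (finBasis ℂ E) := by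
    have h := Ω.inChart_vecCoord (mem_extChartAt_source x) (finBasis ℂ E)
    simp only [vecCoord_self] at h
    exact h
  -- all the forms `Ω` in the chart are multiples of the form at the centre
  have hmul : ∀ y v, Ω.toForm.inChart x y v = Ω.coeff x y * ((Ω.coeff x c)⁻¹ * β v) := by
    intro y v
    have h1 := congrArg (fun β : E [⋀^Fin (finrank ℂ E)]→ₗ[ℂ] ℂ => β v)
      (AlternatingMap.eq_smul_basis_det (finBasis ℂ E) β.toAlternatingMap)
    have h2 := congrArg (fun β : E [⋀^Fin (finrank ℂ E)]→ₗ[ℂ] ℂ => β v)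
      (AlternatingMap.eq_smul_basis_det (finBasis ℂ E)
        (show E [⋀^Fin (finrank ℂ E)]→L[ℂ] ℂ from Ω.toForm.inChart x y).toAlternatingMap)
    have h1' : β v = β (finBasis ℂ E) * (finBasis ℂ E).det v := h1
    have h2' : Ω.toForm.inChart x y v = Ω.coeff x y * (finBasis ℂ E).det v := h2
    rw [h2', h1', ← hβc]
    field_simp
  have hVx : ∀ i, HasDerivWithinAt (fun s => vecCoord x (γ s) (V i s))
      (-g.symbol x c u (V i t)) (Icc 0 1) t := fun i => (g.isParallelAlong_iff hγ (V i)).1 (hV i) t ht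
  have hβd : HasDerivWithinAt (fun s => β (fun i => vecCoord x (γ s) (V i s)))
      (-(LinearMap.trace ℂ E (bismutEnd (g.isHermitianInner_local hx) hG.isHermitianJet u) *
        β (fun i => V i t))) (Icc 0 1) t := by
    have h := ((β.hasFDerivAt (fun i => vecCoord x (γ t) (V i t))).restrictScalars
      ℝ).comp_hasDerivWithinAt t (hasDerivWithinAt_pi.2 hVx)
    refine h.congr_deriv ?_
    rw [← sum_update_eq_trace_mul, ← Finset.sum_neg_distrib]
    refine (ContinuousMultilinearMap.linearDeriv_apply _ _ _).trans ?_
    refine Finset.sum_congr rfl fun j _ => ?_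
    have h1 : (fun i => vecCoord x (γ t) (V i t)) = fun i => V i t :=
      funext fun i => vecCoord_self _ _
    rw [h1]
    exact β.map_update_neg _ _ _
  have hcd : HasDerivWithinAt (fun s => Ω.coeff x (chart E x (γ s)))
      (fderiv ℂ (Ω.coeff x) c u) (Icc 0 1) t :=
    HasFDerivAt.comp_hasDerivWithinAt (l := Ω.coeff x)
      (l' := (fderiv ℂ (Ω.coeff x) c).restrictScalars ℝ) t
      ((Ω.differentiableAt_coeff hx).hasFDerivAt.restrictScalars ℝ) hcurve
  have hld : HasDerivWithinAt (fun s => Complex.exp ((-g.logNorm Ω x (chart E x (γ s)) : ℝ) : ℂ))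
      (Complex.exp ((-g.logNorm Ω x c : ℝ) : ℂ) * ((-fderiv ℝ (g.logNorm Ω x) c u : ℝ) : ℂ))
      (Icc 0 1) t :=
    ((HasFDerivAt.comp_hasDerivWithinAt (l := g.logNorm Ω x) t
      (g.hasFDerivAt_logNorm Ω hx).1.hasFDerivAt hcurve).neg.ofReal_comp).cexp
  have h := (hcd.mul (hβd.const_mul (Ω.coeff x c)⁻¹)).mul hld
  refine (h.congr_of_eventuallyEq_of_mem ?_ ht).congr_deriv ?_
  · filter_upwards [eventually_mem_source hγ ht] with s hs
    have h2 : g.logNorm Ω x (chart E x (γ s)) = Real.log (g.normOmega Ω (γ s)) := by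
      rw [HermitianMetric.logNorm, (chart E x).left_inv hs]
    rw [← Ω.inChart_vecCoord hs, hmul, ← h2]
    rfl
  · have h2 : g.logNorm Ω x c = Real.log (g.normOmega Ω x) := by
      rw [HermitianMetric.logNorm, hinv]
    have h3 := g.trace_symbol Ω hx u
    have h4 : (fun i => vecCoord x (γ t) (V i t)) = fun i => V i t :=
      funext fun i => vecCoord_self _ _
    rw [sub_eq_iff_eq_add, div_eq_iff hne] at h3
    rw [← h2]
    simp only [Pi.mul_apply, ← hxdef, ← hc]
    rw [h3]
    simp only [vecCoord_self]
    push_cast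
    field_simp
    ring

end Parallel

/-! ### Parallel transport -/

section Transport

variable {E : Type*} [NormedAddCommGroup E] [NormedSpace ℂ E] [FiniteDimensional ℂ E]
  {X : Type*} [TopologicalSpace X] [ChartedSpace E X] [IsManifold 𝓘(ℂ, E) ω X]

lemma eq_of_hasDerivWithinAt_zero {F : Type*} [NormedAddCommGroup F] [NormedSpace ℝ F] {f : ℝ → F}
    (hf : ∀ t ∈ Icc (0 : ℝ) 1, HasDerivWithinAt f 0 (Icc 0 1) t) : f 1 = f 0 :=
  constant_of_derivWithin_zero (fun t ht => (hf t ht).differentiableWithinAt)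
    (fun t ht => (hf t (Ico_subset_Icc_self ht)).derivWithin
      (uniqueDiffOn_Icc_zero_one t (Ico_subset_Icc_self ht))) 1 (by simp)

variable (g : HermitianMetric E X)

lemma HermitianMetric.inner_parallel {γ : ℝ → X}
    (hγ : ContMDiffOn 𝓘(ℝ, ℝ) 𝓘(ℝ, E) ∞ γ (Icc 0 1)) {V W : ℝ → E}
    (hV : IsParallelAlong g.bismut γ V) (hW : IsParallelAlong g.bismut γ W) :
    g.at (γ 1) (V 1) (W 1) = g.at (γ 0) (V 0) (W 0) :=
  eq_of_hasDerivWithinAt_zero fun _ ht => g.hasDerivWithinAt_inner hγ hV hW ht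

/-- The parallel transport of the Bismut connection is isometric. -/
lemma HermitianMetric.inner_transport {x y : X} {P : E →L[ℝ] E}
    (hP : IsParallelTransport g.bismut x y P) (v w : E) : g.at y (P v) (P w) = g.at x v w := by
  induction hP generalizing v w with
  | segment γ hγ P hP =>
    obtain ⟨V, hV, hV0, hV1⟩ := hP v
    obtain ⟨W, hW, hW0, hW1⟩ := hP w
    have h := g.inner_parallel hγ hV hW
    rw [hV0, hV1, hW0, hW1] at h
    exact h
  | trans P Q _ _ ihP ihQ => exact (ihQ _ _).trans (ihP _ _)

/-- A parallel field is determined by its initial value: the difference of two has constant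
norm. -/
lemma HermitianMetric.parallel_unique {γ : ℝ → X}
    (hγ : ContMDiffOn 𝓘(ℝ, ℝ) 𝓘(ℝ, E) ∞ γ (Icc 0 1)) {V W : ℝ → E}
    (hV : IsParallelAlong g.bismut γ V) (hW : IsParallelAlong g.bismut γ W) (h0 : V 0 = W 0) :
    V 1 = W 1 := by
  by_contra hne
  have h1 := g.inner_parallel hγ hV hV
  have h2 := g.inner_parallel hγ hV hW
  have h3 := g.inner_parallel hγ hW hV
  have h4 := g.inner_parallel hγ hW hW
  have h5 := g.pos (γ 1) (V 1 - W 1) (sub_ne_zero.2 hne)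
  -- the polarised expansion of the squared norm of the difference
  have h6 : ∀ B : E →L[ℝ] E →L[ℝ] ℝ, ∀ v w : E,
      B (v - w) (v - w) = B v v - B v w - B w v + B w w := fun B v w => by
    simp only [map_sub, sub_apply]
    ring
  have h7 := h6 (g.at (γ 1)) (V 1) (W 1)
  rw [h0] at h1 h2 h3
  rw [h1, h2, h3, h4] at h7
  have h8 : g.at (γ 1) (V 1 - W 1) (V 1 - W 1) = 0 := h7.trans (by ring)
  exact h5.ne' h8

/-- The parallel transport of the Bismut connection is complex linear. -/
lemma HermitianMetric.transport_smul_I {x y : X} {P : E →L[ℝ] E}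
    (hP : IsParallelTransport g.bismut x y P) (v : E) :
    P (Complex.I • v) = Complex.I • P v := by
  induction hP generalizing v with
  | segment γ hγ P hP =>
    obtain ⟨V, hV, hV0, hV1⟩ := hP v
    obtain ⟨W, hW, hW0, hW1⟩ := hP (Complex.I • v : E)
    have h := g.parallel_unique hγ hW (g.isParallelAlong_smul_I hγ hV)
      (hW0.trans (congrArg (fun a : E => Complex.I • a) hV0.symm))
    exact hW1.symm.trans (h.trans (congrArg (fun a : E => Complex.I • a) hV1))
  | trans P Q _ _ ihP ihQ => exact (congrArg Q (ihP v)).trans (ihQ (P v))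

/-- A real endomorphism that commutes with `i` is complex linear. -/
def complexify (P : E →L[ℝ] E) (h : ∀ v, P (Complex.I • v) = Complex.I • P v) : E →L[ℂ] E where
  toFun := P
  map_add' := P.map_add
  map_smul' z v := by
    have hz : ∀ w : E, z • w = z.re • w + z.im • (Complex.I • w) := fun w => by
      conv_lhs => rw [← Complex.re_add_im z, add_smul, mul_smul]
      rfl
    simp only [RingHom.id_apply]
    rw [hz, hz, map_add, P.map_smul, P.map_smul, h]
  cont := P.continuous

/-- When `g` solves the dilatino equation, the form `Ω / ‖Ω‖` is parallel. -/
lemma HermitianMetric.volume_transport (Ω : HolomorphicVolumeForm E X)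
    (hd : ∀ x, ∀ y ∈ (chart E x).target, ∀ u, g.defect Ω x y u = 0) {x y : X} {P : E →L[ℝ] E}
    (hP : IsParallelTransport g.bismut x y P) (v : Fin (finrank ℂ E) → E) :
    Ω.at y (fun i => P (v i)) * Complex.exp (-Real.log (g.normOmega Ω y) : ℝ) =
      Ω.at x v * Complex.exp (-Real.log (g.normOmega Ω x) : ℝ) := by
  induction hP generalizing v with
  | segment γ hγ P hP =>
    choose V hV hV0 hV1 using fun i => hP (v i)
    have h := eq_of_hasDerivWithinAt_zero fun t ht =>
      (g.hasDerivWithinAt_volume Ω hγ hV ht).congr_deriv (by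
        rw [hd _ _ (mem_extChartAt_target _)]
        simp)
    simp only [hV0, hV1] at h
    exact h
  | trans P Q _ _ ihP ihQ => exact (ihQ _).trans (ihP v)

/-- A solution of the dilatino equation has special unitary holonomy: the transport along a loop is
isometric, complex linear, and fixes `Ω` at the base point, so that its determinant is `1`. -/
theorem HermitianMetric.bismutHolonomyInSU (hn : 2 ≤ finrank ℂ E) (Ω : HolomorphicVolumeForm E X)
    (h : g.IsDilatinoSolution Ω) : g.BismutHolonomyInSU := by
  have hd := (isDilatinoSolution_iff hn g Ω).1 h
  intro x P' hP
  let P : E →L[ℝ] E := P'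
  change IsParallelTransport g.bismut x x P at hP
  change P ∈ _
  refine ⟨complexify P (g.transport_smul_I hP), rfl, g.inner_transport hP, ?_⟩
  have h1 := g.volume_transport Ω hd hP (finBasis ℂ E)
  have h2 := apply_eq_det_mul (Ω.at x) (complexify P (g.transport_smul_I hP) : E →ₗ[ℂ] E)
    (finBasis ℂ E)
  have h3 := Ω.apply_finBasis_ne_zero x
  have h4 := mul_right_cancel₀ (Complex.exp_ne_zero _) h1
  exact mul_right_cancel₀ h3 ((h2.symm.trans h4).trans (one_mul _).symm)

end Transport

/-! ### Smoothness of the local expressions -/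

section Regularity

variable {E : Type*} [NormedAddCommGroup E] [NormedSpace ℂ E] [FiniteDimensional ℂ E]
  {X : Type*} [TopologicalSpace X] [ChartedSpace E X] [IsManifold 𝓘(ℂ, E) ω X]

lemma contDiffOn_det {V ι : Type*} [NormedAddCommGroup V] [NormedSpace ℝ V] [Fintype ι]
    [DecidableEq ι] {A : V → Matrix ι ι ℝ} {U : Set V}
    (hA : ∀ i j, ContDiffOn ℝ ∞ (fun y => A y i j) U) : ContDiffOn ℝ ∞ (fun y => (A y).det) U := by
  simp only [Matrix.det_apply']
  exact ContDiffOn.sum fun σ _ => contDiffOn_const.mul (contDiffOn_prod fun i _ => hA _ _)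

variable (g : HermitianMetric E X) (x : X)

lemma HermitianMetric.contDiffOn_jet (u v w : E) :
    ContDiffOn ℝ ∞ (fun y => jet (g.local x) y u v w) (chart E x).target :=
  ((g.contDiffOn_local x v w).fderiv_of_isOpen (isOpen_extChartAt_target x) (m := ∞)
    (by simp)).clm_apply contDiffOn_const

lemma HermitianMetric.contDiffOn_det_gram :
    ContDiffOn ℝ ∞ (fun y => (gram (g.local x y)).det) (chart E x).target :=
  contDiffOn_det fun _ _ => g.contDiffOn_local x _ _

lemma HermitianMetric.contDiffOn_gram_inv (i j) :
    ContDiffOn ℝ ∞ (fun y => (gram (g.local x y))⁻¹ i j) (chart E x).target := by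
  simp only [Matrix.inv_def, Ring.inverse_eq_inv', Matrix.smul_apply, smul_eq_mul,
    Matrix.adjugate_apply]
  refine ((g.contDiffOn_det_gram x).inv fun y hy =>
    (g.isHermitianInner_local hy).det_gram_pos.ne').mul (contDiffOn_det fun a b => ?_)
  by_cases h : a = j
  · subst h
    simp only [Matrix.updateRow_self]
    exact contDiffOn_const
  · simp only [Matrix.updateRow_ne h]
    exact g.contDiffOn_local x _ _

lemma HermitianMetric.contDiffOn_mtrace {T : E → E → E → ℝ}
    (hT : ∀ a b, ContDiffOn ℝ ∞ (fun y => T y a b) (chart E x).target) :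
    ContDiffOn ℝ ∞ (fun y => mtrace (g.local x y) (T y)) (chart E x).target :=
  ContDiffOn.sum fun _ _ => ContDiffOn.sum fun _ _ => (g.contDiffOn_gram_inv x _ _).mul (hT _ _)

lemma HermitianMetric.contDiffOn_sharpFun {α : E → E → ℝ}
    (hα : ∀ a, ContDiffOn ℝ ∞ (fun y => α y a) (chart E x).target) :
    ContDiffOn ℝ ∞ (fun y => sharpFun (g.local x y) (α y)) (chart E x).target :=
  ContDiffOn.sum fun _ _ => ContDiffOn.sum fun _ _ =>
    ((g.contDiffOn_gram_inv x _ _).mul (hα _)).smul contDiffOn_const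

lemma HermitianMetric.contDiffOn_symbol (u v : E) :
    ContDiffOn ℝ ∞ (fun y => g.symbol x y u v) (chart E x).target := by
  refine g.contDiffOn_sharpFun x fun w => ?_
  have h := g.contDiffOn_jet x
  exact (contDiffOn_const.mul (((h _ _ _).add (h _ _ _)).sub (h _ _ _))).sub
    (contDiffOn_const.mul (((h _ _ _).sub (h _ _ _)).add (h _ _ _)))

lemma HermitianMetric.contDiffOn_fderiv_logNorm (Ω : HolomorphicVolumeForm E X) (u : E) :
    ContDiffOn ℝ ∞ (fun y => fderiv ℝ (g.logNorm Ω x) y u) (chart E x).target := by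
  refine ContDiffOn.congr ?_ fun y hy => (g.hasFDerivAt_logNorm Ω hy).2 u
  have hU := isOpen_extChartAt_target (I := 𝓘(ℝ, E)) x
  have h1 : ContDiffOn ℂ ∞ (Ω.coeff x) (chart E x).target :=
    contDiffOn_of_differentiableOn_complex hU (Ω.differentiableOn_coeff x)
  have h2 : ContDiffOn ℂ ∞ (fun y => fderiv ℂ (Ω.coeff x) y u / Ω.coeff x y) (chart E x).target :=
    ((h1.fderiv_of_isOpen hU (m := ∞) (by simp)).clm_apply contDiffOn_const).div h1
      fun y hy => Ω.coeff_ne_zero hy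
  exact (Complex.reCLM.contDiff.comp_contDiffOn (h2.restrict_scalars ℝ)).sub
    (contDiffOn_const.mul (g.contDiffOn_mtrace x fun a b => g.contDiffOn_jet x _ _ _))

lemma HermitianMetric.contDiffOn_defect (Ω : HolomorphicVolumeForm E X) (u : E) :
    ContDiffOn ℝ ∞ (fun y => g.defect Ω x y u) (chart E x).target :=
  ((g.contDiffOn_mtrace x fun _ _ => g.contDiffOn_jet x _ _ _).add
    (contDiffOn_const.mul (g.contDiffOn_mtrace x fun _ _ => g.contDiffOn_jet x _ _ _))).add
    (g.contDiffOn_fderiv_logNorm x Ω _)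

lemma HermitianMetric.isLinearMap_defect (Ω : HolomorphicVolumeForm E X) {y : E}
    (hy : y ∈ (chart E x).target) : IsLinearMap ℝ (g.defect Ω x y) where
  map_add u v := by
    simp only [HermitianMetric.defect, HermitianMetric.localCodiff, smul_add, map_add,
      kahlerCodiff_add (g.isHermitianAt_local hy).isHermitianJet]
    ring
  map_smul c u := by
    simp only [HermitianMetric.defect, HermitianMetric.localCodiff, smul_comm Complex.I c,
      map_smul, kahlerCodiff_smul (g.isHermitianAt_local hy).isHermitianJet, smul_eq_mul]
    ring

lemma _root_.IsLinearMap.eq_sum_realBasis {F : Type*} [AddCommGroup F] [Module ℝ F] {f : E → F}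
    (hf : IsLinearMap ℝ f) (u : E) : f u = ∑ i, (realBasis E).repr u i • f (realBasis E i) := by
  conv_lhs => rw [← (realBasis E).sum_repr u]
  exact (map_sum (hf.mk' f) _ _).trans (Finset.sum_congr rfl fun i _ => hf.map_smul _ _)

/-- The form `d*ω - d^c log ‖Ω‖` in the preferred chart at `x`, as a continuous linear form. (The
formula makes it linear also outside of the target of the chart.) -/
def HermitianMetric.defectForm (Ω : HolomorphicVolumeForm E X) (y : E) : E →L[ℝ] ℝ :=
  haveI : FiniteDimensional ℝ E := FiniteDimensional.complexToReal E
  ∑ i, (g.defect Ω x y (realBasis E i)) • LinearMap.toContinuousLinearMap ((realBasis E).coord i)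

lemma HermitianMetric.defectForm_apply (Ω : HolomorphicVolumeForm E X) {y : E}
    (hy : y ∈ (chart E x).target) (u : E) : g.defectForm x Ω y u = g.defect Ω x y u := by
  rw [(g.isLinearMap_defect x Ω hy).eq_sum_realBasis]
  simp [HermitianMetric.defectForm, sum_apply, mul_comm]

lemma HermitianMetric.contDiffOn_defectForm (Ω : HolomorphicVolumeForm E X) :
    ContDiffOn ℝ ∞ (g.defectForm x Ω) (chart E x).target :=
  ContDiffOn.sum fun _ _ => (g.contDiffOn_defect x Ω _).smul contDiffOn_const

/-- The Bismut symbols, as a continuous bilinear map. -/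
def HermitianMetric.symbolMap (y : E) : E →L[ℝ] E →L[ℝ] E :=
  haveI : FiniteDimensional ℝ E := FiniteDimensional.complexToReal E
  ∑ i, ∑ j, (LinearMap.toContinuousLinearMap ((realBasis E).coord i)).smulRight
    ((LinearMap.toContinuousLinearMap ((realBasis E).coord j)).smulRight
      (g.symbol x y (realBasis E i) (realBasis E j)))

lemma HermitianMetric.symbolMap_apply {y : E} (hy : y ∈ (chart E x).target) (u v : E) :
    g.symbolMap x y u v = g.symbol x y u v := by
  have hG := g.isHermitianAt_local hy
  have h1 : ∀ u, IsLinearMap ℝ (g.symbol x y u) := fun u =>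
    ⟨bismutSymbol_add_right hG.self hG.isHermitianJet u,
      fun c => bismutSymbol_smul_right hG.self hG.isHermitianJet u c⟩
  have h2 : ∀ v, IsLinearMap ℝ (fun u => g.symbol x y u v) := fun v =>
    ⟨fun u u' => bismutSymbol_add_left hG.self hG.isHermitianJet u u' v,
      fun c u => bismutSymbol_smul_left hG.self hG.isHermitianJet c u v⟩
  rw [(h2 v).eq_sum_realBasis u]
  simp only [HermitianMetric.symbolMap, sum_apply]
  refine Finset.sum_congr rfl fun i _ => ?_
  rw [(h1 (realBasis E i)).eq_sum_realBasis v, Finset.smul_sum]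
  exact Finset.sum_congr rfl fun j _ => rfl

lemma HermitianMetric.continuousOn_symbolMap :
    ContinuousOn (g.symbolMap x) (chart E x).target := by
  refine continuousOn_finsetSum _ fun i _ => continuousOn_finsetSum _ fun j _ => ?_
  refine (ContinuousLinearMap.smulRightL ℝ E (E →L[ℝ] E) _).continuous.comp_continuousOn ?_
  exact (ContinuousLinearMap.smulRightL ℝ E E _).continuous.comp_continuousOn
    (g.contDiffOn_symbol x _ _).continuousOn

end Regularity

/-! ### Parallel transport along short segments -/

section Segment

variable {E : Type*} [NormedAddCommGroup E] [NormedSpace ℂ E] [FiniteDimensional ℂ E]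
  {X : Type*} [TopologicalSpace X] [ChartedSpace E X] [IsManifold 𝓘(ℂ, E) ω X]

/-- The curve that is a segment in the preferred chart at `x`. -/
def chartSegment (x : X) (a b : E) (t : ℝ) : X := (chart E x).symm (AffineMap.lineMap a b t)

lemma hasDerivAt_segment (a b : E) (t : ℝ) :
    HasDerivAt (fun s : ℝ => (AffineMap.lineMap a b s : E)) (b - a) t := AffineMap.hasDerivAt_lineMap

variable {x : X} {a b : E}

lemma contMDiffOn_chartSegment
    (hσ : ∀ t ∈ Icc (0 : ℝ) 1, AffineMap.lineMap a b t ∈ (chart E x).target) :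
    ContMDiffOn 𝓘(ℝ, ℝ) 𝓘(ℝ, E) ∞ (chartSegment x a b) (Icc 0 1) := by
  have h : ContDiff ℝ ∞ fun t : ℝ => (AffineMap.lineMap a b t : E) := by
    simp only [AffineMap.lineMap_apply_module']
    fun_prop
  exact (contMDiffOn_extChartAt_symm x).comp h.contMDiff.contMDiffOn hσ

lemma chart_chartSegment {t : ℝ} (ht : AffineMap.lineMap a b t ∈ (chart E x).target) :
    chart E x (chartSegment x a b t) = AffineMap.lineMap a b t := (chart E x).right_inv ht

lemma chartSegment_mem {t : ℝ} (ht : AffineMap.lineMap a b t ∈ (chart E x).target) :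
    chartSegment x a b t ∈ (chart E x).source := (chart E x).map_target ht

lemma velocity_chartSegment
    (hσ : ∀ t ∈ Icc (0 : ℝ) 1, AffineMap.lineMap a b t ∈ (chart E x).target) {t : ℝ}
    (ht : t ∈ Icc (0 : ℝ) 1) : velocity (chartSegment x a b) t =
      jac x (chartSegment x a b t) (AffineMap.lineMap a b t) (b - a) := by
  have h1 := hasDerivWithinAt_chart (contMDiffOn_chartSegment hσ) ht
  have h2 : HasDerivAt (fun s => chart E (chartSegment x a b t) (chartSegment x a b s))
      (jac x (chartSegment x a b t) (AffineMap.lineMap a b t) (b - a)) t :=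
    HasFDerivAt.comp_hasDerivAt (l := transition x (chartSegment x a b t)) t
      (hasFDerivAt_transition_real (mem_overlap_self (hσ t ht))) (hasDerivAt_segment a b t)
  exact (uniqueDiffOn_Icc_zero_one t ht).eq_deriv _ h1 h2.hasDerivWithinAt

variable (g : HermitianMetric E X)

/-- A solution of the equation of the parallel fields in a fixed chart is parallel. -/
lemma HermitianMetric.isParallelAlong_chartSegment
    (hσ : ∀ t ∈ Icc (0 : ℝ) 1, AffineMap.lineMap a b t ∈ (chart E x).target) {w : ℝ → E}
    (hw : ∀ t ∈ Icc (0 : ℝ) 1, HasDerivWithinAt w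
      (-g.symbol x (AffineMap.lineMap a b t) (b - a) (w t)) (Icc 0 1) t) :
    IsParallelAlong g.bismut (chartSegment x a b)
      (fun t => jac x (chartSegment x a b t) (AffineMap.lineMap a b t) (w t)) := by
  refine (g.isParallelAlong_iff (contMDiffOn_chartSegment hσ) _).2 fun t ht => ?_
  set x' := chartSegment x a b t with hx'
  set y : E := AffineMap.lineMap a b t with hy
  have hyt : y ∈ overlap x x' := mem_overlap_self (hσ t ht)
  have hty : transition x x' y = chart E x' x' := rfl
  rw [velocity_chartSegment hσ ht]
  have h1 := g.symbol_transition hyt (b - a) (w t)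
  rw [hty] at h1
  rw [← hx', ← hy, ← sub_eq_iff_eq_add.2 h1]
  have hj : HasDerivWithinAt (fun s : ℝ => jac x x' (AffineMap.lineMap a b s))
      (fderiv ℂ (jac x x') y (b - a)) (Icc 0 1) t :=
    HasFDerivAt.comp_hasDerivWithinAt (l := jac x x')
      (l' := (fderiv ℂ (jac x x') y).restrictScalars ℝ) t
      ((differentiableAt_jac hyt).hasFDerivAt.restrictScalars ℝ)
      (hasDerivAt_segment a b t).hasDerivWithinAt
  let R := ContinuousLinearMap.restrictScalarsL ℂ E E ℝ ℝ
  have hj' : HasDerivWithinAt (fun s : ℝ => R (jac x x' (AffineMap.lineMap a b s)))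
      (R (fderiv ℂ (jac x x') y (b - a))) (Icc 0 1) t := R.hasFDerivAt.comp_hasDerivWithinAt t hj
  have h2 := hj'.clm_apply (hw t ht)
  refine (h2.congr_of_eventuallyEq_of_mem ?_ ht).congr_deriv ?_
  · filter_upwards [eventually_mem_source (contMDiffOn_chartSegment hσ) ht, self_mem_nhdsWithin]
      with s hs hs'
    exact jac_comp_jac (mem_overlap_self (hσ s hs')) ⟨hσ s hs', hs⟩ (w s)
  · have h3 : ∀ p q : E, q + jac x x' y (-p) = -(jac x x' y p - q) := fun p q => by
      rw [map_neg]; abel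
    exact h3 _ _

/-- The linear equation `A' = -C(t) A` with a small coefficient has a solution on `[0, 1]`. -/
lemma exists_linear_flow {F : Type*} [NormedAddCommGroup F] [NormedSpace ℝ F] [CompleteSpace F]
    {C : ℝ → F →L[ℝ] F} (hC : ContinuousOn C (Icc 0 1)) (hb : ∀ t ∈ Icc (0 : ℝ) 1, ‖C t‖ ≤ 1 / 2) :
    ∃ A : ℝ → F →L[ℝ] F, A 0 = ContinuousLinearMap.id ℝ F ∧
      ∀ t ∈ Icc (0 : ℝ) 1, HasDerivWithinAt A (-(C t).comp (A t)) (Icc 0 1) t := by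
  have h : IsPicardLindelof (fun t (A : F →L[ℝ] F) => -(C t).comp A)
      (⟨0, by simp⟩ : Icc (0 : ℝ) 1) (ContinuousLinearMap.id ℝ F) 1 0 1 (1 / 2) := by
    refine ⟨fun t ht => LipschitzWith.lipschitzOnWith (LipschitzWith.of_dist_le_mul fun A B => ?_),
      fun A _ => (hC.clm_comp continuousOn_const).neg, fun t ht A hA => ?_, by simp⟩
    · rw [dist_neg_neg, dist_eq_norm, dist_eq_norm, ← ContinuousLinearMap.comp_sub]
      refine (ContinuousLinearMap.opNorm_comp_le _ _).trans ?_
      exact mul_le_mul_of_nonneg_right ((hb t ht).trans (by norm_num)) (norm_nonneg _)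
    · rw [norm_neg]
      refine (ContinuousLinearMap.opNorm_comp_le _ _).trans ?_
      have h1 : ‖A‖ ≤ 2 := by
        have h2 := norm_le_of_mem_closedBall hA
        have h3 : ‖ContinuousLinearMap.id ℝ F‖ ≤ 1 := ContinuousLinearMap.norm_id_le
        simp only [NNReal.coe_one] at h2
        linarith
      have := hb t ht
      have h4 := mul_le_mul this h1 (norm_nonneg _) (by norm_num)
      simpa using h4
  exact h.exists_eq_forall_mem_Icc_hasDerivWithinAt₀

/-- The parallel transport along a short segment. -/
lemma HermitianMetric.exists_transport_chartSegment (Ω : HolomorphicVolumeForm E X)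
    (hσ : ∀ t ∈ Icc (0 : ℝ) 1, AffineMap.lineMap a b t ∈ (chart E x).target)
    (hM : ∀ t ∈ Icc (0 : ℝ) 1, ‖g.symbolMap x (AffineMap.lineMap a b t) (b - a)‖ ≤ 1 / 2) :
    ∃ P : E →L[ℝ] E, IsParallelTransport g.bismut ((chart E x).symm a) ((chart E x).symm b) P ∧
      ∀ v : Fin (finrank ℂ E) → E, Ω.at ((chart E x).symm b) (fun i => P (v i)) *
          Complex.exp (-Real.log (g.normOmega Ω ((chart E x).symm b)) : ℝ) =
        Complex.exp (-(Complex.I * (∫ᶜ y in .segment a b, g.defectForm x Ω y : ℝ))) *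
          (Ω.at ((chart E x).symm a) v *
            Complex.exp (-Real.log (g.normOmega Ω ((chart E x).symm a)) : ℝ)) := by
  have : FiniteDimensional ℝ E := FiniteDimensional.complexToReal E
  have : CompleteSpace E := FiniteDimensional.complete ℂ E
  have hlin : Continuous fun t : ℝ => (AffineMap.lineMap a b t : E) := AffineMap.lineMap_continuous
  obtain ⟨A, hA0, hA⟩ := exists_linear_flow (C := fun t : ℝ => g.symbolMap x (AffineMap.lineMap a b t)
    (b - a)) (((g.continuousOn_symbolMap x).comp hlin.continuousOn hσ).clm_apply
      continuousOn_const) hM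
  set γ := chartSegment x a b with hγdef
  have hγ := contMDiffOn_chartSegment hσ
  -- the solutions in the chart at `x`, expressed in the charts centred at the points of the curve
  let V : E → ℝ → E := fun v t =>
    jac x (γ t) (AffineMap.lineMap a b t) (A t (vecCoord x (γ 0) v))
  have hV : ∀ v, IsParallelAlong g.bismut γ (V v) := fun v => by
    refine g.isParallelAlong_chartSegment hσ fun t ht => ?_
    have h1 := (hA t ht).clm_apply (hasDerivWithinAt_const t (Icc (0 : ℝ) 1) (vecCoord x (γ 0) v))
    refine h1.congr_deriv ?_
    rw [← g.symbolMap_apply x (hσ t ht)]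
    simp
  have h0 : ∀ v, V v 0 = v := fun v => by
    have h1 := jac_vecCoord (chartSegment_mem (hσ 0 (by simp))) v
    rw [chart_chartSegment (hσ 0 (by simp))] at h1
    simp only [V, hA0]
    exact h1
  let P : E →L[ℝ] E := ((jac x (γ 1) (AffineMap.lineMap a b (1 : ℝ))).restrictScalars ℝ).comp
    ((A 1).comp ((jac (γ 0) x (chart E (γ 0) (γ 0))).restrictScalars ℝ))
  have hP : ∀ v, P v = V v 1 := fun v => rfl
  have hpar : IsParallelTransport g.bismut (γ 0) (γ 1) P :=
    IsParallelTransport.segment γ hγ P fun v => ⟨V v, hV v, h0 v, rfl⟩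
  have hγ0 : γ 0 = (chart E x).symm a := by simp [hγdef, chartSegment]
  have hγ1 : γ 1 = (chart E x).symm b := by simp [hγdef, chartSegment]
  rw [← hγ0, ← hγ1]
  refine ⟨P, hpar, fun v => ?_⟩
  -- the phase along the segment
  let θ : ℝ → ℝ := fun t => g.defectForm x Ω (AffineMap.lineMap a b t) (b - a)
  let S : Set ℝ := (fun t : ℝ => (AffineMap.lineMap a b t : E)) ⁻¹' (chart E x).target
  have hS : IsOpen S := (isOpen_extChartAt_target x).preimage hlin
  have hθ : ContinuousOn θ S := ((g.contDiffOn_defectForm x Ω).continuousOn.comp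
    hlin.continuousOn fun t ht => ht).clm_apply continuousOn_const
  have hF : ∀ t ∈ Icc (0 : ℝ) 1, HasDerivAt (fun s => ∫ r in (0 : ℝ)..s, θ r) (θ t) t := by
    intro t ht
    refine intervalIntegral.integral_hasDerivAt_right ?_
      (hθ.stronglyMeasurableAtFilter hS t (hσ t ht)) (hθ.continuousAt (hS.mem_nhds (hσ t ht)))
    refine ContinuousOn.intervalIntegrable (hθ.mono ?_)
    rw [uIcc_of_le ht.1]
    exact fun s hs => hσ s ⟨hs.1, hs.2.trans ht.2⟩
  -- the factor `exp (i ∫ θ)` compensates the derivative of `Ω / ‖Ω‖` along the segment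
  have hconst := eq_of_hasDerivWithinAt_zero (f := fun t =>
      (Ω.at (γ t) (fun i => V (v i) t) * Complex.exp (-Real.log (g.normOmega Ω (γ t)) : ℝ)) *
        Complex.exp (Complex.I * ((∫ r in (0 : ℝ)..t, θ r : ℝ) : ℂ))) fun t ht => by
    have h1 := g.hasDerivWithinAt_volume Ω hγ (V := fun i => V (v i)) (fun i => hV (v i)) ht
    have h2 := (((hF t ht).hasDerivWithinAt (s := Icc 0 1)).ofReal_comp.const_mul Complex.I).cexp
    refine (h1.mul h2).congr_deriv ?_
    have h3 : g.defect Ω (γ t) (chart E (γ t) (γ t)) (velocity γ t) = θ t := by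
      have h4 := g.defect_transition Ω (mem_overlap_self (hσ t ht)) (b - a)
      rw [← g.defectForm_apply x Ω (hσ t ht)] at h4
      rw [hγdef, velocity_chartSegment hσ ht]
      exact h4.symm
    rw [h3]
    ring
  have hint : ∫ᶜ y in .segment a b, g.defectForm x Ω y = ∫ r in (0 : ℝ)..1, θ r :=
    curveIntegral_segment _ _ _
  rw [hint, Complex.exp_neg]
  simp only [intervalIntegral.integral_same, Complex.ofReal_zero, mul_zero, Complex.exp_zero,
    mul_one, h0] at hconst
  rw [← hconst]
  simp only [hP]
  field_simp

end Segment

/-! ### Special holonomy makes the defect closed -/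

section Closed

/-- A `1`-form whose integrals along small triangles vanish is closed: it is the derivative of its
integral along the segments from a point. -/
lemma fderiv_symm_of_curveIntegral {E : Type*} [NormedAddCommGroup E] [NormedSpace ℝ E]
    {θ : E → E →L[ℝ] ℝ} {U : Set E} (hU : IsOpen U) (hθ : ContinuousOn θ U) {p : E} (hp : p ∈ U)
    (hd : DifferentiableAt ℝ θ p)
    (h : ∀ b ∈ U, ∀ c ∈ U, (∫ᶜ y in .segment p b, θ y) + (∫ᶜ y in .segment b c, θ y) =
      ∫ᶜ y in .segment p c, θ y) (u v : E) : fderiv ℝ θ p u v = fderiv ℝ θ p v u := by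
  refine second_derivative_symmetric_of_eventually (f := fun z => ∫ᶜ y in .segment p z, θ y)
    (f' := θ) ?_ hd.hasFDerivAt u v
  filter_upwards [hU.mem_nhds hp] with b hb
  have h1 : HasFDerivAt (fun z => ∫ᶜ y in .segment b z, θ y) (θ b) b :=
    HasFDerivAt.curveIntegral_segment_source' (by
      filter_upwards [hU.mem_nhds hb] with z hz using hθ.continuousAt (hU.mem_nhds hz))
  refine (h1.const_add (∫ᶜ y in .segment p b, θ y)).congr_of_eventuallyEq ?_
  filter_upwards [hU.mem_nhds hb] with c hc using (h b hb c hc).symm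

set_option synthInstance.maxHeartbeats 200000 in
lemma eventually_norm_lt {V F : Type*} [TopologicalSpace V] [NormedAddCommGroup F]
    [NormedSpace ℝ F] {f : V → F →L[ℝ] F →L[ℝ] F} {p : V} (hf : ContinuousAt f p) {M : ℝ}
    (h : ‖f p‖ < M) : ∀ᶠ y in 𝓝 p, ‖f y‖ < M :=
  hf.eventually (p := fun A => ‖A‖ < M)
    ((continuous_norm (E := F →L[ℝ] F →L[ℝ] F)).continuousAt.eventually (gt_mem_nhds h))

variable {E : Type*} [NormedAddCommGroup E] [NormedSpace ℂ E] [FiniteDimensional ℂ E]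
  {X : Type*} [TopologicalSpace X] [ChartedSpace E X] [IsManifold 𝓘(ℂ, E) ω X]
  (g : HermitianMetric E X) (Ω : HolomorphicVolumeForm E X)

set_option synthInstance.maxHeartbeats 200000 in
/-- Transporting `Ω / ‖Ω‖` around a small triangle multiplies it by `exp (-i ∮ θ)`. When the
holonomy is special unitary this factor is `1`, and the integral, being small, vanishes. -/
lemma HermitianMetric.fderiv_defectForm_symm (h : g.BismutHolonomyInSU) {x : X} {p : E}
    (hp : p ∈ (chart E x).target) (u v : E) :
    fderiv ℝ (g.defectForm x Ω) p u v = fderiv ℝ (g.defectForm x Ω) p v u := by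
  have : FiniteDimensional ℝ E := FiniteDimensional.complexToReal E
  have hU := isOpen_extChartAt_target (I := 𝓘(ℝ, E)) x
  have hθ : ContinuousOn (g.defectForm x Ω) (chart E x).target :=
    (g.contDiffOn_defectForm x Ω).continuousOn
  -- near `p` the symbols and `θ` are bounded by `M`; on the ball of radius `r ≤ 1 / (4 M)` transport
  -- along segments exists, and the integral of `θ` along a segment is at most `1 / 2`
  set M := ‖g.symbolMap x p‖ + ‖g.defectForm x Ω p‖ + 1 with hMdef
  have hMpos : 0 < M := by positivity
  have hev : ∀ᶠ y in 𝓝 p, y ∈ (chart E x).target ∧ ‖g.symbolMap x y‖ < M ∧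
      ‖g.defectForm x Ω y‖ < M := by
    refine (hU.eventually_mem hp).and (Filter.Eventually.and ?_ ?_)
    · refine eventually_norm_lt ((g.continuousOn_symbolMap x).continuousAt (hU.mem_nhds hp)) ?_
      rw [hMdef]; linarith [norm_nonneg (g.defectForm x Ω p)]
    · refine (hθ.continuousAt (hU.mem_nhds hp)).norm.eventually (gt_mem_nhds ?_)
      rw [hMdef]; linarith [norm_nonneg (g.symbolMap x p)]
  obtain ⟨ε, hε, hball⟩ := Metric.eventually_nhds_iff_ball.1 hev
  set r := min ε (1 / (4 * M)) with hr
  have hr0 : 0 < r := by positivity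
  have hrM : M * (2 * r) ≤ 1 / 2 := by
    have h1 : r ≤ 1 / (4 * M) := min_le_right _ _
    calc M * (2 * r) ≤ M * (2 * (1 / (4 * M))) := by gcongr
      _ = 1 / 2 := by field_simp; norm_num
  have hB : ∀ y ∈ Metric.ball p r, y ∈ (chart E x).target ∧ ‖g.symbolMap x y‖ < M ∧
      ‖g.defectForm x Ω y‖ < M := fun y hy =>
    hball y (Metric.ball_subset_ball (min_le_left _ _) hy)
  have hseg : ∀ a ∈ Metric.ball p r, ∀ b ∈ Metric.ball p r, ∀ t ∈ Icc (0 : ℝ) 1,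
      (AffineMap.lineMap a b t : E) ∈ Metric.ball p r := fun a ha b hb t ht =>
    (convex_ball p r).lineMap_mem ha hb ht
  have hsub : ∀ a ∈ Metric.ball p r, ∀ b ∈ Metric.ball p r, M * ‖b - a‖ ≤ 1 / 2 := by
    intro a ha b hb
    refine le_trans (mul_le_mul_of_nonneg_left ?_ hMpos.le) hrM
    rw [← dist_eq_norm]
    have h1 := dist_triangle_right b a p
    rw [Metric.mem_ball] at ha hb
    linarith
  let T : E → E → ℝ := fun a b => ∫ᶜ y in .segment a b, g.defectForm x Ω y
  have hT : ∀ a ∈ Metric.ball p r, ∀ b ∈ Metric.ball p r, |T a b| ≤ 1 / 2 := by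
    intro a ha b hb
    refine le_trans (show ‖∫ᶜ y in .segment a b, g.defectForm x Ω y‖ ≤ _ from
      norm_curveIntegral_segment_le (C := M) fun z hz => ?_) (hsub a ha b hb)
    rw [segment_eq_image_lineMap] at hz
    obtain ⟨t, ht, rfl⟩ := hz
    exact (hB _ (hseg a ha b hb t ht)).2.2.le
  have htr : ∀ a ∈ Metric.ball p r, ∀ b ∈ Metric.ball p r, _ := fun a ha b hb =>
    g.exists_transport_chartSegment (x := x) (a := a) (b := b) Ω
      (fun t ht => (hB _ (hseg a ha b hb t ht)).1) fun t ht =>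
      (ContinuousLinearMap.le_opNorm _ _).trans ((mul_le_mul_of_nonneg_right
        (hB _ (hseg a ha b hb t ht)).2.1.le (norm_nonneg _)).trans (hsub a ha b hb))
  have htri : ∀ a ∈ Metric.ball p r, ∀ b ∈ Metric.ball p r, ∀ c ∈ Metric.ball p r,
      T a b + T b c + T c a = 0 := by
    intro a ha b hb c hc
    obtain ⟨P₁, hP₁, h₁⟩ := htr a ha b hb
    obtain ⟨P₂, hP₂, h₂⟩ := htr b hb c hc
    obtain ⟨P₃, hP₃, h₃⟩ := htr c hc a ha
    have hP := h _ ((hP₁.trans _ _ hP₂).trans _ _ hP₃)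
    obtain ⟨Q, hQ, -, hdet⟩ := hP
    have hv := h₃ fun i => P₂ (P₁ (finBasis ℂ E i))
    rw [h₂ fun i => P₁ (finBasis ℂ E i), h₁] at hv
    have hQv : Ω.at ((chart E x).symm a) (fun i => P₃ (P₂ (P₁ (finBasis ℂ E i)))) =
        Ω.at ((chart E x).symm a) (finBasis ℂ E) := by
      have h5 := apply_eq_det_mul (Ω.at ((chart E x).symm a)) (Q : E →ₗ[ℂ] E) (finBasis ℂ E)
      rw [hdet, one_mul] at h5
      refine Eq.trans ?_ h5
      congr 1
      funext i
      exact (congrArg (fun R : E →L[ℝ] E => R (finBasis ℂ E i)) hQ).symm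
    rw [hQv, ← mul_assoc, ← mul_assoc, ← Complex.exp_add, ← Complex.exp_add] at hv
    have hne : Ω.at ((chart E x).symm a) (finBasis ℂ E) *
        Complex.exp (-Real.log (g.normOmega Ω ((chart E x).symm a)) : ℝ) ≠ 0 :=
      mul_ne_zero (Ω.apply_finBasis_ne_zero _) (Complex.exp_ne_zero _)
    have hexp := mul_right_cancel₀ hne ((one_mul _).trans hv)
    obtain ⟨m, hm⟩ := Complex.exp_eq_one_iff.1 hexp.symm
    have him := congrArg Complex.im hm
    have him' : -(T a b + T b c + T c a) = m * (2 * Real.pi) := by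
      simp [T] at him ⊢
      linarith
    -- the integral around the triangle is at most `3 / 2`, which is less than `2π`
    have hm0 : m = 0 := by
      have h1 := abs_le.1 (hT a ha b hb)
      have h2 := abs_le.1 (hT b hb c hc)
      have h3 := abs_le.1 (hT c hc a ha)
      have hpi := Real.pi_gt_three
      by_contra hm0
      have h4 : (1 : ℝ) ≤ |(m : ℝ)| := by exact_mod_cast Int.one_le_abs hm0
      have h5 : |(m : ℝ)| * (2 * Real.pi) ≤ 3 / 2 := by
        rw [← abs_of_pos (Real.two_pi_pos), ← abs_mul, ← him', abs_le]
        constructor <;> linarith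
      nlinarith
    rw [hm0, Int.cast_zero, zero_mul] at him'
    linarith
  have hpb : p ∈ Metric.ball p r := Metric.mem_ball_self hr0
  have hself : ∀ a ∈ Metric.ball p r, T a a = 0 := fun a ha => by linarith [htri a ha a ha a ha]
  refine fderiv_symm_of_curveIntegral Metric.isOpen_ball (hθ.mono fun y hy => (hB y hy).1) hpb
    (((g.contDiffOn_defectForm x Ω).contDiffAt (hU.mem_nhds hp)).differentiableAt (by simp))
    (fun b hb c hc => ?_) u v
  have h1 := htri p hpb b hb c hc
  have h2 := htri p hpb p hpb c hc
  rw [hself p hpb] at h2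
  change T p b + T b c = T p c
  linarith

end Closed

/-! ### A divergence formula -/

section Divergence

variable {E : Type*} [NormedAddCommGroup E] [NormedSpace ℂ E] [FiniteDimensional ℂ E]

/-- The divergence of a vector field on `E` for the Lebesgue measure. -/
def divergence (Z : E → E) (y : E) : ℝ :=
  ∑ j, fderiv ℝ (fun z => (realBasis E).repr (Z z) j) y (realBasis E j)

lemma divergence_smul {f : E → ℝ} {Z : E → E} {y : E} (hf : DifferentiableAt ℝ f y)
    (hZ : ∀ j, DifferentiableAt ℝ (fun z => (realBasis E).repr (Z z) j) y) :
    divergence (fun z => f z • Z z) y = fderiv ℝ f y (Z y) + f y * divergence Z y := by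
  have h : ∀ j, fderiv ℝ (fun z => (realBasis E).repr (f z • Z z) j) y (realBasis E j) =
      (realBasis E).repr (Z y) j * fderiv ℝ f y (realBasis E j) +
        f y * fderiv ℝ (fun z => (realBasis E).repr (Z z) j) y (realBasis E j) := fun j => by
    simp only [map_smul, Finsupp.smul_apply, smul_eq_mul]
    rw [fderiv_fun_mul hf (hZ j)]
    simp only [add_apply, smul_apply, smul_eq_mul]
    ring
  rw [divergence, Finset.sum_congr rfl fun j _ => h j, Finset.sum_add_distrib, ← Finset.mul_sum]
  congr 1
  conv_rhs => rw [← (realBasis E).sum_repr (Z y)]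
  rw [map_sum]
  exact Finset.sum_congr rfl fun j _ => ((fderiv ℝ f y).map_smul _ _).symm

lemma repr_sharpFun (B : E →L[ℝ] E →L[ℝ] ℝ) (α : E → ℝ) (j) :
    (realBasis E).repr (sharpFun B α) j = ∑ i, (gram B)⁻¹ i j * α (realBasis E i) := by
  simp only [sharpFun, map_sum, map_smul, Finsupp.coe_finsetSum, Finset.sum_apply,
    Finsupp.smul_apply, Basis.repr_self, smul_eq_mul, Finsupp.single_apply]
  simp

variable {G : E → E →L[ℝ] E →L[ℝ] ℝ} {y : E}

lemma IsHermitianAt.differentiableAt_repr_sharpFun (hG : IsHermitianAt G y) {β : E → E → ℝ}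
    (hβ : ∀ a, DifferentiableAt ℝ (fun z => β z a) y) (j) :
    DifferentiableAt ℝ (fun z => (realBasis E).repr (sharpFun (G z) (β z)) j) y := by
  simp only [repr_sharpFun]
  exact DifferentiableAt.fun_sum fun i _ => (hG.differentiableAt_gram_inv i j).mul (hβ _)

/-- The divergence of the field dual to a `1`-form: the derivative of the form, traced, and a term
from the derivative of the inverse metric. -/
lemma IsHermitianAt.divergence_sharpFun (hG : IsHermitianAt G y) {β : E → E → ℝ}
    (hβ : ∀ a, DifferentiableAt ℝ (fun z => β z a) y) :
    divergence (fun z => sharpFun (G z) (β z)) y =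
      mtrace (G y) (fun a b => fderiv ℝ (fun z => β z a) y b) -
        mtrace (G y) (fun a b => jet G y a (sharpFun (G y) (β y)) b) := by
  have hD := hG.isHermitianJet
  have h : ∀ j, fderiv ℝ (fun z => (realBasis E).repr (sharpFun (G z) (β z)) j) y (realBasis E j) =
      ∑ i, (gram (G y))⁻¹ i j * fderiv ℝ (fun z => β z (realBasis E i)) y (realBasis E j) -
        ∑ k, (gram (G y))⁻¹ k j * jet G y (realBasis E j) (sharpFun (G y) (β y)) (realBasis E k) := by
    intro j
    simp only [repr_sharpFun]
    have hm : ∀ i, DifferentiableAt ℝ (fun z => (gram (G z))⁻¹ i j * β z (realBasis E i)) y :=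
      fun i => (hG.differentiableAt_gram_inv i j).mul (hβ _)
    rw [fderiv_fun_sum fun i _ => hm i, sum_apply]
    have h1 : ∀ i, fderiv ℝ (fun z => (gram (G z))⁻¹ i j * β z (realBasis E i)) y (realBasis E j) =
        (gram (G y))⁻¹ i j * fderiv ℝ (fun z => β z (realBasis E i)) y (realBasis E j) -
          ∑ k, (gram (G y))⁻¹ k j * ∑ p, (gram (G y))⁻¹ i p *
            (β y (realBasis E i) * jet G y (realBasis E j) (realBasis E p) (realBasis E k)) := by
      intro i
      rw [fderiv_fun_mul (hG.differentiableAt_gram_inv i j) (hβ _)]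
      simp only [add_apply, smul_apply, smul_eq_mul, hG.fderiv_gram_inv]
      rw [mul_neg, Finset.mul_sum, sub_eq_add_neg]
      simp only [Finset.mul_sum]
      rw [Finset.sum_comm]
      congr 2
      refine Finset.sum_congr rfl fun k _ => Finset.sum_congr rfl fun p _ => ?_
      ring
    rw [Finset.sum_congr rfl fun i _ => h1 i, Finset.sum_sub_distrib]
    congr 1
    rw [Finset.sum_comm]
    refine Finset.sum_congr rfl fun k _ => ?_
    rw [← Finset.mul_sum]
    congr 1
    have hX : IsLinearMap ℝ fun v => jet G y (realBasis E j) v (realBasis E k) :=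
      ⟨fun v v' => hD.add_mid _ _ _ _, fun c v => hD.smul_mid _ _ _ _⟩
    exact (linear_sharpFun (G y) (hX.mk' _) (β y)).symm
  rw [divergence, Finset.sum_congr rfl fun j _ => h j, Finset.sum_sub_distrib]
  congr 1
  · rw [Finset.sum_comm]
    rfl
  · rw [← mtrace_flip hG.self, mtrace, Finset.sum_comm]

/-- Let `θ` be a closed `1`-form. The divergence of the field `a √det G · J θ♯` consists of the
derivative of `a` and of the codifferential of the Kähler form: the second derivatives of the
potentials of `θ` drop out, because `J` is antisymmetric. -/
lemma IsHermitianAt.divergence_smul_I (hG : IsHermitianAt G y) {a : E → ℝ} {θ : E → E → ℝ}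
    (ha : DifferentiableAt ℝ a y) (hθd : ∀ v, DifferentiableAt ℝ (fun z => θ z v) y)
    (hθl : ∀ᶠ z in 𝓝 y, IsLinearMap ℝ (θ z))
    (hclosed : ∀ u v, fderiv ℝ (fun z => θ z v) y u = fderiv ℝ (fun z => θ z u) y v) :
    divergence (fun z => (a z * √(gram (G z)).det) • (Complex.I • sharpFun (G z) (θ z))) y =
      √(gram (G y)).det * (fderiv ℝ a y (Complex.I • sharpFun (G y) (θ y)) +
        a y * kahlerCodiff (G y) (jet G y) (sharpFun (G y) (θ y))) := by
  have hD := hG.isHermitianJet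
  set v := sharpFun (G y) (θ y) with hv
  have hs := hG.hasFDerivAt_sqrt_det
  -- the field `J θ♯` is dual to the form `-θ ∘ J`
  have hJ : ∀ z, IsHermitianInner (G z) → IsLinearMap ℝ (θ z) →
      Complex.I • sharpFun (G z) (θ z) = sharpFun (G z) (fun w => -θ z (Complex.I • w)) := by
    intro z hz hl
    refine hz.ext_left fun w => ?_
    rw [hz.smul_I_left, hz.inner_sharpFun hl, hz.inner_sharpFun]
    exact ⟨fun w w' => by rw [smul_add, hl.map_add, neg_add],
      fun c w => by rw [smul_comm, hl.map_smul, smul_eq_mul, smul_eq_mul, mul_neg]⟩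
  have hJy := hJ y hG.self hθl.self_of_nhds
  have hβ : ∀ w, DifferentiableAt ℝ (fun z => -θ z (Complex.I • w)) y := fun w => (hθd _).neg
  have hcongr : (fun z => (a z * √(gram (G z)).det) • (Complex.I • sharpFun (G z) (θ z))) =ᶠ[𝓝 y]
      fun z => (a z * √(gram (G z)).det) • sharpFun (G z) (fun w => -θ z (Complex.I • w)) := by
    filter_upwards [hG.eventually, hθl] with z hz hl
    rw [hJ z hz hl]
  have hdiv : ∀ Z Z' : E → E, Z =ᶠ[𝓝 y] Z' → divergence Z y = divergence Z' y := fun Z Z' h =>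
    Finset.sum_congr rfl fun j _ => by
      have h1 : (fun z => (realBasis E).repr (Z z) j) =ᶠ[𝓝 y]
          fun z => (realBasis E).repr (Z' z) j := by
        filter_upwards [h] with z hz
        rw [hz]
      rw [h1.fderiv_eq]
  rw [hdiv _ _ hcongr, divergence_smul (f := fun z => a z * √(gram (G z)).det) (ha.mul hs.1)
    (hG.differentiableAt_repr_sharpFun hβ), hG.divergence_sharpFun hβ, ← hJy, ← hv,
    fderiv_fun_mul ha hs.1]
  have hadd : ∀ c c', fderiv ℝ (fun z => θ z (c + c')) y =
      fderiv ℝ (fun z => θ z c) y + fderiv ℝ (fun z => θ z c') y := fun c c' => by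
    have h : (fun z => θ z (c + c')) =ᶠ[𝓝 y] fun z => θ z c + θ z c' := by
      filter_upwards [hθl] with z hl using hl.map_add c c'
    rw [h.fderiv_eq, fderiv_fun_add (hθd c) (hθd c')]
  have hsmul : ∀ (r : ℝ) c, fderiv ℝ (fun z => θ z (r • c)) y = r • fderiv ℝ (fun z => θ z c) y :=
    fun r c => by
    have h : (fun z => θ z (r • c)) =ᶠ[𝓝 y] fun z => r * θ z c := by
      filter_upwards [hθl] with z hl using hl.map_smul r c
    rw [h.fderiv_eq, fderiv_const_mul (hθd c)]
  -- the symmetric derivative of the closed form, traced against `J`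
  have h1 : mtrace (G y) (fun c b => fderiv ℝ (fun z => -θ z (Complex.I • c)) y b) = 0 := by
    simp only [fderiv_fun_neg]
    refine mtrace_eq_zero hG.self ⟨fun c c' b => ?_, fun r c b => ?_, fun c b b' => ?_,
      fun r c b => ?_⟩ fun c b => ?_
    · rw [smul_add, hadd, neg_add]; rfl
    · rw [smul_comm, hsmul, ← smul_neg]; rfl
    · exact map_add _ _ _
    · exact map_smul _ _ _
    · rw [I_smul_I_smul, ← neg_one_smul ℝ c, hsmul, neg_one_smul, neg_neg, neg_apply, neg_neg]
      exact hclosed _ _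
  have h2 : mtrace (G y) (fun c b => jet G y c (Complex.I • v) b) =
      -mtrace (G y) (fun c b => jet G y c v (Complex.I • b)) := by
    rw [← mtrace_neg]
    simp only [hD.smul_I_mid]
  rw [h1, h2, kahlerCodiff]
  simp only [add_apply, smul_apply, smul_eq_mul, hs.2]
  ring

end Divergence

/-! ### The vector field whose divergence is the norm of the defect -/

section Field

variable {E : Type*} [NormedAddCommGroup E] [NormedSpace ℂ E] [FiniteDimensional ℂ E]
  {X : Type*} [TopologicalSpace X] [ChartedSpace E X] [IsManifold 𝓘(ℂ, E) ω X]
  (g : HermitianMetric E X) (Ω : HolomorphicVolumeForm E X)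

/-- The vector field dual to the form `θ = d*ω - d^c log ‖Ω‖`, in the preferred chart at `x`. -/
def HermitianMetric.dualDefect (x : X) (y : E) : E := sharpFun (g.local x y) (g.defect Ω x y)

/-- The vector density `‖Ω‖ √det g · J θ♯`, in the preferred chart at `x`. -/
def HermitianMetric.defectField (x : X) (y : E) : E :=
  (Real.exp (g.logNorm Ω x y) * √(gram (g.local x y)).det) • (Complex.I • g.dualDefect Ω x y)

lemma HermitianMetric.inner_dualDefect {x : X} {y : E} (hy : y ∈ (chart E x).target) (w : E) :
    g.local x y (g.dualDefect Ω x y) w = g.defect Ω x y w :=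
  (g.isHermitianInner_local hy).inner_sharpFun (g.isLinearMap_defect x Ω hy) w

lemma HermitianMetric.contDiffOn_logNorm (x : X) :
    ContDiffOn ℝ ∞ (g.logNorm Ω x) (chart E x).target := by
  have : FiniteDimensional ℝ E := FiniteDimensional.complexToReal E
  refine (contDiffOn_infty_iff_fderiv_of_isOpen (isOpen_extChartAt_target x)).2 ⟨fun y hy =>
    (g.hasFDerivAt_logNorm Ω hy).1.differentiableWithinAt, contDiffOn_clm_apply.2 fun u =>
    g.contDiffOn_fderiv_logNorm x Ω u⟩

lemma HermitianMetric.contDiffOn_dualDefect (x : X) :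
    ContDiffOn ℝ ∞ (g.dualDefect Ω x) (chart E x).target :=
  g.contDiffOn_sharpFun x fun _ => g.contDiffOn_defect x Ω _

lemma HermitianMetric.contDiffOn_defectField (x : X) :
    ContDiffOn ℝ ∞ (g.defectField Ω x) (chart E x).target :=
  ((g.contDiffOn_logNorm Ω x).exp.mul ((g.contDiffOn_det_gram x).sqrt fun _ hy =>
    (g.isHermitianInner_local hy).det_gram_pos.ne')).smul
    ((g.contDiffOn_dualDefect Ω x).const_smul Complex.I)

lemma HermitianMetric.fderiv_defect (x : X) {y : E} (hy : y ∈ (chart E x).target) (u v : E) :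
    fderiv ℝ (fun z => g.defect Ω x z v) y u = fderiv ℝ (g.defectForm x Ω) y u v := by
  have hU := (isOpen_extChartAt_target (I := 𝓘(ℝ, E)) x).mem_nhds hy
  have h : (fun z => g.defect Ω x z v) =ᶠ[𝓝 y] fun z => g.defectForm x Ω z v := by
    filter_upwards [hU] with z hz using (g.defectForm_apply x Ω hz v).symm
  have hd : DifferentiableAt ℝ (g.defectForm x Ω) y :=
    ((g.contDiffOn_defectForm x Ω).contDiffAt hU).differentiableAt (by simp)
  rw [h.fderiv_eq, (hd.hasFDerivAt.clm_apply (hasFDerivAt_const v y)).fderiv]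
  simp

/-- The divergence of the field is the norm of `θ`, when `θ` is closed. -/
lemma HermitianMetric.divergence_defectField (h : g.BismutHolonomyInSU) {x : X} {y : E}
    (hy : y ∈ (chart E x).target) : divergence (g.defectField Ω x) y =
      Real.exp (g.logNorm Ω x y) * √(gram (g.local x y)).det *
        g.local x y (g.dualDefect Ω x y) (g.dualDefect Ω x y) := by
  have hU := (isOpen_extChartAt_target (I := 𝓘(ℝ, E)) x).mem_nhds hy
  have hf := (g.hasFDerivAt_logNorm Ω hy).1
  have h1 := (g.isHermitianAt_local hy).divergence_smul_I (θ := g.defect Ω x) hf.exp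
    (fun v => ((g.contDiffOn_defect x Ω v).contDiffAt hU).differentiableAt (by simp))
    (by filter_upwards [hU] with z hz using g.isLinearMap_defect x Ω hz)
    (fun u v => by
      rw [g.fderiv_defect Ω x hy, g.fderiv_defect Ω x hy, g.fderiv_defectForm_symm Ω h hy])
  refine h1.trans ?_
  rw [g.inner_dualDefect Ω hy, HermitianMetric.defect, HermitianMetric.localCodiff, fderiv_exp hf,
    HermitianMetric.dualDefect]
  simp only [smul_apply, smul_eq_mul]
  ring

/-- The local expressions of `θ♯` define a global vector field. -/
lemma HermitianMetric.jac_dualDefect {x x' : X} {y : E} (hy : y ∈ overlap x x') :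
    jac x x' y (g.dualDefect Ω x y) = g.dualDefect Ω x' (transition x x' y) := by
  refine (g.isHermitianInner_local (transition_mem_target hy)).ext_left fun w => ?_
  obtain ⟨w, rfl⟩ := (jacEquiv hy).surjective w
  change g.local x' (transition x x' y) _ (jac x x' y w) = g.local x' (transition x x' y) _ (jac x x' y w)
  rw [← g.local_transition hy, g.inner_dualDefect Ω hy.1,
    g.inner_dualDefect Ω (transition_mem_target hy), g.defect_transition Ω hy]

/-- The local expressions of `Z` transform as a vector density: `√det g` contributes the absolute value
of the Jacobian determinant. -/
lemma HermitianMetric.jac_defectField {x x' : X} {y : E} (hy : y ∈ overlap x x') :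
    jac x x' y (g.defectField Ω x y) =
      |((jac x x' y).restrictScalars ℝ).det| • g.defectField Ω x' (transition x x' y) := by
  have h1 := det_gram_pullback ((jac x x' y : E →ₗ[ℂ] E).restrictScalars ℝ)
    (fun v w => g.local_transition hy v w)
  have h2 : ((jac x x' y).restrictScalars ℝ).det =
    LinearMap.det ((jac x x' y : E →ₗ[ℂ] E).restrictScalars ℝ) := rfl
  have h3 : g.logNorm Ω x y = g.logNorm Ω x' (transition x x' y) := by
    rw [HermitianMetric.logNorm, HermitianMetric.logNorm, symm_transition hy]
  rw [HermitianMetric.defectField, HermitianMetric.defectField, h1, h2, h3,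
    Real.sqrt_mul (sq_nonneg _), Real.sqrt_sq_eq_abs, ← g.jac_dualDefect Ω hy, smul_smul,
    ← (jac x x' y).map_smul]
  refine (((jac x x' y).restrictScalars ℝ).map_smul _ _).trans ?_
  congr 1
  ring

end Field

/-! ### Stokes' theorem -/

section Integral

open MeasureTheory

variable {E : Type*} [NormedAddCommGroup E] [NormedSpace ℝ E] [FiniteDimensional ℝ E]
  [MeasurableSpace E] [BorelSpace E] (μ : Measure E) [μ.IsAddHaarMeasure]

lemma integrableOn_of_eq_zero {U K : Set E} (hU : IsOpen U) (hK : IsCompact K) (hKU : K ⊆ U)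
    {F : E → ℝ} (hF : ContinuousOn F U) (h0 : ∀ y ∈ U, y ∉ K → F y = 0) : IntegrableOn F U μ := by
  have h1 : IntegrableOn F K μ := (hF.mono hKU).integrableOn_compact hK
  have h2 : IntegrableOn F (U \ K) μ :=
    integrableOn_zero.congr_fun (fun y hy => (h0 y hy.1 hy.2).symm)
      (hU.measurableSet.diff hK.measurableSet)
  have h3 := h1.union h2
  rwa [union_sdiff_cancel hKU] at h3

/-- The integral over `U` of a derivative of a function supported in a compact subset `K` of `U`
vanishes. The function may be arbitrary outside `U`. -/
lemma integral_fderiv_eq_zero {U K : Set E} (hU : IsOpen U) (hK : IsCompact K) (hKU : K ⊆ U)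
    {F : E → ℝ} (hF : ContDiffOn ℝ 1 F U) (h0 : ∀ y ∈ U, y ∉ K → F y = 0) (u : E) :
    IntegrableOn (fun y => fderiv ℝ F y u) U μ ∧ ∫ y in U, fderiv ℝ F y u ∂μ = 0 := by
  -- the extension of the function by zero is of class `C¹` on the whole space
  have hnear : ∀ y, y ∉ K → U.indicator F =ᶠ[𝓝 y] 0 := fun y hy => by
    filter_upwards [hK.isClosed.isOpen_compl.mem_nhds hy] with z hz
    by_cases hzU : z ∈ U
    · rw [indicator_of_mem hzU]; exact h0 z hzU hz
    · rw [indicator_of_notMem hzU]; rfl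
  have hin : ∀ y ∈ U, U.indicator F =ᶠ[𝓝 y] F := fun y hy => by
    filter_upwards [hU.mem_nhds hy] with z hz using indicator_of_mem hz F
  have hs : ContDiff ℝ 1 (U.indicator F) := contDiff_iff_contDiffAt.2 fun y => by
    by_cases hy : y ∈ K
    · exact (hF.contDiffAt (hU.mem_nhds (hKU hy))).congr_of_eventuallyEq (hin y (hKU hy))
    · exact contDiffAt_const.congr_of_eventuallyEq (hnear y hy)
  have hcs : HasCompactSupport (U.indicator F) := HasCompactSupport.intro hK fun y hy =>
    (hnear y hy).self_of_nhds
  have hd : HasCompactSupport fun y => fderiv ℝ (U.indicator F) y u := hcs.fderiv_apply ℝ u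
  have hi : Integrable (fun y => fderiv ℝ (U.indicator F) y u) μ :=
    ((hs.continuous_fderiv (by simp)).clm_apply continuous_const).integrable_of_hasCompactSupport hd
  have hiF : Integrable (U.indicator F) μ := hs.continuous.integrable_of_hasCompactSupport hcs
  have hzero : ∫ y, fderiv ℝ (U.indicator F) y u ∂μ = 0 := by
    have h := integral_mul_fderiv_eq_neg_fderiv_mul_of_integrable (μ := μ) (f := fun _ : E => (1 : ℝ))
      (g := U.indicator F) (v := u) (by simp) (by simpa using hi) (by simpa using hiF)
      (fun _ _ => differentiableAt_const _) (fun y _ => hs.differentiable (by simp) y)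
    simpa using h
  have heq : EqOn (fun y => fderiv ℝ (U.indicator F) y u) (fun y => fderiv ℝ F y u) U :=
    fun y hy => by simp only [(hin y hy).fderiv_eq]
  refine ⟨hi.integrableOn.congr_fun heq hU.measurableSet, ?_⟩
  rw [← setIntegral_congr_fun hU.measurableSet heq, ← hzero]
  refine setIntegral_eq_integral_of_forall_compl_eq_zero fun y hy => ?_
  rw [(hnear y fun h => hy (hKU h)).fderiv_eq]
  simp

end Integral

/-! ### The dilatino equation on a compact manifold of special holonomy -/

section Global

open MeasureTheory

variable {E : Type*} [NormedAddCommGroup E] [NormedSpace ℂ E] [FiniteDimensional ℂ E]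
  {X : Type*} [TopologicalSpace X] [ChartedSpace E X]

/-- The expression of a function in the preferred chart at `x`. -/
def pullFun (ρ : X → ℝ) (x : X) (y : E) : ℝ := ρ ((chart E x).symm y)

section Support

lemma isCompact_chart_image [CompactSpace X] {ρ : X → ℝ} {x : X}
    (hρ : tsupport ρ ⊆ (chart E x).source) : IsCompact (chart E x '' tsupport ρ) :=
  (isClosed_tsupport ρ).isCompact.image_of_continuousOn ((continuousOn_extChartAt x).mono hρ)

lemma chart_image_subset {ρ : X → ℝ} {x : X} (hρ : tsupport ρ ⊆ (chart E x).source) :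
    chart E x '' tsupport ρ ⊆ (chart E x).target := by
  rintro _ ⟨z, hz, rfl⟩
  exact (chart E x).map_source (hρ hz)

lemma symm_notMem_tsupport {ρ : X → ℝ} {x : X} {y : E} (hy : y ∈ (chart E x).target)
    (h : y ∉ chart E x '' tsupport ρ) : (chart E x).symm y ∉ tsupport ρ := fun h' =>
  h ⟨_, h', (chart E x).right_inv hy⟩

lemma fderiv_pullFun_eq_zero {ρ : X → ℝ} {x : X} {y : E} (hy : y ∈ (chart E x).target)
    (h : (chart E x).symm y ∉ tsupport ρ) : fderiv ℝ (pullFun ρ x) y = 0 := by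
  have h1 : pullFun ρ x =ᶠ[𝓝 y] fun _ => 0 := by
    filter_upwards [(continuousAt_extChartAt_symm'' hy).eventually
      ((isClosed_tsupport ρ).isOpen_compl.mem_nhds h)] with z hz
    exact image_eq_zero_of_notMem_tsupport (f := ρ) hz
  rw [h1.fderiv_eq, fderiv_fun_const]
  rfl

end Support

variable [IsManifold 𝓘(ℂ, E) ω X] (g : HermitianMetric E X) (Ω : HolomorphicVolumeForm E X)

lemma contDiffOn_pullFun {ρ : X → ℝ} (hρ : ContMDiff 𝓘(ℝ, E) 𝓘(ℝ, ℝ) ∞ ρ) (x : X) :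
    ContDiffOn ℝ ∞ (pullFun ρ x) (chart E x).target := by
  rw [← contMDiffOn_iff_contDiffOn]
  exact hρ.comp_contMDiffOn (contMDiffOn_extChartAt_symm x)

/-- The density `ρ · Z(σ)`, in the preferred chart at `x`, for functions `ρ`, `σ` and the vector
density `Z = ‖Ω‖ √det g · J θ♯`. -/
def HermitianMetric.fieldDensity (ρ σ : X → ℝ) (x : X) (y : E) : ℝ :=
  pullFun ρ x y * fderiv ℝ (pullFun σ x) y (g.defectField Ω x y)

lemma HermitianMetric.fieldDensity_eq_zero {ρ σ : X → ℝ} {x : X} {y : E}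
    (hy : y ∈ (chart E x).target)
    (h : (chart E x).symm y ∉ tsupport ρ ∨ (chart E x).symm y ∉ tsupport σ) :
    g.fieldDensity Ω ρ σ x y = 0 := by
  rcases h with h | h
  · rw [HermitianMetric.fieldDensity, pullFun, image_eq_zero_of_notMem_tsupport h, zero_mul]
  · rw [HermitianMetric.fieldDensity, fderiv_pullFun_eq_zero hy h, zero_apply, mul_zero]

/-- The local expressions of `ρ · Z(σ)` transform as a density, so that their integrals do not depend
on the chart. -/
lemma HermitianMetric.fieldDensity_transition {ρ σ : X → ℝ}
    (hσ : ContMDiff 𝓘(ℝ, E) 𝓘(ℝ, ℝ) ∞ σ) {x x' : X} {y : E} (hy : y ∈ overlap x x') :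
    g.fieldDensity Ω ρ σ x y = |((jac x x' y).restrictScalars ℝ).det| •
      g.fieldDensity Ω ρ σ x' (transition x x' y) := by
  have h1 : pullFun ρ x y = pullFun ρ x' (transition x x' y) := by
    rw [pullFun, pullFun, symm_transition hy]
  have h2 : pullFun σ x =ᶠ[𝓝 y] pullFun σ x' ∘ transition x x' := by
    filter_upwards [(isOpen_overlap x x').mem_nhds hy] with z hz
    rw [Function.comp_apply, pullFun, pullFun, symm_transition hz]
  have h3 : DifferentiableAt ℝ (pullFun σ x') (transition x x' y) :=
    ((contDiffOn_pullFun hσ x').contDiffAt ((isOpen_extChartAt_target x').mem_nhds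
      (transition_mem_target hy))).differentiableAt (by simp)
  have h4 := h3.hasFDerivAt.comp y (hasFDerivAt_transition_real hy)
  have h5 : fderiv ℝ (pullFun σ x) y (g.defectField Ω x y) =
      fderiv ℝ (pullFun σ x') (transition x x' y) (jac x x' y (g.defectField Ω x y)) := by
    rw [h2.fderiv_eq, h4.fderiv]
    rfl
  rw [HermitianMetric.fieldDensity, HermitianMetric.fieldDensity, h5, g.jac_defectField Ω hy,
    map_smul, h1, smul_eq_mul, smul_eq_mul]
  ring

lemma HermitianMetric.continuousOn_fieldDensity {ρ σ : X → ℝ}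
    (hρ : ContMDiff 𝓘(ℝ, E) 𝓘(ℝ, ℝ) ∞ ρ) (hσ : ContMDiff 𝓘(ℝ, E) 𝓘(ℝ, ℝ) ∞ σ) (x : X) :
    ContinuousOn (g.fieldDensity Ω ρ σ x) (chart E x).target :=
  (contDiffOn_pullFun hρ x).continuousOn.mul
    (((contDiffOn_pullFun hσ x).continuousOn_fderiv_of_isOpen (isOpen_extChartAt_target x)
      (by simp)).clm_apply (g.contDiffOn_defectField Ω x).continuousOn)

variable [MeasurableSpace E] [BorelSpace E] (μ : Measure E) [μ.IsAddHaarMeasure] [CompactSpace X]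

lemma HermitianMetric.integrableOn_fieldDensity {ρ σ : X → ℝ}
    (hρ : ContMDiff 𝓘(ℝ, E) 𝓘(ℝ, ℝ) ∞ ρ) (hσ : ContMDiff 𝓘(ℝ, E) 𝓘(ℝ, ℝ) ∞ σ) {x : X}
    (h : tsupport ρ ⊆ (chart E x).source ∨ tsupport σ ⊆ (chart E x).source) :
    IntegrableOn (g.fieldDensity Ω ρ σ x) (chart E x).target μ := by
  have : FiniteDimensional ℝ E := FiniteDimensional.complexToReal E
  have hU := isOpen_extChartAt_target (I := 𝓘(ℝ, E)) x
  rcases h with h | h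
  · exact integrableOn_of_eq_zero μ hU (isCompact_chart_image h) (chart_image_subset h)
      (g.continuousOn_fieldDensity Ω hρ hσ x) fun y hy hn =>
      g.fieldDensity_eq_zero Ω hy (Or.inl (symm_notMem_tsupport hy hn))
  · exact integrableOn_of_eq_zero μ hU (isCompact_chart_image h) (chart_image_subset h)
      (g.continuousOn_fieldDensity Ω hρ hσ x) fun y hy hn =>
      g.fieldDensity_eq_zero Ω hy (Or.inr (symm_notMem_tsupport hy hn))

/-- The integral of the density `ρ · Z(σ)` does not depend on the chart. -/
lemma HermitianMetric.integral_fieldDensity {ρ σ : X → ℝ}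
    (hσ : ContMDiff 𝓘(ℝ, E) 𝓘(ℝ, ℝ) ∞ σ) {x x' : X}
    (hρx : tsupport ρ ⊆ (chart E x').source) (hσx : tsupport σ ⊆ (chart E x).source) :
    ∫ y in (chart E x).target, g.fieldDensity Ω ρ σ x y ∂μ =
      ∫ y in (chart E x').target, g.fieldDensity Ω ρ σ x' y ∂μ := by
  have : FiniteDimensional ℝ E := FiniteDimensional.complexToReal E
  have hm : MeasurableSet (overlap x x' : Set E) := (isOpen_overlap x x').measurableSet
  rw [setIntegral_eq_of_subset_of_forall_sdiff_eq_zero (s := overlap x x')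
      (isOpen_extChartAt_target x).measurableSet inter_subset_left fun y hy =>
        g.fieldDensity_eq_zero Ω hy.1 (Or.inl fun h => hy.2 ⟨hy.1, hρx h⟩),
    setIntegral_eq_of_subset_of_forall_sdiff_eq_zero (s := overlap x' x)
      (isOpen_extChartAt_target x').measurableSet inter_subset_left fun y hy =>
        g.fieldDensity_eq_zero Ω hy.1 (Or.inr fun h => hy.2 ⟨hy.1, hσx h⟩)]
  have himage : transition (E := E) x x' '' overlap x x' = overlap x' x := by
    ext y
    constructor
    · rintro ⟨z, hz, rfl⟩
      exact transition_mem_overlap hz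
    · exact fun hy => ⟨_, transition_mem_overlap hy, transition_transition hy⟩
  have hinj : InjOn (transition (E := E) x x') (overlap x x') := fun y hy z hz h => by
    rw [← transition_transition hy, h, transition_transition hz]
  rw [← himage, integral_image_eq_integral_abs_det_fderiv_smul μ hm
    (fun y hy => (hasFDerivAt_transition_real hy).hasFDerivWithinAt) hinj]
  exact setIntegral_congr_fun hm fun y hy => g.fieldDensity_transition Ω hσ hy

/-- Stokes' theorem for the field `ρ Z`, with `ρ` supported in a chart. -/
lemma HermitianMetric.integral_divergence {ρ : X → ℝ} (hρ : ContMDiff 𝓘(ℝ, E) 𝓘(ℝ, ℝ) ∞ ρ) {x : X}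
    (hρx : tsupport ρ ⊆ (chart E x).source) :
    IntegrableOn (fun y => pullFun ρ x y * divergence (g.defectField Ω x) y) (chart E x).target μ ∧
    ∫ y in (chart E x).target, pullFun ρ x y * divergence (g.defectField Ω x) y ∂μ =
      -∫ y in (chart E x).target, g.fieldDensity Ω 1 ρ x y ∂μ := by
  have : FiniteDimensional ℝ E := FiniteDimensional.complexToReal E
  have hU := isOpen_extChartAt_target (I := 𝓘(ℝ, E)) x
  let c : Fin (2 * finrank ℂ E) → E →L[ℝ] ℝ := fun j =>
    LinearMap.toContinuousLinearMap ((realBasis E).coord j)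
  have hc : ∀ j, ContDiffOn ℝ ∞ (fun y => (realBasis E).repr (g.defectField Ω x y) j)
      (chart E x).target := fun j => (c j).contDiff.comp_contDiffOn (g.contDiffOn_defectField Ω x)
  have hF : ∀ j, ContDiffOn ℝ 1 (fun y => (realBasis E).repr
      (pullFun ρ x y • g.defectField Ω x y) j) (chart E x).target := fun j =>
    ((c j).contDiff.comp_contDiffOn ((contDiffOn_pullFun hρ x).smul
      (g.contDiffOn_defectField Ω x))).of_le (by simp)
  have hS := fun j => integral_fderiv_eq_zero μ hU (isCompact_chart_image hρx)
    (chart_image_subset hρx) (hF j) (fun y hy hn => by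
      rw [pullFun, image_eq_zero_of_notMem_tsupport (symm_notMem_tsupport hy hn)]
      simp) (realBasis E j)
  have hdiv : ∀ y ∈ (chart E x).target,
      ∑ j, fderiv ℝ (fun y => (realBasis E).repr (pullFun ρ x y • g.defectField Ω x y) j) y
        (realBasis E j) - g.fieldDensity Ω 1 ρ x y =
      pullFun ρ x y * divergence (g.defectField Ω x) y := fun y hy => by
    have h := divergence_smul (f := pullFun ρ x) (Z := g.defectField Ω x)
      (((contDiffOn_pullFun hρ x).contDiffAt (hU.mem_nhds hy)).differentiableAt (by simp))
      (fun j => ((hc j).contDiffAt (hU.mem_nhds hy)).differentiableAt (by simp))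
    rw [divergence] at h
    rw [h, HermitianMetric.fieldDensity, show pullFun (1 : X → ℝ) x y = 1 from rfl]
    ring
  have hi : IntegrableOn (g.fieldDensity Ω 1 ρ x) (chart E x).target μ :=
    g.integrableOn_fieldDensity Ω μ contMDiff_const hρ (Or.inr hρx)
  have hi' := integrable_finsetSum Finset.univ fun j _ => (hS j).1
  refine ⟨(IntegrableOn.sub hi' hi).congr_fun hdiv hU.measurableSet, ?_⟩
  · rw [← setIntegral_congr_fun hU.measurableSet hdiv, integral_sub hi' hi,
      integral_finsetSum _ fun j _ => (hS j).1]
    rw [Finset.sum_eq_zero fun j _ => (hS j).2, zero_sub]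

/-- The total divergence of `Z` vanishes: after the partition of unity, the terms with derivatives
of the partition functions `ρⱼ` add up to the derivative of `∑ ρⱼ = 1`. -/
lemma HermitianMetric.sum_integral_fieldDensity {ι : Type*} [Fintype ι] {ρ : ι → X → ℝ} {c : ι → X}
    (hρ : ∀ j, ContMDiff 𝓘(ℝ, E) 𝓘(ℝ, ℝ) ∞ (ρ j)) (hs : ∀ j, tsupport (ρ j) ⊆ (chart E (c j)).source)
    (h1 : ∀ z, ∑ j, ρ j z = 1) :
    ∑ j, ∫ y in (chart E (c j)).target, g.fieldDensity Ω 1 (ρ j) (c j) y ∂μ = 0 := by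
  -- insert `1 = ∑ ρₖ` into the integral in the chart `j`, and move the `k`-th term to the chart `k`
  have hL : ∀ j, ∫ y in (chart E (c j)).target, g.fieldDensity Ω 1 (ρ j) (c j) y ∂μ =
      ∑ k, ∫ y in (chart E (c k)).target, g.fieldDensity Ω (ρ k) (ρ j) (c k) y ∂μ := fun j => by
    rw [← Finset.sum_congr rfl fun k _ => g.integral_fieldDensity Ω μ (hρ j) (hs k) (hs j),
      ← integral_finsetSum _ fun k _ => g.integrableOn_fieldDensity Ω μ (hρ k) (hρ j)
        (Or.inr (hs j))]
    congr 1
    funext y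
    simp only [HermitianMetric.fieldDensity]
    rw [← Finset.sum_mul]
    simp only [pullFun, h1, Pi.one_apply]
  rw [Finset.sum_congr rfl fun j _ => hL j, Finset.sum_comm]
  refine Finset.sum_eq_zero fun k _ => ?_
  rw [← integral_finsetSum _ fun j _ => g.integrableOn_fieldDensity Ω μ (hρ k) (hρ j)
    (Or.inl (hs k))]
  have hU := isOpen_extChartAt_target (I := 𝓘(ℝ, E)) (c k)
  rw [setIntegral_congr_fun (g := fun _ => (0 : ℝ)) hU.measurableSet fun y hy => ?_]
  · simp
  · have hd : ∀ j, DifferentiableAt ℝ (pullFun (ρ j) (c k)) y := fun j =>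
      ((contDiffOn_pullFun (hρ j) (c k)).contDiffAt (hU.mem_nhds hy)).differentiableAt (by simp)
    have h2 : fderiv ℝ (fun y => ∑ j, pullFun (ρ j) (c k) y) y = 0 := by
      have : (fun y : E => ∑ j, pullFun (ρ j) (c k) y) = fun _ => 1 := funext fun y => h1 _
      rw [this, fderiv_fun_const]
      rfl
    rw [fderiv_fun_sum fun j _ => hd j] at h2
    simp only [HermitianMetric.fieldDensity]
    rw [← Finset.mul_sum, ← sum_apply, h2, zero_apply, mul_zero]

end Global

section Conclusion

open MeasureTheory

variable {E : Type*} [NormedAddCommGroup E] [NormedSpace ℂ E] [FiniteDimensional ℂ E]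
  {X : Type*} [TopologicalSpace X] [T2Space X] [CompactSpace X] [ChartedSpace E X]
  [IsManifold 𝓘(ℂ, E) ω X] (g : HermitianMetric E X) (Ω : HolomorphicVolumeForm E X)

/-- The vector density `‖Ω‖ √det g · J θ♯` has total divergence zero and its divergence is a
positive multiple of `|θ|²`. -/
lemma HermitianMetric.defect_eq_zero (h : g.BismutHolonomyInSU) {x : X} {y : E}
    (hy : y ∈ (chart E x).target) (u : E) : g.defect Ω x y u = 0 := by
  have : FiniteDimensional ℝ E := FiniteDimensional.complexToReal E
  let _ : MeasurableSpace E := borel E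
  have : BorelSpace E := ⟨rfl⟩
  let μ : Measure E := Measure.addHaar
  obtain ⟨t, ht⟩ := CompactSpace.elim_nhds_subcover (fun x : X => (chart E x).source)
    fun x => (isOpen_extChartAt_source x).mem_nhds (mem_extChartAt_source x)
  obtain ⟨f, hf⟩ := SmoothPartitionOfUnity.exists_isSubordinate 𝓘(ℝ, E) (isClosed_univ (X := X))
    (fun j : t => (chart E (j : X)).source) (fun j => isOpen_extChartAt_source _) (by
      intro z _
      have hz : z ∈ ⋃ x ∈ t, (chart E x).source := by rw [ht]; trivial
      simp only [mem_iUnion] at hz ⊢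
      obtain ⟨x, hx, hz⟩ := hz
      exact ⟨⟨x, hx⟩, hz⟩)
  have h1 : ∀ z, ∑ j, f j z = 1 := fun z => by
    rw [← finsum_eq_sum_of_fintype]
    exact f.sum_eq_one (mem_univ z)
  -- the nonnegative densities `ρⱼ div Z` have total integral zero, so each of them vanishes
  let F : t → E → ℝ := fun j y => pullFun (f j) (j : X) y * divergence (g.defectField Ω (j : X)) y
  have hI := fun j : t => g.integral_divergence Ω μ (f j).contMDiff (hf j)
  have hpos : ∀ (x : X) (y : E), y ∈ (chart E x).target → 0 ≤ divergence (g.defectField Ω x) y := by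
    intro x y hy
    rw [g.divergence_defectField Ω h hy]
    have hB := g.isHermitianInner_local hy
    refine mul_nonneg (by positivity) ?_
    by_cases hv : g.dualDefect Ω x y = 0
    · rw [hv, map_zero]
    · exact (hB.pos _ hv).le
  have hFpos : ∀ (j : t) (y : E), y ∈ (chart E (j : X)).target → 0 ≤ F j y := fun j y hy =>
    mul_nonneg (f.nonneg j _) (hpos _ y hy)
  have hsum : ∑ j : t, ∫ y in (chart E (j : X)).target, F j y ∂μ = 0 := by
    have h2 := g.sum_integral_fieldDensity Ω μ (fun j : t => (f j).contMDiff) hf h1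
    rw [Finset.sum_congr rfl fun j _ => (hI j).2, Finset.sum_neg_distrib, h2, neg_zero]
  have hzero : ∀ j : t, ∫ y in (chart E (j : X)).target, F j y ∂μ = 0 := fun j =>
    (Finset.sum_eq_zero_iff_of_nonneg fun j _ => setIntegral_nonneg
      (isOpen_extChartAt_target _).measurableSet (hFpos j)).1 hsum j (Finset.mem_univ j)
  -- a chart of the partition that sees the given point
  obtain ⟨j, hj⟩ : ∃ j : t, f j ((chart E x).symm y) ≠ 0 := by
    by_contra! hne
    have := h1 ((chart E x).symm y)
    rw [Finset.sum_eq_zero fun j _ => hne j] at this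
    exact zero_ne_one this
  have hjs : (chart E x).symm y ∈ (chart E (j : X)).source := hf j (subset_tsupport _ hj)
  have hyo : y ∈ overlap x (j : X) := ⟨hy, hjs⟩
  have hty := transition_mem_target hyo
  have hU := isOpen_extChartAt_target (I := 𝓘(ℝ, E)) (j : X)
  have hae : F j =ᵐ[μ.restrict (chart E (j : X)).target] 0 :=
    (setIntegral_eq_zero_iff_of_nonneg_ae ((ae_restrict_mem hU.measurableSet).mono (hFpos j))
      (hI j).1).1 (hzero j)
  have hdc : ContinuousOn (divergence (g.defectField Ω (j : X))) (chart E (j : X)).target :=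
    continuousOn_finsetSum _ fun i _ =>
      (((LinearMap.toContinuousLinearMap ((realBasis E).coord i)).contDiff.comp_contDiffOn
        (g.contDiffOn_defectField Ω (j : X))).continuousOn_fderiv_of_isOpen hU
          (by simp)).clm_apply continuousOn_const
  have hF0 := Measure.eqOn_open_of_ae_eq hae hU
    ((contDiffOn_pullFun (f j).contMDiff (j : X)).continuousOn.mul hdc) continuousOn_const hty
  have hdiv : divergence (g.defectField Ω (j : X)) (transition x j y) = 0 := by
    have h3 : pullFun (f j) (j : X) (transition x j y) ≠ 0 := by
      rw [pullFun, symm_transition hyo]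
      exact hj
    exact (mul_eq_zero.1 hF0).resolve_left h3
  rw [g.divergence_defectField Ω h hty] at hdiv
  have hB := g.isHermitianInner_local hty
  have hv : g.dualDefect Ω (j : X) (transition x j y) = 0 := by
    by_contra hv
    have h4 := hB.pos _ hv
    have h5 := Real.sqrt_pos.2 hB.det_gram_pos
    have h6 := Real.exp_pos (g.logNorm Ω (j : X) (transition x j y))
    exact (mul_pos (mul_pos h6 h5) h4).ne' hdiv
  rw [g.defect_transition Ω hyo, ← g.inner_dualDefect Ω hty, hv, map_zero, zero_apply]

end Conclusion

end CalabiYau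

end

theorem mainTheorem3 {E : Type*} [NormedAddCommGroup E] [NormedSpace ℂ E] [FiniteDimensional ℂ E]
    (hn : 2 ≤ Module.finrank ℂ E)
    {X : Type*} [TopologicalSpace X] [T2Space X] [SecondCountableTopology X] [ChartedSpace E X]
    [IsManifold 𝓘(ℂ, E) ω X] (Ω : CalabiYau.HolomorphicVolumeForm E X)
    (g : CalabiYau.HermitianMetric E X) :
    (g.IsDilatinoSolution Ω → g.BismutHolonomyInSU) ∧
      (CompactSpace X → g.BismutHolonomyInSU → g.IsDilatinoSolution Ω) := by
  refine ⟨g.bismutHolonomyInSU hn Ω, fun _ h => ?_⟩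
  exact (CalabiYau.HermitianMetric.isDilatinoSolution_iff hn g Ω).2 fun x y hy u => g.defect_eq_zero Ω h hy u
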